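/- **Theorem (Process-level convergence).** Fix integers $K,M\ge 1$ and $d\ge 2$, constants $\lambda,\xi>0$, service rates $u_m>0$, proportions $w_k>0$ ($1\le k\le K$) and $v_m>0$ ($1\le m\le M$) with $\sum_k w_k=\sum_m v_m=1$, and a matrix $(p_{k,m})$. For each $N$ let $G^N=(W^N,V^N,E^N)$ be a bipartite graph with a finite set $W^N$ of dispatchers, a set $V^N$ of $N$ servers and edges $E^N\subseteq W^N\times V^N$; each dispatcher has a type $k\in\{1,\dots,K\}$ and each server a type $m\in\{1,\dots,M\}$, and $W^N_k$, $V^N_m$ denote the sets of dispatchers of type $k$ and of servers of type $m$. Write $\mathcal N^N_w(i)=\{j:(i,j)\in E^N\}$ and $E^N_k(U)=E^N\cap(W^N_k\times U)$ for $U\subseteq V^N$. Let $\deg^N_w(i,m)$ be the number of neighbors of the dispatcher $i$ in $V^N_m$, and $\deg^N_v(k,j)$ the number of neighbors of the server $j$ in $W^N_k$. *Dynamics.* Tasks arrive at each dispatcher as independent Poisson processes of rate $\lambda$. A task arriving at a dispatcher $i$ with $|\mathcal N^N_w(i)|\ge d$ joins at once the shortest queue among $d$ distinct servers selected uniformly at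 random from $\mathcal N^N_w(i)$, ties being broken uniformly at random; if $|\mathcal N^N_w(i)|<d$ it joins a uniformly random neighbor of $i$ (and is lost if there is none). Service times at a server of type $m$ are exponential with mean $1/u_m$. Thus the queue lengths $X^N(t)=(X^N_j(t))_{j\in V^N}$ form a continuous-time Markov chain with bounded jump rates; the initial state $X^N(0)$ is an arbitrary random element of $\mathbb N_0^{V^N}$ (the initial queue lengths need not be i.i.d. or independent). The occupancy process is $$\mathbf q^N(t)=\big(q^N_{m,l}(t)\big)_{1\le m\le M,\ l\in\mathbb N_0},\qquad q^N_{m,l}(t)=\frac{1}{|V^N_m|}\,\big|\{j\in V^N_m:X^N_j(t)\ge l\}\big| .$$ *Assumptions on the graphs.* As $N\to\infty$, $|W^N|/N\to\xi$, $|W^N_k|/|W^N|\to w_k$ and $|V^N_m|/N\to v_m$; for all $k,m$, $$\frac{|E^N_k(V^N_m)|}{|W^N_k|\,|V^N_m|}\to p_{k,m},\qquad \frac{\max_{i\in W^N_k}\deg^N_w(i,m)}{\min_{i\in W^N_k}\deg^N_w(i,m)}\to1,\qquad \frac{\max_{j\in V^N_m}\deg^N_v(k,j)}{\min_{j\in V^N_m}\deg^N_v(k,j)}\to1,$$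 where $0/0$ is read as $1$ in the last two ratios; and $\delta_k:=\sum_m p_{k,m}v_m>0$ for every $k$. Moreover $\{G^N\}_N$ is *clustered proportionally sparse*: for every $\varepsilon>0$, $$\sup_{k}\ \sup_{U\subseteq V^N}\ \frac{1}{|W^N_k|}\,\Big|\Big\{i\in W^N_k:\Big|\frac{|\mathcal N^N_w(i)\cap U|}{|\mathcal N^N_w(i)|}-\frac{|E^N_k(U)|}{|E^N_k(V^N)|}\Big|\ge\varepsilon\Big\}\Big|\ \longrightarrow\ 0 .$$ *State spaces.* Let $\bar{\mathcal S}$ be the set of $\mathbf q\in[0,1]^{M\times\mathbb N_0}$ with $q_{m,0}=1$ and $q_{m,l+1}\le q_{m,l}$ for all $m,l$, and let $\mathcal S=\{\mathbf q\in\bar{\mathcal S}:\sum_{l}q_{m,l}<\infty\ \text{for all } m\}$ with the $\ell_1$-topology. *Conclusion.* Suppose that $\mathbf q^N(0)$ converges weakly (in $\ell_1$) to a deterministic $\mathbf q^\infty\in\mathcal S$. Then the system of ODEs $$\frac{dq_{m,l}(t)}{dt}=-u_m\big(q_{m,l}(t)-q_{m,l+1}(t)\big)+\lambda\xi\,\big(q_{m,l-1}(t)-q_{m,l}(t)\big)\sum_{k=1}^K\frac{p_{k,m}w_k}{\delta_k}\,\frac{\tilde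 q_{k,l-1}(t)^d-\tilde q_{k,l}(t)^d}{\tilde q_{k,l-1}(t)-\tilde q_{k,l}(t)},\qquad l\ge1,$$ with $\tilde q_{k,l}(t)=\sum_m\frac{v_mp_{k,m}}{\delta_k}q_{m,l}(t)$, $q_{m,0}(t)=1$ and $\mathbf q(0)=\mathbf q^\infty$ has a unique solution $\mathbf q(\cdot)$ on $[0,\infty)$ with values in $\bar{\mathcal S}$ (where a denominator $\tilde q_{k,l-1}-\tilde q_{k,l}$ vanishes, so does $p_{k,m}(q_{m,l-1}-q_{m,l})$, and the corresponding term is $0$). This solution takes values in $\mathcal S$ and is continuous in $\ell_1$, and for every $T>0$ the occupancy process $\mathbf q^N(\cdot)$ on $[0,T]$ converges weakly to $\mathbf q(\cdot)$ as random elements of $\mathbb D([0,T],\ell_1)$ with the Skorokhod $J_1$ topology. -/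

import Mathlib

open MeasureTheory ProbabilityTheory Filter Topology
open scoped NNReal ENNReal

noncomputable section

/-! ### Càdlàg paths on `[0, T]` and the Skorokhod `J₁` topology -/

/-- Right-continuous with left limits. (At a point with nothing to its left, or with nothing to its
right, the corresponding requirement is vacuous.) -/
def IsCadlag {ι E : Type*} [TopologicalSpace ι] [Preorder ι] [TopologicalSpace E]
    (x : ι → E) : Prop :=
  ∀ t, ContinuousWithinAt x (Set.Ici t) t ∧ ∃ a, Tendsto x (𝓝[<] t) (𝓝 a)

/-- The space `D([0, T], E)`. -/
def SkorokhodSpace (T : ℝ≥0) (E : Type*) [TopologicalSpace E] : Type _ :=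
  {x : Set.Icc (0 : ℝ≥0) T → E // IsCadlag x}

/-- The `J₁` distance: infimum over the increasing bijections `θ` of `[0, T]` of
`max (sup_t |θ t - t|) (sup_t d(x t, y (θ t)))`. -/
def j1Dist {T : ℝ≥0} {E : Type*} [PseudoEMetricSpace E]
    (x y : Set.Icc (0 : ℝ≥0) T → E) : ℝ≥0∞ :=
  ⨅ θ : Set.Icc (0 : ℝ≥0) T ≃o Set.Icc (0 : ℝ≥0) T,
    max (⨆ t, edist (θ t) t) (⨆ t, edist (x t) (y (θ t)))

theorem j1Dist_comm_le {T : ℝ≥0} {E : Type*} [PseudoEMetricSpace E]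
    (x y : Set.Icc (0 : ℝ≥0) T → E) : j1Dist x y ≤ j1Dist y x := by
  refine le_iInf fun θ => (iInf_le _ θ.symm).trans (max_le_max ?_ ?_)
  · refine iSup_le fun t => ?_
    refine le_trans ?_ (le_iSup _ (θ.symm t))
    rw [θ.apply_symm_apply, edist_comm]
  · refine iSup_le fun t => ?_
    refine le_trans ?_ (le_iSup _ (θ.symm t))
    rw [θ.apply_symm_apply, edist_comm]

theorem j1Dist_triangle {T : ℝ≥0} {E : Type*} [PseudoEMetricSpace E]
    (x y z : Set.Icc (0 : ℝ≥0) T → E) : j1Dist x z ≤ j1Dist x y + j1Dist y z := by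
  unfold j1Dist
  refine ENNReal.le_iInf_add_iInf fun θ η => (iInf_le _ (θ.trans η)).trans (max_le ?_ ?_)
  · refine iSup_le fun t => ?_
    calc edist (η (θ t)) t ≤ edist (η (θ t)) (θ t) + edist (θ t) t := edist_triangle _ _ _
      _ ≤ _ := by
        rw [add_comm]
        exact add_le_add (le_max_of_le_left (le_iSup (fun t => edist (θ t) t) t))
          (le_max_of_le_left (le_iSup (fun t => edist (η t) t) (θ t)))
  · refine iSup_le fun t => ?_
    calc edist (x t) (z (η (θ t))) ≤ edist (x t) (y (θ t)) + edist (y (θ t)) (z (η (θ t))) :=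
          edist_triangle _ _ _
      _ ≤ _ := add_le_add (le_max_of_le_right (le_iSup (fun t => edist (x t) (y (θ t))) t))
          (le_max_of_le_right (le_iSup (fun t => edist (y t) (z (η t))) (θ t)))

instance {T : ℝ≥0} {E : Type*} [PseudoEMetricSpace E] :
    PseudoEMetricSpace (SkorokhodSpace T E) where
  edist x y := j1Dist x.1 y.1
  edist_self x := by
    refine le_antisymm ((iInf_le _ (OrderIso.refl _)).trans ?_) zero_le
    simp
  edist_comm x y := le_antisymm (j1Dist_comm_le _ _) (j1Dist_comm_le _ _)
  edist_triangle x y z := j1Dist_triangle _ _ _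

instance {T : ℝ≥0} {E : Type*} [PseudoEMetricSpace E] : MeasurableSpace (SkorokhodSpace T E) :=
  borel _

instance {T : ℝ≥0} {E : Type*} [PseudoEMetricSpace E] : BorelSpace (SkorokhodSpace T E) :=
  ⟨rfl⟩

theorem IsCadlag.comp_restrict {E F : Type*} [TopologicalSpace E] [TopologicalSpace F]
    {x : ℝ≥0 → E} (hx : IsCadlag x) {f : E → F} (hf : Continuous f) (T : ℝ≥0) :
    IsCadlag (fun t : Set.Icc (0 : ℝ≥0) T => f (x t)) := by
  intro t
  obtain ⟨h1, a, ha⟩ := hx t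
  refine ⟨hf.continuousAt.comp_continuousWithinAt
    (h1.comp continuous_subtype_val.continuousWithinAt fun s hs => hs), f a, ?_⟩
  refine (hf.tendsto a).comp (ha.comp ?_)
  exact tendsto_nhdsWithin_of_tendsto_nhds_of_eventually_within _
    (continuous_subtype_val.continuousAt.tendsto.mono_left nhdsWithin_le_nhds)
    (eventually_nhdsWithin_of_forall fun s hs => hs)

/-- The restriction to `[0, T]` of a continuous path, as a point of `D([0, T], E)`. -/
def SkorokhodSpace.ofContinuous {E : Type*} [TopologicalSpace E] (T : ℝ≥0) (q : ℝ≥0 → E)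
    (hq : Continuous q) : SkorokhodSpace T E :=
  ⟨fun t => q t, fun t => ⟨(hq.comp continuous_subtype_val).continuousWithinAt, q t,
    ((hq.comp continuous_subtype_val).tendsto t).mono_left nhdsWithin_le_nhds⟩⟩

/-! ### The compatibility graphs -/

/-- A system with `N` servers: the number of dispatchers, the compatibility edges between
dispatchers and servers, the task type of each dispatcher, and the type of each server. -/
structure CompatSystem (K M N : ℕ) where
  numDisp : ℕ
  edges : Finset (Fin numDisp × Fin N)
  dispType : Fin numDisp → Fin K
  servType : Fin N → Fin M

namespace CompatSystem

variable {K M N : ℕ} (G : CompatSystem K M N)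

/-- `W_k`, the dispatchers of type `k`. -/
def dispOf (k : Fin K) : Finset (Fin G.numDisp) := Finset.univ.filter fun i => G.dispType i = k

/-- `V_m`, the servers of type `m`. -/
def servOf (m : Fin M) : Finset (Fin N) := Finset.univ.filter fun j => G.servType j = m

/-- The neighborhood of dispatcher `i`. -/
def nbr (i : Fin G.numDisp) : Finset (Fin N) := Finset.univ.filter fun j => (i, j) ∈ G.edges

/-- `E_k(U)`, the edges between dispatchers of type `k` and servers in `U`. -/
def edgesTo (k : Fin K) (U : Finset (Fin N)) : Finset (Fin G.numDisp × Fin N) :=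
  G.edges.filter fun e => e.1 ∈ G.dispOf k ∧ e.2 ∈ U

/-- The number of servers of type `m` adjacent to dispatcher `i`. -/
def degW (i : Fin G.numDisp) (m : Fin M) : ℕ :=
  ((G.servOf m).filter fun j => (i, j) ∈ G.edges).card

/-- The number of dispatchers of type `k` adjacent to server `j`. -/
def degV (k : Fin K) (j : Fin N) : ℕ :=
  ((G.dispOf k).filter fun i => (i, j) ∈ G.edges).card

/-! ### The local JSQ(`d`) policy and the queue length process -/

/-- The servers of `S` with the shortest queue. -/
def shortest (x : Fin N → ℕ) (S : Finset (Fin N)) : Finset (Fin N) :=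
  S.filter fun j => ∀ j' ∈ S, x j ≤ x j'

/-- The probability that a task arriving at dispatcher `i` is assigned to server `j` when the queue
lengths are `x`. If `i` has at least `d` neighbors, a `d`-element subset of them is selected
uniformly at random, and then one of its servers with the shortest queue uniformly at random.
Otherwise a neighbor is selected uniformly at random (if there is none, the task is lost). -/
def assignProb (d : ℕ) (x : Fin N → ℕ) (i : Fin G.numDisp) (j : Fin N) : ℝ :=
  if d ≤ (G.nbr i).card then
    (∑ S ∈ (G.nbr i).powersetCard d,
      if j ∈ shortest x S then 1 / ((shortest x S).card : ℝ) else 0) /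
        ((G.nbr i).card.choose d : ℝ)
  else if j ∈ G.nbr i then 1 / ((G.nbr i).card : ℝ) else 0

/-- The generator of the queue length process: at each dispatcher tasks arrive at rate `lam` and
are assigned by the JSQ(`d`) policy; a nonempty queue at a server of type `m` loses a task at rate
`u m`. -/
def generator (d : ℕ) (lam : ℝ) (u : Fin M → ℝ) (f : (Fin N → ℕ) → ℝ) (x : Fin N → ℕ) : ℝ :=
  (∑ i, ∑ j, lam * G.assignProb d x i j * (f (Function.update x j (x j + 1)) - f x)) +
    ∑ j, if 0 < x j then u (G.servType j) * (f (Function.update x j (x j - 1)) - f x) else 0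

/-- `X` is a queue length process of the system under the local JSQ(`d`) policy, i.e. the continuous
time Markov chain with the above generator and an arbitrary initial distribution. The jump rates
are bounded, so that the law of the chain given the initial state is characterized as the càdlàg
solution of the martingale problem for the generator on bounded functions. -/
structure IsQueueChain (d : ℕ) (lam : ℝ) (u : Fin M → ℝ) {Ω : Type*} [mΩ : MeasurableSpace Ω]
    (P : Measure Ω) (X : ℝ≥0 → Ω → Fin N → ℕ) : Prop where
  cadlag : ∀ ω, IsCadlag fun t => X t ω
  martingale : ∃ ℱ : Filtration ℝ≥0 mΩ, (∀ t, Measurable[ℱ t] (X t)) ∧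
    ∀ f : (Fin N → ℕ) → ℝ, (∃ C, ∀ x, |f x| ≤ C) →
      Martingale (fun t ω => f (X t ω) -
        ∫ s in (0 : ℝ)..t, G.generator d lam u f (X s.toNNReal ω)) ℱ P

end CompatSystem

/-! ### Occupancy -/

/-- The space `ℓ₁` over the index set `{1, …, M} × ℕ₀`, in which occupancies live. -/
abbrev OccSpace (M : ℕ) : Type := lp (fun _ : Fin M × ℕ => ℝ) 1

instance (M : ℕ) : MeasurableSpace (OccSpace M) := borel _

instance (M : ℕ) : BorelSpace (OccSpace M) := ⟨rfl⟩

/-- The set `S̄` of all families `(q m l)` in `[0, 1]` with `q m 0 = 1` that are nonincreasing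
in `l`. -/
def occSetBar (M : ℕ) : Set (Fin M × ℕ → ℝ) :=
  {q | (∀ a, q a ∈ Set.Icc (0 : ℝ) 1) ∧ (∀ m, q (m, 0) = 1) ∧ ∀ m l, q (m, l + 1) ≤ q (m, l)}

/-- The set `S` of the summable elements of `S̄`, as a subset of `ℓ₁`. -/
def occSet (M : ℕ) : Set (OccSpace M) := {q | (q : Fin M × ℕ → ℝ) ∈ occSetBar M}

namespace CompatSystem

variable {K M N : ℕ} (G : CompatSystem K M N)

/-- The fraction of the servers of type `m` with queue length at least `l`. -/
def occFun (x : Fin N → ℕ) (a : Fin M × ℕ) : ℝ :=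
  (((G.servOf a.1).filter fun j => a.2 ≤ x j).card : ℝ) / ((G.servOf a.1).card : ℝ)

theorem memℓp_occFun (x : Fin N → ℕ) : Memℓp (G.occFun x) 1 := by
  refine (memℓp_zero ?_).of_exponent_ge zero_le
  refine Set.Finite.subset ((Set.finite_univ (α := Fin M)).prod
    (Set.finite_Iic (Finset.univ.sup x))) ?_
  rintro ⟨m, l⟩ h
  refine ⟨Set.mem_univ _, ?_⟩
  by_contra hl
  apply h
  have : ((G.servOf m).filter fun j => l ≤ x j) = ∅ := by
    refine Finset.filter_false_of_mem fun j _ hj => hl ?_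
    exact hj.trans (Finset.le_sup (f := x) (Finset.mem_univ j))
  simp [occFun, this]

/-- The occupancy of the state `x`. -/
def occ (x : Fin N → ℕ) : OccSpace M := ⟨G.occFun x, G.memℓp_occFun x⟩

/-- The path on `[0, T]` of the occupancy process along a càdlàg path of the queue lengths. -/
def occPath (T : ℝ≥0) (x : ℝ≥0 → Fin N → ℕ) (hx : IsCadlag x) :
    SkorokhodSpace T (OccSpace M) :=
  ⟨fun t => G.occ (x t), hx.comp_restrict continuous_of_discreteTopology T⟩

end CompatSystem

/-! ### Conditions on sequences of systems -/

/-- `max f / min f` over `s`, where `0 / 0` is read as `1`. -/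
def maxMinRatio {α : Type*} (s : Finset α) (f : α → ℕ) : ℝ :=
  if ∀ a ∈ s, f a = 0 then 1 else ((s.sup f : ℕ) : ℝ) / ((sInf (f '' s) : ℕ) : ℝ)

/-- The numbers of dispatchers and servers of each type have the asymptotic proportions
`xi`, `w`, `v`. -/
def HasProportions {K M : ℕ} (G : ∀ N, CompatSystem K M N) (xi : ℝ) (w : Fin K → ℝ)
    (v : Fin M → ℝ) : Prop :=
  Tendsto (fun N : ℕ => ((G N).numDisp : ℝ) / N) atTop (𝓝 xi) ∧
  (∀ k, Tendsto (fun N => (((G N).dispOf k).card : ℝ) / (G N).numDisp) atTop (𝓝 (w k))) ∧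
  ∀ m, Tendsto (fun N : ℕ => (((G N).servOf m).card : ℝ) / N) atTop (𝓝 (v m))

/-- The edge densities converge to the compatibility matrix `p`, and the degrees are
asymptotically equal within each pair of types. -/
def HasCompatMatrix {K M : ℕ} (G : ∀ N, CompatSystem K M N) (p : Fin K → Fin M → ℝ) : Prop :=
  ∀ k m,
    Tendsto (fun N => (((G N).edgesTo k ((G N).servOf m)).card : ℝ) /
      (((G N).dispOf k).card * ((G N).servOf m).card)) atTop (𝓝 (p k m)) ∧
    Tendsto (fun N => maxMinRatio ((G N).dispOf k) fun i => (G N).degW i m) atTop (𝓝 1) ∧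
    Tendsto (fun N => maxMinRatio ((G N).servOf m) fun j => (G N).degV k j) atTop (𝓝 1)

/-- Clustered proportional sparsity. -/
def ClusteredProportionallySparse {K M : ℕ} (G : ∀ N, CompatSystem K M N) : Prop :=
  ∀ ε : ℝ, 0 < ε → Tendsto (fun N => ⨆ k : Fin K, ⨆ U : Finset (Fin N),
    ((((G N).dispOf k).filter fun i =>
      ε ≤ |(((G N).nbr i ∩ U).card : ℝ) / (((G N).nbr i).card : ℝ) -
        (((G N).edgesTo k U).card : ℝ) / (((G N).edgesTo k Finset.univ).card : ℝ)|).card : ℝ) /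
      (((G N).dispOf k).card : ℝ)) atTop (𝓝 0)

/-! ### The limiting system of ODEs -/

/-- `δ_k = ∑_m p_{k,m} v_m`. -/
def limDeg {K M : ℕ} (v : Fin M → ℝ) (p : Fin K → Fin M → ℝ) (k : Fin K) : ℝ :=
  ∑ m, p k m * v m

/-- `q̃_{k,l} = ∑_m (v_m p_{k,m} / δ_k) q_{m,l}`. -/
def weightedOcc {K M : ℕ} (v : Fin M → ℝ) (p : Fin K → Fin M → ℝ) (q : Fin M × ℕ → ℝ)
    (k : Fin K) (l : ℕ) : ℝ :=
  ∑ m, v m * p k m / limDeg v p k * q (m, l)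

/-- The right-hand side of the equation for `q_{m,l+1}`. Where `q̃_{k,l} = q̃_{k,l+1}`, the quotient
is `0` here; its value is then immaterial on `S̄`, because `p_{k,m} (q_{m,l} - q_{m,l+1}) = 0`. -/
def odeRHS {K M : ℕ} (d : ℕ) (lam xi : ℝ) (u v : Fin M → ℝ) (w : Fin K → ℝ)
    (p : Fin K → Fin M → ℝ) (q : Fin M × ℕ → ℝ) (m : Fin M) (l : ℕ) : ℝ :=
  -u m * (q (m, l + 1) - q (m, l + 2)) +
    lam * xi * (q (m, l) - q (m, l + 1)) * ∑ k, p k m * w k / limDeg v p k *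
      ((weightedOcc v p q k l ^ d - weightedOcc v p q k (l + 1) ^ d) /
        (weightedOcc v p q k l - weightedOcc v p q k (l + 1)))

/-- `y` is an `S̄`-valued solution on `[0, ∞)` of the system of ODEs started at `q0`. (The
equations `q_{m,0}(t) = 1` are part of the membership in `S̄`.) -/
def IsODESolution {K M : ℕ} (d : ℕ) (lam xi : ℝ) (u v : Fin M → ℝ) (w : Fin K → ℝ)
    (p : Fin K → Fin M → ℝ) (q0 : Fin M × ℕ → ℝ) (y : ℝ≥0 → Fin M × ℕ → ℝ) : Prop :=
  y 0 = q0 ∧ (∀ t, y t ∈ occSetBar M) ∧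
  ∀ (t : ℝ≥0) (m : Fin M) (l : ℕ),
    HasDerivWithinAt (fun s : ℝ => y s.toNNReal (m, l + 1))
      (odeRHS d lam xi u v w p (y t) m l) (Set.Ici 0) t

end

/-!
The proof identifies the limit of the occupancy process by its drift and takes the existence of the
limit from the processes themselves.

*Drift.* For a state `x`, the probability that a task arriving at dispatcher `i` joins a given
neighbor `j` with queue length `l` is, by exchangeability of the neighbors with equal queue lengths,
a difference quotient in the numbers of neighbors of `i` with queue length at least `l` and at least
`l + 1` (`CompatSystem.assignProb_mul`). As the degrees are of order `N`, sampling without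
replacement may be replaced by sampling with replacement, and the quotient becomes the polynomial
`geomQuot d a b = (a ^ d - b ^ d) / (a - b)` in the fractions `a`, `b` of neighbors with queues that
long (`CompatSystem.exists_card_mul_assignProb_close`). Clustered proportional sparsity replaces
these fractions by the weighted occupancies for all but a vanishing proportion of the dispatchers,
and the regularity of the degrees evaluates the remaining edge counts. So the generator applied to a
coordinate of the occupancy is close to the right-hand side of the system of ODEs, uniformly in the
state (`LimitRegime.unifClose_generator`).

*Noise.* For a bounded function with jumps of order `1 / N`, the martingale of the martingale
problem has a second moment of order `1 / N`. Doob's inequality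
(`CompatSystem.IsQueueChain.measure_exists_le`) makes it uniformly small on `[0, T]`. Applied to the
number of tasks beyond position `L` of their queues, whose drift is at most a constant times the
fraction of queues of length at least `L`, it gives uniform smallness of the tails
(`asympNull_tailSum`). Applied to the coordinates of the occupancy, it shows that the path of the
occupancy process is with high probability an approximate solution of the integrated system, in the
supremum norm over all coordinates (`asympNull_not_isApproxSol`).

*Limit.* In the supremum norm the right-hand side is Lipschitz, so that by Grönwall's inequality two
approximate solutions are close (`exists_approxSol_dist_le`). Hence solutions are unique, and paths
of the processes taken from the events of high probability converge to a solution; the uniform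
bounds on the tails make it summable, continuous in `ℓ₁`, and close to the occupancy process in `ℓ₁`
(`exists_odeSolution`). Uniform convergence implies convergence in the Skorokhod topology. That the
path of the occupancy process is a random element of the Skorokhod space, whose Borel sets are not
given by finite-dimensional projections beforehand, follows by approximation with step paths
(`measurable_skorokhod_path`).
-/

noncomputable section

/-! ### Bounded right-continuous processes -/

/-- A real process with measurable marginals and right-continuous paths, bounded by `B`. -/
structure IsBddRightCts {Ω : Type*} [MeasurableSpace Ω] (B : ℝ) (Y : ℝ≥0 → Ω → ℝ) : Prop where
  measurable : ∀ t, Measurable (Y t)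
  rightCts : ∀ ω t, ContinuousWithinAt (fun s => Y s ω) (Set.Ici t) t
  abs_le : ∀ t ω, |Y t ω| ≤ B

namespace IsBddRightCts

variable {Ω : Type*} [MeasurableSpace Ω] {B B' : ℝ} {Y Z : ℝ≥0 → Ω → ℝ}

theorem mul (hY : IsBddRightCts B Y) (hZ : IsBddRightCts B' Z) :
    IsBddRightCts (B * B') fun t ω => Y t ω * Z t ω where
  measurable t := (hY.measurable t).mul (hZ.measurable t)
  rightCts ω t := (hY.rightCts ω t).mul (hZ.rightCts ω t)
  abs_le t ω := by
    rw [abs_mul]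
    exact mul_le_mul (hY.abs_le t ω) (hZ.abs_le t ω) (abs_nonneg _)
      ((abs_nonneg _).trans (hY.abs_le t ω))

theorem sub (hY : IsBddRightCts B Y) (hZ : IsBddRightCts B' Z) :
    IsBddRightCts (B + B') fun t ω => Y t ω - Z t ω where
  measurable t := (hY.measurable t).sub (hZ.measurable t)
  rightCts ω t := (hY.rightCts ω t).sub (hZ.rightCts ω t)
  abs_le t ω := (abs_sub _ _).trans (add_le_add (hY.abs_le t ω) (hZ.abs_le t ω))

theorem const (hY : IsBddRightCts B Y) (s : ℝ≥0) : IsBddRightCts B fun _ => Y s where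
  measurable _t := hY.measurable s
  rightCts _ω _t := continuousWithinAt_const
  abs_le _t := hY.abs_le s

/-- The path at time `t` is the limit of its values at the grid points just after `t`. -/
theorem measurable_uncurry (hY : IsBddRightCts B Y) :
    Measurable fun z : ℝ≥0 × Ω => Y z.1 z.2 := by
  have hpos : ∀ n : ℕ, (0 : ℝ≥0) < (n + 1 : ℕ) := fun n => by simp
  have hτ : ∀ t : ℝ≥0, Tendsto (fun n : ℕ => (⌈t * (n + 1 : ℕ)⌉₊ : ℝ≥0) / (n + 1 : ℕ)) atTop
      (𝓝[≥] t) := fun t => by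
    have h1 : ∀ n : ℕ, t ≤ (⌈t * (n + 1 : ℕ)⌉₊ : ℝ≥0) / (n + 1 : ℕ) := fun n =>
      (le_div_iff₀ (hpos n)).2 (Nat.le_ceil _)
    refine tendsto_nhdsWithin_iff.2 ⟨?_, Eventually.of_forall h1⟩
    have h2 : Tendsto (fun n : ℕ => t + 1 / ((n : ℝ≥0) + 1)) atTop (𝓝 (t + 0)) :=
      tendsto_const_nhds.add (tendsto_one_div_add_atTop_nhds_zero_nat (𝕜 := ℝ≥0))
    rw [add_zero] at h2
    refine tendsto_of_tendsto_of_tendsto_of_le_of_le tendsto_const_nhds h2 h1 fun n => ?_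
    have h3 := (Nat.ceil_lt_add_one (a := t * (n + 1 : ℕ)) zero_le).le
    rw [div_le_iff₀ (hpos n)]
    refine h3.trans (le_of_eq ?_)
    have := (hpos n).ne'
    push_cast at this ⊢
    field_simp
  refine measurable_of_tendsto_metrizable
    (f := fun (n : ℕ) (z : ℝ≥0 × Ω) => Y ((⌈z.1 * (n + 1 : ℕ)⌉₊ : ℝ≥0) / (n + 1 : ℕ)) z.2)
    (fun n => ?_) (tendsto_pi_nhds.2 fun z => (hY.rightCts z.2 z.1).tendsto.comp (hτ z.1))
  have h1 : Measurable fun z : ℕ × Ω => Y ((z.1 : ℝ≥0) / (n + 1 : ℕ)) z.2 :=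
    measurable_from_prod_countable_right fun k => hY.measurable ((k : ℝ≥0) / (n + 1 : ℕ))
  have h2 : Measurable fun z : ℝ≥0 × Ω => ((⌈z.1 * (n + 1 : ℕ)⌉₊ : ℕ), z.2) :=
    (Nat.measurable_ceil.comp (measurable_fst.mul_const _)).prodMk measurable_snd
  exact h1.comp h2

theorem measurable_joint (hY : IsBddRightCts B Y) :
    Measurable fun z : ℝ × Ω => Y z.1.toNNReal z.2 :=
  hY.measurable_uncurry.comp
    ((measurable_real_toNNReal.comp measurable_fst).prodMk measurable_snd)

theorem measurable_path (hY : IsBddRightCts B Y) (ω : Ω) :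
    Measurable fun r : ℝ => Y r.toNNReal ω :=
  hY.measurable_joint.comp (measurable_id.prodMk measurable_const)

theorem intervalIntegrable (hY : IsBddRightCts B Y) (ω : Ω) (a b : ℝ) :
    IntervalIntegrable (fun r : ℝ => Y r.toNNReal ω) volume a b := by
  refine (intervalIntegrable_const (c := B)).mono_fun
    (hY.measurable_path ω).aestronglyMeasurable (ae_of_all _ fun r => ?_)
  rw [Real.norm_eq_abs]
  exact (hY.abs_le _ _).trans (le_abs_self B)

theorem abs_integral_le (hY : IsBddRightCts B Y) (ω : Ω) (t : ℝ≥0) :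
    |∫ r in (0 : ℝ)..t, Y r.toNNReal ω| ≤ B * t := by
  have := intervalIntegral.norm_integral_le_of_norm_le_const (a := (0 : ℝ)) (b := t)
    (f := fun r : ℝ => Y r.toNNReal ω) (C := B) fun r _ => hY.abs_le _ _
  simpa using this

theorem continuous_integral (hY : IsBddRightCts B Y) (ω : Ω) :
    Continuous fun t : ℝ => ∫ r in (0 : ℝ)..t, Y r.toNNReal ω :=
  intervalIntegral.continuous_primitive (fun a b => hY.intervalIntegrable ω a b) 0

theorem measurable_integral (hY : IsBddRightCts B Y) (t : ℝ≥0) :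
    Measurable fun ω => ∫ r in (0 : ℝ)..t, Y r.toNNReal ω := by
  have h : ∀ ω, ∫ r in (0 : ℝ)..t, Y r.toNNReal ω =
      ∫ r in Set.Ioc (0 : ℝ) t, Y r.toNNReal ω := fun ω => intervalIntegral.integral_of_le t.2
  simp_rw [h]
  exact (StronglyMeasurable.integral_prod_left
    (μ := volume.restrict (Set.Ioc (0 : ℝ) t)) (f := fun r ω => Y r.toNNReal ω)
    hY.measurable_joint.stronglyMeasurable).measurable

theorem hasDerivWithinAt_integral (hY : IsBddRightCts B Y) (ω : Ω) (t : ℝ) :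
    HasDerivWithinAt (fun t : ℝ => ∫ r in (0 : ℝ)..t, Y r.toNNReal ω) (Y t.toNNReal ω)
      (Set.Ioi t) t := by
  refine (intervalIntegral.integral_hasDerivWithinAt_right (s := Set.Ici t) (t := Set.Ioi t)
    (hY.intervalIntegrable ω _ _)
    ((hY.measurable_path ω).stronglyMeasurable.stronglyMeasurableAtFilter) ?_).mono
      Set.Ioi_subset_Ici_self
  refine ((hY.rightCts ω t.toNNReal).tendsto).comp (tendsto_nhdsWithin_iff.2 ⟨?_, ?_⟩)
  · exact continuous_real_toNNReal.continuousAt.tendsto.mono_left nhdsWithin_le_nhds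
  · filter_upwards [self_mem_nhdsWithin] with s hs
    exact Real.toNNReal_le_toNNReal (le_of_lt hs)

/-- The primitive of a bounded process, stopped at time `T`. -/
theorem integral_min (hY : IsBddRightCts B Y) (hB : 0 ≤ B) (T : ℝ≥0) :
    IsBddRightCts (B * T) fun t ω => ∫ r in (0 : ℝ)..((min t T : ℝ≥0) : ℝ), Y r.toNNReal ω where
  measurable _t := hY.measurable_integral _
  rightCts ω _t := ((hY.continuous_integral ω).comp
    (NNReal.continuous_coe.comp (continuous_id.min continuous_const))).continuousWithinAt
  abs_le _t ω := (hY.abs_integral_le ω _).trans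
    (mul_le_mul_of_nonneg_left (NNReal.coe_le_coe.2 (min_le_right _ _)) hB)

/-- The square of a primitive, through its right derivative. -/
theorem sq_integral (hY : IsBddRightCts B Y) (ω : Ω) (t : ℝ≥0) :
    (∫ r in (0 : ℝ)..t, Y r.toNNReal ω) ^ 2 =
      2 * ∫ r in (0 : ℝ)..t, Y r.toNNReal ω * ∫ v in (0 : ℝ)..r, Y v.toNNReal ω := by
  rw [← intervalIntegral.integral_const_mul]
  have h := intervalIntegral.integral_eq_sub_of_hasDeriv_right_of_le (a := 0) (b := (t : ℝ)) t.2
    (f := fun t : ℝ => (∫ r in (0 : ℝ)..t, Y r.toNNReal ω) ^ 2)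
    (f' := fun r => 2 * (Y r.toNNReal ω * ∫ v in (0 : ℝ)..r, Y v.toNNReal ω))
    ((hY.continuous_integral ω).pow 2).continuousOn (fun x hx => ?_) ?_
  · rw [h]; simp
  · have := (hY.hasDerivWithinAt_integral ω x).pow 2
    refine this.congr_deriv ?_
    simp; ring
  · exact ((hY.intervalIntegrable ω _ _).mul_continuousOn
      (hY.continuous_integral ω).continuousOn).const_mul 2

variable {P : Measure Ω} [IsProbabilityMeasure P]

theorem integrable (hY : IsBddRightCts B Y) (t : ℝ≥0) : Integrable (Y t) P :=
  Integrable.of_bound (hY.measurable t).aestronglyMeasurable B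
    (ae_of_all _ fun ω => hY.abs_le t ω)

theorem integrable_integral (hY : IsBddRightCts B Y) (t : ℝ≥0) :
    Integrable (fun ω => ∫ r in (0 : ℝ)..t, Y r.toNNReal ω) P :=
  Integrable.of_bound (hY.measurable_integral t).aestronglyMeasurable (B * t)
    (ae_of_all _ fun ω => hY.abs_integral_le ω t)

/-- Fubini for the time integral of a bounded process. -/
theorem integral_swap {F : ℝ → Ω → ℝ} {C : ℝ} {t : ℝ≥0}
    (hF : Measurable fun z : ℝ × Ω => F z.1 z.2)
    (hC : ∀ r : ℝ, 0 ≤ r → r ≤ t → ∀ ω, |F r ω| ≤ C) :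
    ∫ ω, (∫ r in (0 : ℝ)..t, F r ω) ∂P = ∫ r in (0 : ℝ)..t, ∫ ω, F r ω ∂P := by
  refine (intervalIntegral_integral_swap ?_).symm
  have : IsFiniteMeasure ((volume.restrict (Set.uIoc (0 : ℝ) t)) : Measure ℝ) :=
    isFiniteMeasure_restrict.2 (by simp [Set.uIoc])
  refine Integrable.of_bound (C := C) hF.aestronglyMeasurable ?_
  have : ∀ᵐ z : ℝ × Ω ∂((volume.restrict (Set.uIoc (0 : ℝ) t)).prod P), z.1 ∈ Set.uIoc (0 : ℝ) t :=
    Measure.quasiMeasurePreserving_fst.ae (ae_restrict_mem measurableSet_uIoc)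
  filter_upwards [this] with z hz
  rw [Set.uIoc_of_le t.coe_nonneg] at hz
  exact hC z.1 hz.1.le hz.2 z.2

end IsBddRightCts

/-! ### Second moments and a maximal inequality for the martingale problem -/

section Martingale

variable {Ω : Type*} [mΩ : MeasurableSpace Ω] {P : Measure Ω} [IsProbabilityMeasure P]
  {ℱ : Filtration ℝ≥0 mΩ}

theorem integral_mul_martingale {M : ℝ≥0 → Ω → ℝ} (hM : Martingale M ℱ P) {s t : ℝ≥0}
    (hst : s ≤ t) {Z : Ω → ℝ} (hZ : StronglyMeasurable[ℱ s] Z) {C : ℝ} (hC : ∀ ω, |Z ω| ≤ C) :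
    ∫ ω, Z ω * M t ω ∂P = ∫ ω, Z ω * M s ω ∂P := by
  have h1 := condExp_stronglyMeasurable_mul_of_bound (ℱ.le s) hZ (hM.integrable t) C
    (ae_of_all P hC)
  calc ∫ ω, Z ω * M t ω ∂P = ∫ ω, (P[Z * M t | ℱ s]) ω ∂P := (integral_condExp (ℱ.le s)).symm
    _ = ∫ ω, (Z * P[M t | ℱ s]) ω ∂P := integral_congr_ae h1
    _ = _ := by
      refine integral_congr_ae ?_
      filter_upwards [hM.2 s t hst] with ω hω
      simp [hω]

variable {B C D : ℝ} {Y g Q : ℝ≥0 → Ω → ℝ}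

/-- The second moment of the increment over `[0, t]` of the martingale `Y - ∫ g`, in the case that
also `Y ^ 2 - ∫ Q` is a martingale. -/
theorem integral_sq_martingale (hY : IsBddRightCts B Y) (hg : IsBddRightCts C g)
    (hQ : IsBddRightCts D Q) (hYm : ∀ t, Measurable[ℱ t] (Y t)) (hgm : ∀ t, Measurable[ℱ t] (g t))
    (hM : Martingale (fun t ω => Y t ω - ∫ r in (0 : ℝ)..t, g r.toNNReal ω) ℱ P)
    (hR : Martingale (fun t ω => Y t ω ^ 2 - ∫ r in (0 : ℝ)..t, Q r.toNNReal ω) ℱ P) (t : ℝ≥0) :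
    ∫ ω, (Y t ω - Y 0 ω - ∫ r in (0 : ℝ)..t, g r.toNNReal ω) ^ 2 ∂P =
      ∫ ω, (∫ r in (0 : ℝ)..t, (Q r.toNNReal ω - 2 * (Y r.toNNReal ω * g r.toNNReal ω))) ∂P := by
  have hC0 : 0 ≤ C := by
    obtain ⟨ω⟩ := nonempty_of_isProbabilityMeasure P
    exact (abs_nonneg _).trans (hg.abs_le 0 ω)
  set I : ℝ≥0 → Ω → ℝ := fun t ω => ∫ r in (0 : ℝ)..t, g r.toNNReal ω with hI
  set m : ℝ≥0 → Ω → ℝ := fun t ω => Y t ω - Y 0 ω - I t ω with hm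
  -- `I` and `m`, stopped at time `t`, are bounded processes
  have hI' : IsBddRightCts (C * t) fun s => I (min s t) := hg.integral_min hC0 t
  set m' : ℝ≥0 → Ω → ℝ := fun s ω => Y s ω - Y 0 ω - I (min s t) ω with hmm'
  have hm' : IsBddRightCts (B + B + C * t) m' := (hY.sub (hY.const 0)).sub hI'
  have hle : ∀ r : ℝ, r ∈ Set.uIcc (0 : ℝ) t → m' r.toNNReal = m r.toNNReal ∧
      (r.toNNReal : ℝ) = r := fun r hr => by
    rw [Set.uIcc_of_le t.coe_nonneg] at hr
    refine ⟨?_, Real.coe_toNNReal _ hr.1⟩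
    simp only [hmm', hm, min_eq_left (Real.toNNReal_le_iff_le_coe.2 hr.2)]
  have hmt : ∀ ω, |m t ω| ≤ B + B + C * t := fun ω => by simpa [hm, hmm'] using hm'.abs_le t ω
  have hmtm : Measurable (m t) := by simpa [hm, hmm'] using hm'.measurable t
  have hmI : Integrable (m t) P :=
    Integrable.of_bound hmtm.aestronglyMeasurable _ (ae_of_all _ hmt)
  have hIi : Integrable (I t) P := hg.integrable_integral t
  -- orthogonality of the increments of the martingale
  have hgm0 : ∀ r : ℝ, r ∈ Set.uIcc (0 : ℝ) t →
      ∫ ω, g r.toNNReal ω * m t ω ∂P = ∫ ω, g r.toNNReal ω * m' r.toNNReal ω ∂P := by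
    intro r hr
    rw [(hle r hr).1]
    rw [Set.uIcc_of_le t.coe_nonneg] at hr
    have hrt : r.toNNReal ≤ t := Real.toNNReal_le_iff_le_coe.2 hr.2
    have h := integral_mul_martingale hM hrt (hgm r.toNNReal).stronglyMeasurable
      (hg.abs_le r.toNNReal)
    have hi : ∀ s, Integrable (fun ω => g r.toNNReal ω * (Y s ω - I s ω)) P := fun s =>
      ((hY.integrable s).sub (hg.integrable_integral s)).bdd_mul
        (hg.measurable _).aestronglyMeasurable (ae_of_all _ fun ω => hg.abs_le _ ω)
    have hi0 : Integrable (fun ω => g r.toNNReal ω * Y 0 ω) P :=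
      (hY.integrable 0).bdd_mul
        (hg.measurable _).aestronglyMeasurable (ae_of_all _ fun ω => hg.abs_le _ ω)
    have e : ∀ s, ∫ ω, g r.toNNReal ω * m s ω ∂P =
        ∫ ω, g r.toNNReal ω * (Y s ω - I s ω) ∂P - ∫ ω, g r.toNNReal ω * Y 0 ω ∂P := fun s => by
      rw [← integral_sub (hi s) hi0]
      refine integral_congr_ae (ae_of_all _ fun ω => ?_)
      simp only [hm]; ring
    rw [e, e, h]
  have hY0m : ∫ ω, Y 0 ω * m t ω ∂P = 0 := by
    have h := integral_mul_martingale hM (zero_le (a := t)) (hYm 0).stronglyMeasurable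
      (hY.abs_le 0)
    simp only [NNReal.coe_zero, intervalIntegral.integral_same, sub_zero] at h
    have hi : Integrable (fun ω => Y 0 ω * (Y t ω - I t ω)) P :=
      ((hY.integrable t).sub (hg.integrable_integral t)).bdd_mul
        (hY.measurable _).aestronglyMeasurable (ae_of_all _ fun ω => hY.abs_le _ ω)
    have hi0 : Integrable (fun ω => Y 0 ω * Y 0 ω) P := (hY.mul hY).integrable 0
    have e : ∫ ω, Y 0 ω * m t ω ∂P =
        ∫ ω, Y 0 ω * (Y t ω - I t ω) ∂P - ∫ ω, Y 0 ω * Y 0 ω ∂P := by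
      rw [← integral_sub hi hi0]
      refine integral_congr_ae (ae_of_all _ fun ω => ?_)
      simp only [hm]; ring
    rw [e, h, sub_self]
  have hR0 : ∫ ω, (Y t ω ^ 2 - Y 0 ω ^ 2 - ∫ r in (0 : ℝ)..t, Q r.toNNReal ω) ∂P = 0 := by
    have h := integral_mul_martingale hR (zero_le (a := t))
      (stronglyMeasurable_const (b := (1 : ℝ))) (C := 1) (by simp)
    simp only [NNReal.coe_zero, intervalIntegral.integral_same, sub_zero, one_mul] at h
    have hi : Integrable (fun ω => Y 0 ω ^ 2) P := by
      simpa [sq] using (hY.mul hY).integrable (P := P) 0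
    have e := integral_sub (hR.integrable t) hi
    rw [h, sub_self] at e
    refine Eq.trans (integral_congr_ae (ae_of_all _ fun ω => ?_)) e
    simp only; ring
  -- the cross term, by Fubini
  have hcross : ∫ ω, m t ω * I t ω ∂P =
      ∫ ω, (∫ r in (0 : ℝ)..t, g r.toNNReal ω * m' r.toNNReal ω) ∂P := by
    have hgm' := hg.mul hm'
    have h1 : ∫ ω, (∫ r in (0 : ℝ)..t, g r.toNNReal ω * m t ω) ∂P =
        ∫ r in (0 : ℝ)..t, ∫ ω, g r.toNNReal ω * m t ω ∂P :=
      IsBddRightCts.integral_swap (C := C * (B + B + C * t))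
        (hg.measurable_joint.mul (hmtm.comp measurable_snd)) fun r _ _ ω => by
          rw [abs_mul]
          exact mul_le_mul (hg.abs_le _ _) (hmt ω) (abs_nonneg _) hC0
    have h2 : ∫ ω, (∫ r in (0 : ℝ)..t, g r.toNNReal ω * m' r.toNNReal ω) ∂P =
        ∫ r in (0 : ℝ)..t, ∫ ω, g r.toNNReal ω * m' r.toNNReal ω ∂P := by
      refine IsBddRightCts.integral_swap (C := C * (B + B + C * t))
        (F := fun r ω => g r.toNNReal ω * m' r.toNNReal ω) ?_ fun r h0 hr ω => ?_
      · exact hgm'.measurable_joint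
      · exact hgm'.abs_le _ _
    rw [h2, ← intervalIntegral.integral_congr hgm0, ← h1]
    refine integral_congr_ae (ae_of_all _ fun ω => ?_)
    simp only [hI]
    rw [intervalIntegral.integral_mul_const, mul_comm]
  -- pointwise identities
  have hpath : ∀ ω, (∫ r in (0 : ℝ)..t, (Q r.toNNReal ω - 2 * (Y r.toNNReal ω * g r.toNNReal ω)))
      = (∫ r in (0 : ℝ)..t, Q r.toNNReal ω) - 2 * (Y 0 ω * I t ω) -
        2 * (∫ r in (0 : ℝ)..t, g r.toNNReal ω * m' r.toNNReal ω) - I t ω ^ 2 := by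
    intro ω
    have i1 := hQ.intervalIntegrable ω 0 t
    have i2 := (hg.intervalIntegrable ω 0 t).const_mul (Y 0 ω)
    have i3 := (hg.mul hm').intervalIntegrable ω 0 t
    have i4 : IntervalIntegrable
        (fun r => g r.toNNReal ω * ∫ v in (0 : ℝ)..r, g v.toNNReal ω) volume 0 t :=
      (hg.intervalIntegrable ω _ _).mul_continuousOn (hg.continuous_integral ω).continuousOn
    have i5 := i1.sub (i2.const_mul 2)
    have i6 := i5.sub (i3.const_mul 2)
    rw [hg.sq_integral ω t]
    simp only [hI]
    rw [← intervalIntegral.integral_const_mul (Y 0 ω), ← intervalIntegral.integral_const_mul 2,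
      ← intervalIntegral.integral_const_mul 2, ← intervalIntegral.integral_const_mul 2,
      ← intervalIntegral.integral_sub i1 (i2.const_mul 2),
      ← intervalIntegral.integral_sub i5 (i3.const_mul 2),
      ← intervalIntegral.integral_sub i6 (i4.const_mul 2)]
    refine intervalIntegral.integral_congr fun r hr => ?_
    obtain ⟨h1, h2⟩ := hle r hr
    simp only [h1, h2, hm, hI]
    ring
  have hsq : ∀ ω, m t ω ^ 2 = (Y t ω ^ 2 - Y 0 ω ^ 2 - ∫ r in (0 : ℝ)..t, Q r.toNNReal ω) +
      ((∫ r in (0 : ℝ)..t, Q r.toNNReal ω) - 2 * (Y 0 ω * I t ω) - I t ω ^ 2)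
      - 2 * (Y 0 ω * m t ω) - 2 * (m t ω * I t ω) := fun ω => by
    simp only [hm]; ring
  have iQ : Integrable (fun ω => ∫ r in (0 : ℝ)..t, Q r.toNNReal ω) P := hQ.integrable_integral t
  have iY0I : Integrable (fun ω => Y 0 ω * I t ω) P := hIi.bdd_mul
    (hY.measurable _).aestronglyMeasurable (ae_of_all _ fun ω => hY.abs_le _ ω)
  have iI2 : Integrable (fun ω => I t ω ^ 2) P := by
    simpa [sq] using (hI'.mul hI').integrable (P := P) t
  have iR : Integrable (fun ω => Y t ω ^ 2 - Y 0 ω ^ 2 - ∫ r in (0 : ℝ)..t, Q r.toNNReal ω) P := by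
    have i1 : ∀ s, Integrable (fun ω => Y s ω ^ 2) P := fun s => by
      simpa [sq] using (hY.mul hY).integrable (P := P) s
    exact ((i1 t).sub (i1 0)).sub iQ
  have iYm : Integrable (fun ω => Y 0 ω * m t ω) P := hmI.bdd_mul
    (hY.measurable _).aestronglyMeasurable (ae_of_all _ fun ω => hY.abs_le _ ω)
  have imI : Integrable (fun ω => m t ω * I t ω) P := hIi.bdd_mul
    hmtm.aestronglyMeasurable (ae_of_all _ hmt)
  have iF : Integrable
      (fun ω => ∫ r in (0 : ℝ)..t, g r.toNNReal ω * m' r.toNNReal ω) P :=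
    (hg.mul hm').integrable_integral t
  have hA : Integrable (fun ω => (∫ r in (0 : ℝ)..t, Q r.toNNReal ω) - 2 * (Y 0 ω * I t ω) -
      I t ω ^ 2) P := (iQ.sub (iY0I.const_mul 2)).sub iI2
  have hB : Integrable (fun ω => (Y t ω ^ 2 - Y 0 ω ^ 2 - ∫ r in (0 : ℝ)..t, Q r.toNNReal ω) +
      ((∫ r in (0 : ℝ)..t, Q r.toNNReal ω) - 2 * (Y 0 ω * I t ω) - I t ω ^ 2)) P := iR.add hA
  have hD : Integrable (fun ω => (Y t ω ^ 2 - Y 0 ω ^ 2 - ∫ r in (0 : ℝ)..t, Q r.toNNReal ω) +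
      ((∫ r in (0 : ℝ)..t, Q r.toNNReal ω) - 2 * (Y 0 ω * I t ω) - I t ω ^ 2) -
      2 * (Y 0 ω * m t ω)) P := hB.sub (iYm.const_mul 2)
  calc ∫ ω, m t ω ^ 2 ∂P
      = 0 + ∫ ω, ((∫ r in (0 : ℝ)..t, Q r.toNNReal ω) - 2 * (Y 0 ω * I t ω) - I t ω ^ 2) ∂P
        - 2 * 0 - 2 * ∫ ω, m t ω * I t ω ∂P := by
        rw [integral_congr_ae (ae_of_all _ hsq),
          integral_sub hD (imI.const_mul 2),
          integral_sub hB (iYm.const_mul 2), integral_add iR hA, hR0,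
          integral_const_mul, integral_const_mul, hY0m]
    _ = ∫ ω, ((∫ r in (0 : ℝ)..t, Q r.toNNReal ω) - 2 * (Y 0 ω * I t ω) - I t ω ^ 2) ∂P
        - 2 * ∫ ω, (∫ r in (0 : ℝ)..t, g r.toNNReal ω * m' r.toNNReal ω) ∂P := by
        rw [hcross]; ring
    _ = _ := by
        rw [← integral_const_mul, ← integral_sub hA (iF.const_mul 2)]
        refine integral_congr_ae (ae_of_all _ fun ω => ?_)
        simp only [hpath ω]
        ring

/-- Doob's `L²` maximal inequality for a right-continuous martingale. -/
theorem measure_exists_le_of_martingale {M : ℝ≥0 → Ω → ℝ} (hM : Martingale M ℱ P)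
    (hrc : ∀ ω t, ContinuousWithinAt (fun s => M s ω) (Set.Ici t) t)
    (hsq : ∀ t, Integrable (fun ω => M t ω ^ 2) P) (T : ℝ≥0) {ε : ℝ} (hε : 0 < ε) :
    P {ω | ∃ t ≤ T, ε < |M t ω|} ≤ ENNReal.ofReal ((∫ ω, M T ω ^ 2 ∂P) / ε ^ 2) := by
  -- the grid `T * k / 2 ^ n`, frozen at `T`
  let τ : ℕ → ℕ → ℝ≥0 := fun n k => min T (T * (k / 2 ^ n))
  have hτmono : ∀ n, Monotone (τ n) := fun n a b hab => by
    refine min_le_min le_rfl (mul_le_mul_right ?_ T)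
    exact div_le_div_of_nonneg_right (by exact_mod_cast hab) (by positivity)
  have hτT : ∀ n, τ n (2 ^ n) = T := fun n => by
    simp only [τ]
    push_cast
    rw [div_self (by positivity), mul_one, min_self]
  let A : ℕ → Set Ω := fun n => {ω | ∃ k ≤ 2 ^ n, ε < |M (τ n k) ω|}
  have hA : ∀ n, P (A n) ≤ ENNReal.ofReal ((∫ ω, M T ω ^ 2 ∂P) / ε ^ 2) := by
    intro n
    let 𝒢 : Filtration ℕ mΩ := ⟨fun k => ℱ (τ n k), fun a b hab => ℱ.mono (hτmono n hab),
      fun k => ℱ.le _⟩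
    have hsub : Submartingale (fun k ω => M (τ n k) ω ^ 2) 𝒢 P := by
      refine ⟨fun k => (hM.stronglyMeasurable (τ n k)).pow 2, fun i j hij => ?_, fun k => hsq _⟩
      have hj := ConvexOn.map_condExp_le_univ (μ := P) (ℱ.le (τ n i)) (φ := fun x : ℝ => x ^ 2)
        (even_two.convexOn_pow) (continuous_pow 2).lowerSemicontinuous
        (hM.integrable (τ n j)) (hsq (τ n j))
      filter_upwards [hj, hM.2 _ _ (hτmono n hij)] with ω h1 h2
      simp only [Function.comp_apply, h2] at h1
      exact h1
    have hmax := maximal_ineq hsub (fun k ω => sq_nonneg _) (ε := (ε ^ 2).toNNReal) (2 ^ n)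
    have hε2 : 0 < ε ^ 2 := by positivity
    have hε3 : ENNReal.ofReal (ε ^ 2) ≠ 0 := by simpa using hε.ne'
    rw [ENNReal.ofReal_div_of_pos hε2, ENNReal.le_div_iff_mul_le (Or.inl hε3)
      (Or.inl ENNReal.ofReal_ne_top), mul_comm]
    refine le_trans (le_trans (mul_le_mul_right (measure_mono ?_) _) hmax) ?_
    · rintro ω ⟨k, hk, hω⟩
      rw [Set.mem_ofPred_eq, Real.coe_toNNReal _ hε2.le, Finset.le_sup'_iff]
      refine ⟨k, Finset.mem_range.2 (Nat.lt_succ_of_le hk), ?_⟩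
      rw [← sq_abs (M _ _)]
      exact pow_le_pow_left₀ hε.le hω.le 2
    · refine ENNReal.ofReal_le_ofReal ?_
      rw [hτT]
      exact setIntegral_le_integral (hsq T) (ae_of_all _ fun ω => sq_nonneg _)
  have hmono : Monotone A := by
    refine monotone_nat_of_le_succ fun n ω => ?_
    rintro ⟨k, hk, hω⟩
    refine ⟨2 * k, by rw [pow_succ]; omega, ?_⟩
    have : τ (n + 1) (2 * k) = τ n k := by
      simp only [τ]
      congr 2
      push_cast
      rw [pow_succ, mul_comm (2 ^ n) 2, mul_div_mul_left _ _ two_ne_zero]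
    rwa [this]
  have hcover : {ω | ∃ t ≤ T, ε < |M t ω|} ⊆ ⋃ n, A n := by
    rintro ω ⟨t, htT, hω⟩
    rcases htT.eq_or_lt with rfl | htT
    · exact Set.mem_iUnion.2 ⟨0, 1, by simp, by simpa [τ] using hω⟩
    have hT0 : 0 < T := pos_of_gt htT
    -- the grid points just after `t` converge to `t` from the right
    let s : ℕ → ℝ≥0 := fun n => τ n ⌈t / T * 2 ^ n⌉₊
    have hs1 : ∀ n, t ≤ s n := fun n => by
      refine le_min htT.le ?_
      rw [mul_comm, ← div_le_iff₀ hT0, le_div_iff₀ (by positivity)]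
      exact Nat.le_ceil _
    have hs2 : ∀ n, s n ≤ t + T * (1 / 2) ^ n := fun n => by
      refine (min_le_right _ _).trans ?_
      have h3 := (Nat.ceil_lt_add_one (a := t / T * 2 ^ n) zero_le).le
      calc T * ((⌈t / T * 2 ^ n⌉₊ : ℝ≥0) / 2 ^ n) ≤ T * ((t / T * 2 ^ n + 1) / 2 ^ n) := by
            gcongr
        _ = _ := by
            have := hT0.ne'
            rw [one_div, inv_pow]
            field_simp
    have hs : Tendsto s atTop (𝓝[≥] t) := by
      refine tendsto_nhdsWithin_iff.2 ⟨?_, Eventually.of_forall hs1⟩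
      have h2 : Tendsto (fun n : ℕ => t + T * (1 / 2 : ℝ≥0) ^ n) atTop (𝓝 (t + T * 0)) :=
        tendsto_const_nhds.add (tendsto_const_nhds.mul
          (NNReal.tendsto_pow_atTop_nhds_zero_of_lt_one (by norm_num)))
      rw [mul_zero, add_zero] at h2
      exact tendsto_of_tendsto_of_tendsto_of_le_of_le tendsto_const_nhds h2 hs1 hs2
    have h4 := ((hrc ω t).tendsto.comp hs).abs
    obtain ⟨n, hn⟩ := (h4.eventually (lt_mem_nhds hω)).exists
    refine Set.mem_iUnion.2 ⟨n, ⌈t / T * 2 ^ n⌉₊, ?_, hn⟩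
    refine Nat.ceil_le.2 ?_
    push_cast
    exact mul_le_of_le_one_left zero_le ((div_le_one₀ hT0).2 htT.le)
  calc P {ω | ∃ t ≤ T, ε < |M t ω|} ≤ P (⋃ n, A n) := measure_mono hcover
    _ = ⨆ n, P (A n) := hmono.measure_iUnion
    _ ≤ _ := iSup_le hA

end Martingale

/-! ### The generator of the queue length process -/

namespace CompatSystem

variable {K M N : ℕ} (G : CompatSystem K M N)

theorem assignProb_nonneg (d : ℕ) (x : Fin N → ℕ) (i : Fin G.numDisp) (j : Fin N) :
    0 ≤ G.assignProb d x i j := by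
  unfold assignProb
  split_ifs
  · refine div_nonneg (Finset.sum_nonneg fun S _ => ?_) (by positivity)
    split_ifs <;> positivity
  · positivity
  · exact le_rfl

theorem sum_ite_mem_shortest_le (x : Fin N → ℕ) (S U : Finset (Fin N)) :
    ∑ j ∈ U, (if j ∈ shortest x S then 1 / ((shortest x S).card : ℝ) else 0) ≤ 1 := by
  rw [← Finset.sum_filter, Finset.sum_const, nsmul_eq_mul, mul_one_div]
  refine div_le_one_of_le₀ ?_ (by positivity)
  exact_mod_cast Finset.card_le_card fun j hj => (Finset.mem_filter.1 hj).2

theorem sum_assignProb_le_one (d : ℕ) (x : Fin N → ℕ) (i : Fin G.numDisp) :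
    ∑ j, G.assignProb d x i j ≤ 1 := by
  unfold assignProb
  split_ifs with h
  · rw [← Finset.sum_div, Finset.sum_comm]
    refine div_le_one_of_le₀ ?_ (by positivity)
    calc _ ≤ ∑ S ∈ (G.nbr i).powersetCard d, (1 : ℝ) :=
          Finset.sum_le_sum fun S _ => sum_ite_mem_shortest_le x S _
      _ = _ := by simp
  · rw [← Finset.sum_filter, Finset.sum_const, nsmul_eq_mul, mul_one_div]
    refine div_le_one_of_le₀ ?_ (by positivity)
    exact_mod_cast Finset.card_le_card fun j hj => (Finset.mem_filter.1 hj).2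

variable (d : ℕ) {lam : ℝ} {u : Fin M → ℝ}

/-- A bound on the total jump rate of the queue length process. -/
def rateBound (lam : ℝ) (u : Fin M → ℝ) : ℝ := lam * G.numDisp + ∑ j, u (G.servType j)

/-- The rates of all jumps, weighted by a function of the jump that is bounded by `c`. -/
theorem sum_rates_le (hlam : 0 ≤ lam) (hu : ∀ m, 0 ≤ u m) (x : Fin N → ℕ) {c : ℝ} (hc : 0 ≤ c)
    (φ ψ : Fin N → ℝ) (hφ : ∀ j, φ j ≤ c) (hψ : ∀ j, ψ j ≤ c) :
    (∑ i, ∑ j, lam * G.assignProb d x i j * φ j) +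
      ∑ j, (if 0 < x j then u (G.servType j) * ψ j else 0) ≤ G.rateBound lam u * c := by
  rw [rateBound, add_mul]
  refine add_le_add ?_ ?_
  · calc _ ≤ ∑ i : Fin G.numDisp, lam * c := Finset.sum_le_sum fun i _ => ?_
      _ = _ := by simp; ring
    calc _ ≤ ∑ j, lam * c * G.assignProb d x i j := Finset.sum_le_sum fun j _ => by
          rw [mul_right_comm]
          exact mul_le_mul_of_nonneg_right (mul_le_mul_of_nonneg_left (hφ j) hlam)
            (G.assignProb_nonneg d x i j)
      _ = lam * c * ∑ j, G.assignProb d x i j := by rw [Finset.mul_sum]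
      _ ≤ _ := mul_le_of_le_one_right (mul_nonneg hlam hc) (G.sum_assignProb_le_one d x i)
  · rw [Finset.sum_mul]
    refine Finset.sum_le_sum fun j _ => ?_
    split_ifs
    · exact mul_le_mul_of_nonneg_left (hψ j) (hu _)
    · exact mul_nonneg (hu _) hc

theorem generator_le (hlam : 0 ≤ lam) (hu : ∀ m, 0 ≤ u m) (f : (Fin N → ℕ) → ℝ) (x : Fin N → ℕ)
    {c : ℝ} (hc : 0 ≤ c) (hf : ∀ j n, f (Function.update x j n) - f x ≤ c) :
    G.generator d lam u f x ≤ G.rateBound lam u * c :=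
  G.sum_rates_le d hlam hu x hc _ _ (fun j => hf j _) (fun j => hf j _)

theorem generator_neg (f : (Fin N → ℕ) → ℝ) (x : Fin N → ℕ) :
    G.generator d lam u (fun y => -f y) x = -G.generator d lam u f x := by
  unfold generator
  rw [neg_add, ← Finset.sum_neg_distrib, ← Finset.sum_neg_distrib]
  congr 1
  · refine Finset.sum_congr rfl fun i _ => ?_
    rw [← Finset.sum_neg_distrib]
    exact Finset.sum_congr rfl fun j _ => by ring
  · refine Finset.sum_congr rfl fun j _ => ?_
    split_ifs <;> ring

theorem abs_generator_le (hlam : 0 ≤ lam) (hu : ∀ m, 0 ≤ u m) {f : (Fin N → ℕ) → ℝ} {B : ℝ}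
    (hf : ∀ x, |f x| ≤ B) (x : Fin N → ℕ) :
    |G.generator d lam u f x| ≤ G.rateBound lam u * (2 * B) := by
  have hB : 0 ≤ B := (abs_nonneg _).trans (hf x)
  rw [abs_le', ← generator_neg]
  refine ⟨G.generator_le d hlam hu f x (by positivity) fun j n => ?_,
    G.generator_le d hlam hu _ x (by positivity) fun j n => ?_⟩
  · linarith [(abs_le.1 (hf (Function.update x j n))).2, (abs_le.1 (hf x)).1]
  · linarith [(abs_le.1 (hf (Function.update x j n))).1, (abs_le.1 (hf x)).2]

/-- The carré du champ of a function whose jumps are bounded by `b`. -/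
theorem generator_sq_sub_le (hlam : 0 ≤ lam) (hu : ∀ m, 0 ≤ u m) (f : (Fin N → ℕ) → ℝ) {b : ℝ}
    (hup : ∀ x j, |f (Function.update x j (x j + 1)) - f x| ≤ b)
    (hdown : ∀ x j, |f (Function.update x j (x j - 1)) - f x| ≤ b) (x : Fin N → ℕ) :
    G.generator d lam u (fun y => f y ^ 2) x - 2 * (f x * G.generator d lam u f x) ≤
      G.rateBound lam u * b ^ 2 := by
  refine le_trans (le_of_eq ?_) (G.sum_rates_le d hlam hu x (sq_nonneg b)
    (fun j => (f (Function.update x j (x j + 1)) - f x) ^ 2)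
    (fun j => (f (Function.update x j (x j - 1)) - f x) ^ 2)
    (fun j => sq_le_sq' (abs_le.1 (hup x j)).1 (abs_le.1 (hup x j)).2)
    (fun j => sq_le_sq' (abs_le.1 (hdown x j)).1 (abs_le.1 (hdown x j)).2))
  unfold generator
  rw [mul_add, mul_add, add_sub_add_comm]
  congr 1
  · simp only [Finset.mul_sum]
    rw [← Finset.sum_sub_distrib]
    refine Finset.sum_congr rfl fun i _ => ?_
    rw [← Finset.sum_sub_distrib]
    exact Finset.sum_congr rfl fun j _ => by ring
  · simp only [Finset.mul_sum]
    rw [← Finset.sum_sub_distrib]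
    refine Finset.sum_congr rfl fun j _ => ?_
    split_ifs <;> ring

variable {G d} {Ω : Type*} [mΩ : MeasurableSpace Ω] {P : Measure Ω}
  {X : ℝ≥0 → Ω → Fin N → ℕ}

theorem IsQueueChain.measurable (hX : G.IsQueueChain d lam u P X) (t : ℝ≥0) :
    Measurable (X t) := by
  obtain ⟨ℱ, h, -⟩ := hX.martingale
  exact (h t).mono (ℱ.le t) le_rfl

theorem IsQueueChain.isBddRightCts (hX : G.IsQueueChain d lam u P X) {f : (Fin N → ℕ) → ℝ} {B : ℝ}
    (hf : ∀ x, |f x| ≤ B) : IsBddRightCts B fun t ω => f (X t ω) where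
  measurable t := (measurable_of_countable f).comp (hX.measurable t)
  rightCts ω t := (continuous_of_discreteTopology (f := f)).continuousAt.comp_continuousWithinAt
    (hX.cadlag ω t).1
  abs_le _t _ω := hf _

variable [IsProbabilityMeasure P]

/-- The maximal inequality for the martingale of a bounded test function with small jumps. -/
theorem IsQueueChain.measure_exists_le (hX : G.IsQueueChain d lam u P X) (hlam : 0 ≤ lam)
    (hu : ∀ m, 0 ≤ u m) {f : (Fin N → ℕ) → ℝ} {B b : ℝ} (hf : ∀ x, |f x| ≤ B)
    (hup : ∀ x j, |f (Function.update x j (x j + 1)) - f x| ≤ b)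
    (hdown : ∀ x j, |f (Function.update x j (x j - 1)) - f x| ≤ b) (T : ℝ≥0) {ε : ℝ}
    (hε : 0 < ε) :
    P {ω | ∃ t ≤ T, ε < |f (X t ω) - f (X 0 ω) -
      ∫ s in (0 : ℝ)..t, G.generator d lam u f (X s.toNNReal ω)|} ≤
      ENNReal.ofReal (G.rateBound lam u * b ^ 2 * T / ε ^ 2) := by
  obtain ⟨ℱ, hadapt, hmart⟩ := hX.martingale
  have hB2 : ∀ x, |f x ^ 2| ≤ B ^ 2 := fun x => by
    rw [abs_pow]
    exact pow_le_pow_left₀ (abs_nonneg _) (hf x) 2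
  have hY := hX.isBddRightCts hf
  have hg := hX.isBddRightCts (G.abs_generator_le d hlam hu hf)
  have hQ := hX.isBddRightCts (G.abs_generator_le d hlam hu hB2)
  have hM := hmart f ⟨B, hf⟩
  have hR := hmart (fun y => f y ^ 2) ⟨B ^ 2, hB2⟩
  have hYm : ∀ h : (Fin N → ℕ) → ℝ, ∀ t, Measurable[ℱ t] fun ω => h (X t ω) := fun h t =>
    (measurable_of_countable h).comp (hadapt t)
  -- the martingale started at zero
  have hM0 : Martingale (fun t ω => f (X t ω) - f (X 0 ω) -
      ∫ s in (0 : ℝ)..t, G.generator d lam u f (X s.toNNReal ω)) ℱ P := by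
    have hc : Martingale (fun (_ : ℝ≥0) ω => f (X 0 ω)) ℱ P := by
      refine martingale_const_fun ℱ P ?_ (hY.integrable 0)
      exact (hYm f ⊥).stronglyMeasurable
    convert hM.sub hc using 1
    ext t ω
    simp only [Pi.sub_apply]
    ring
  have hsqint : ∀ t : ℝ≥0, Integrable (fun ω => (f (X t ω) - f (X 0 ω) -
      ∫ s in (0 : ℝ)..t, G.generator d lam u f (X s.toNNReal ω)) ^ 2) P := fun t => by
    have hB : 0 ≤ G.rateBound lam u * (2 * B) := by
      obtain ⟨ω⟩ := nonempty_of_isProbabilityMeasure P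
      exact (abs_nonneg _).trans (hg.abs_le 0 ω)
    have h := (hY.sub (hY.const 0)).sub (hg.integral_min hB t)
    simpa [sq] using (h.mul h).integrable (P := P) t
  refine (measure_exists_le_of_martingale hM0 (fun ω t => ?_) hsqint T hε).trans ?_
  · exact ((hY.rightCts ω t).sub continuousWithinAt_const).sub
      ((hg.continuous_integral ω).comp NNReal.continuous_coe).continuousWithinAt
  · refine ENNReal.ofReal_le_ofReal (div_le_div_of_nonneg_right ?_ (sq_nonneg ε))
    rw [integral_sq_martingale hY hg hQ (hYm f) (hYm _) hM hR T]
    have hΓ : ∀ x, |G.generator d lam u (fun y => f y ^ 2) x -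
        2 * (f x * G.generator d lam u f x)| ≤ G.rateBound lam u * (2 * B ^ 2) +
          2 * (B * (G.rateBound lam u * (2 * B))) := fun x => by
      refine (abs_sub _ _).trans (add_le_add (G.abs_generator_le d hlam hu hB2 x) ?_)
      rw [abs_mul, abs_mul, abs_two]
      refine mul_le_mul_of_nonneg_left ?_ zero_le_two
      exact mul_le_mul (hf x) (G.abs_generator_le d hlam hu hf x) (abs_nonneg _)
        ((abs_nonneg _).trans (hf x))
    have hW := hX.isBddRightCts hΓ
    calc _ ≤ ∫ _ω, G.rateBound lam u * b ^ 2 * T ∂P := by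
          refine integral_mono (hW.integrable_integral T) (integrable_const _) fun ω => ?_
          calc _ ≤ ∫ _s in (0 : ℝ)..T, G.rateBound lam u * b ^ 2 :=
                intervalIntegral.integral_mono_on T.2 (hW.intervalIntegrable ω _ _)
                  intervalIntegrable_const fun s _ => G.generator_sq_sub_le d hlam hu f hup hdown _
            _ = _ := by simp; ring
      _ = _ := by simp

end CompatSystem

/-! ### Measurability of random càdlàg paths -/

/-- A time change of the line close to the identity, with prescribed values at finitely many
points: the identity plus a small tent at each of the points. -/
theorem exists_timeChange (A : Finset ℝ) {ε : ℝ} (hε : 0 < ε) :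
    ∃ η > 0, ∀ r : ℝ → ℝ, (∀ a ∈ A, |r a - a| ≤ η) → ∃ h : ℝ → ℝ, StrictMono h ∧ Continuous h ∧
      (∀ a ∈ A, h a = r a) ∧ ∀ t, |h t - t| ≤ ε := by
  obtain ⟨δ, hδ, hδ0⟩ : ∃ δ : ℝ, (∀ a ∈ A, ∀ b ∈ A, a ≠ b → δ ≤ |b - a|) ∧ 0 < δ := by
    have : ∀ᶠ δ in 𝓝[>] (0 : ℝ), ∀ a ∈ A, ∀ b ∈ A, a ≠ b → δ ≤ |b - a| := by
      refine (Finset.eventually_all _).2 fun a _ => (Finset.eventually_all _).2 fun b _ => ?_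
      by_cases hab : a = b
      · simp [hab]
      · have : 0 < |b - a| := abs_pos.2 (sub_ne_zero.2 (Ne.symm hab))
        filter_upwards [nhdsWithin_le_nhds (Iio_mem_nhds this)] with δ hδ _
        exact le_of_lt hδ
    exact (this.and self_mem_nhdsWithin).exists
  have hcard : (0 : ℝ) < A.card + 1 := by positivity
  refine ⟨min ε (δ / 2) / (A.card + 1), div_pos (lt_min hε (half_pos hδ0)) hcard,
    fun r hr => ?_⟩
  set η := min ε (δ / 2) / (A.card + 1) with hη
  have hη0 : 0 ≤ η := (div_pos (lt_min hε (half_pos hδ0)) hcard).le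
  have hAη : A.card * η ≤ min ε (δ / 2) := by
    rw [hη, mul_div_assoc', div_le_iff₀ hcard, mul_comm]
    exact mul_le_mul_of_nonneg_left (by linarith) (lt_min hε (half_pos hδ0)).le
  let φ : ℝ → ℝ := fun y => max (1 - |y| / δ) 0
  have hφ0 : ∀ y, |φ y| ≤ 1 := fun y => by
    have : 0 ≤ |y| / δ := by positivity
    rw [abs_of_nonneg (le_max_right _ _)]
    exact max_le (by linarith) zero_le_one
  have hφlip : ∀ y z, |φ y - φ z| ≤ |y - z| / δ := fun y z => by
    refine (abs_max_sub_max_le_abs (1 - |y| / δ) (1 - |z| / δ) 0).trans ?_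
    rw [show 1 - |y| / δ - (1 - |z| / δ) = (|z| - |y|) / δ by ring, abs_div, abs_of_pos hδ0,
      abs_sub_comm y z]
    exact div_le_div_of_nonneg_right (abs_abs_sub_abs_le _ _) hδ0.le
  let h : ℝ → ℝ := fun t => t + ∑ a ∈ A, (r a - a) * φ (t - a)
  refine ⟨h, fun s t hst => ?_, by fun_prop, fun b hb => ?_, fun t => ?_⟩
  · have h1 : |∑ a ∈ A, (r a - a) * φ (s - a) - ∑ a ∈ A, (r a - a) * φ (t - a)| ≤
        A.card * (η * (|s - t| / δ)) := by
      rw [← Finset.sum_sub_distrib, ← nsmul_eq_mul]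
      refine (Finset.abs_sum_le_sum_abs _ _).trans (Finset.sum_le_card_nsmul _ _ _ fun a ha => ?_)
      rw [← mul_sub, abs_mul]
      refine mul_le_mul (hr a ha) ((hφlip _ _).trans (le_of_eq ?_)) (abs_nonneg _) hη0
      congr 2; ring
    have h2 : A.card * (η * (|s - t| / δ)) ≤ (t - s) / 2 := by
      rw [abs_sub_comm, abs_of_pos (sub_pos.2 hst)]
      calc A.card * (η * ((t - s) / δ)) = A.card * η * ((t - s) / δ) := by ring
        _ ≤ δ / 2 * ((t - s) / δ) := by
          refine mul_le_mul_of_nonneg_right (hAη.trans (min_le_right _ _)) ?_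
          exact div_nonneg (sub_pos.2 hst).le hδ0.le
        _ = _ := by field_simp
    have h3 := (abs_le.1 (h1.trans h2)).2
    simp only [h]
    linarith
  · simp only [h]
    rw [Finset.sum_eq_single_of_mem b hb]
    · simp [φ]
    · intro a ha hab
      have : 1 ≤ |b - a| / δ := (one_le_div hδ0).2 (hδ a ha b hb hab)
      have : φ (b - a) = 0 := max_eq_right (by linarith)
      rw [this, mul_zero]
  · simp only [h, add_sub_cancel_left]
    refine le_trans ?_ (hAη.trans (min_le_left _ _))
    rw [← nsmul_eq_mul]
    refine (Finset.abs_sum_le_sum_abs _ _).trans (Finset.sum_le_card_nsmul _ _ _ fun a ha => ?_)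
    rw [abs_mul]
    exact (mul_le_of_le_one_right (abs_nonneg _) (hφ0 _)).trans (hr a ha)

/-- The order isomorphism of `[0, T]` induced by an increasing continuous function fixing the
endpoints. -/
theorem exists_orderIso_Icc {T : ℝ≥0} {h : ℝ → ℝ} (hmono : StrictMono h) (hcont : Continuous h)
    (h0 : h 0 = 0) (hT : h T = T) :
    ∃ θ : Set.Icc (0 : ℝ≥0) T ≃o Set.Icc (0 : ℝ≥0) T, ∀ t, ((θ t : ℝ≥0) : ℝ) = h (t : ℝ≥0) := by
  have hnn : ∀ t : Set.Icc (0 : ℝ≥0) T, 0 ≤ h (t : ℝ≥0) := fun t => by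
    rw [← h0]; exact hmono.monotone (t : ℝ≥0).coe_nonneg
  let F : Set.Icc (0 : ℝ≥0) T → Set.Icc (0 : ℝ≥0) T := fun t =>
    ⟨(h (t : ℝ≥0)).toNNReal, zero_le, by
      rw [Real.toNNReal_le_iff_le_coe, ← hT]
      exact hmono.monotone (NNReal.coe_le_coe.2 t.2.2)⟩
  have hFc : ∀ t, ((F t : ℝ≥0) : ℝ) = h (t : ℝ≥0) := fun t => Real.coe_toNNReal _ (hnn t)
  have hF : StrictMono F := fun s t hst => by
    rw [← Subtype.coe_lt_coe, ← NNReal.coe_lt_coe, hFc, hFc]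
    exact hmono hst
  have hsurj : Function.Surjective F := fun y => by
    have hy : ((y : ℝ≥0) : ℝ) ∈ Set.Icc (h 0) (h T) := by
      rw [h0, hT]; exact ⟨(y : ℝ≥0).coe_nonneg, NNReal.coe_le_coe.2 y.2.2⟩
    obtain ⟨z, hz, hzy⟩ := intermediate_value_Icc T.coe_nonneg hcont.continuousOn hy
    refine ⟨⟨⟨z, hz.1⟩, zero_le, hz.2⟩, ?_⟩
    rw [Subtype.ext_iff, NNReal.coe_inj.symm, hFc]
    exact hzy
  exact ⟨hF.orderIsoOfSurjective F hsurj, hFc⟩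

section Discrete

variable {S : Type*} [TopologicalSpace S] [DiscreteTopology S] {x : ℝ≥0 → S}

/-- The jump times of a path. -/
def jumpSet (x : ℝ≥0 → S) : Set ℝ≥0 := {t | ¬ ∀ᶠ s in 𝓝[<] t, x s = x t}

theorem IsCadlag.finite_jumpSet (hx : IsCadlag x) (T : ℝ≥0) :
    (jumpSet x ∩ Set.Icc 0 T).Finite := by
  by_contra hinf
  obtain ⟨t, -, hacc⟩ := Set.Infinite.exists_accPt_of_subset_isCompact hinf
    (isCompact_Icc (a := (0 : ℝ≥0)) (b := T)) Set.inter_subset_right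
  rw [accPt_iff_frequently_nhdsNE] at hacc
  refine hacc ?_
  obtain ⟨h1, a, h2⟩ := hx t
  have key : ∀ (U : Set ℝ≥0) (b : S), IsOpen U → (∀ s ∈ U, x s = b) → ∀ s ∈ U, s ∉ jumpSet x :=
    fun U b hU hb s hs hj => hj (by
      filter_upwards [nhdsWithin_le_nhds (hU.mem_nhds hs)] with r hr
      rw [hb r hr, hb s hs])
  rw [← Set.Iio_union_Ioi, nhdsWithin_union, eventually_sup]
  have hr : ∀ᶠ s in 𝓝[>] t, x s = x t := by
    have := h1.tendsto (isOpen_discrete {x t} |>.mem_nhds rfl)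
    exact nhdsWithin_mono _ Set.Ioi_subset_Ici_self this
  have hl : ∀ᶠ s in 𝓝[<] t, x s = a := h2 (isOpen_discrete {a} |>.mem_nhds rfl)
  constructor
  · rw [← eventually_eventually_nhdsWithin] at hl
    filter_upwards [hl, self_mem_nhdsWithin] with s hs hst hj
    refine hj.1 ?_
    rw [IsOpen.nhdsWithin_eq isOpen_Iio hst] at hs
    have h3 := hs.self_of_nhds
    filter_upwards [nhdsWithin_le_nhds hs] with r hr
    rw [hr, h3]
  · rw [← eventually_eventually_nhdsWithin] at hr
    filter_upwards [hr, self_mem_nhdsWithin] with s hs hst hj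
    refine hj.1 ?_
    rw [IsOpen.nhdsWithin_eq isOpen_Ioi hst] at hs
    have h3 := hs.self_of_nhds
    filter_upwards [nhdsWithin_le_nhds hs] with r hr
    rw [hr, h3]

theorem IsCadlag.eq_of_no_jump (hx : IsCadlag x) {s t : ℝ≥0} (hst : s ≤ t)
    (h : ∀ r, s < r → r ≤ t → r ∉ jumpSet x) : x s = x t := by
  have hc : ContinuousOn x (Set.Icc s t) := fun r hr => by
    rcases hr.1.eq_or_lt with rfl | hsr
    · exact (hx s).1.mono Set.Icc_subset_Ici_self
    · have hl : ContinuousWithinAt x (Set.Iio r) r := by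
        have := not_not.1 (h r hsr hr.2)
        exact (tendsto_const_nhds (x := x r)).congr' (this.mono fun _ h => h.symm)
      have := hl.union (hx r).1
      rw [Set.Iio_union_Ici] at this
      exact this.mono (Set.subset_univ _)
  exact isPreconnected_Icc.constant hc ⟨le_rfl, hst⟩ ⟨hst, le_rfl⟩

/-- The index of the grid point of mesh `T / (n + 1)` just before a time in `[0, T]`. -/
def gridIndex (T : ℝ≥0) (n : ℕ) (t : ℝ≥0) : ℕ := ⌊t * ((n + 1 : ℕ) / T)⌋₊

/-- The path that takes the value `v k` in the `k`-th interval of the grid. -/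
theorem isCadlag_step {E : Type*} [TopologicalSpace E] (T : ℝ≥0) (n : ℕ) (v : ℕ → E) :
    IsCadlag fun t : Set.Icc (0 : ℝ≥0) T => v (gridIndex T n t) := by
  have hmono : Monotone fun t : Set.Icc (0 : ℝ≥0) T => gridIndex T n t := fun s t hst =>
    Nat.floor_mono (mul_le_mul_left (show (s : ℝ≥0) ≤ t from hst) _)
  intro t
  constructor
  · have hev : ∀ᶠ s : Set.Icc (0 : ℝ≥0) T in 𝓝[≥] t, gridIndex T n s = gridIndex T n t := by
      have ho : ∀ᶠ s : Set.Icc (0 : ℝ≥0) T in 𝓝 t,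
          (s : ℝ≥0) * ((n + 1 : ℕ) / T) < (gridIndex T n t + 1 : ℕ) := by
        refine (continuous_subtype_val.mul continuous_const).continuousAt.eventually_lt
          continuousAt_const ?_
        rw [Nat.cast_add_one (gridIndex T n t)]
        exact Nat.lt_floor_add_one ((t : ℝ≥0) * ((n + 1 : ℕ) / T))
      filter_upwards [nhdsWithin_le_nhds ho, self_mem_nhdsWithin] with s hs hts
      refine le_antisymm (Nat.lt_succ_iff.1 ((Nat.floor_lt zero_le).2 hs)) (hmono hts)
    exact (tendsto_const_nhds (x := v (gridIndex T n t))).congr'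
      (hev.mono fun s hs => by simp only [hs])
  · obtain ⟨k, hk⟩ : ∃ k, Tendsto (fun s : Set.Icc (0 : ℝ≥0) T => gridIndex T n s) (𝓝[<] t) (𝓝 k) :=
      ⟨_, hmono.tendsto_nhdsLT t⟩
    exact ⟨v k, (continuous_of_discreteTopology (f := v)).continuousAt.tendsto.comp hk⟩

/-- A càdlàg path as a point of the Skorokhod space. -/
def SkorokhodSpace.ofCadlag {E : Type*} [TopologicalSpace E] {T : ℝ≥0}
    (y : Set.Icc (0 : ℝ≥0) T → E) (hy : IsCadlag y) : SkorokhodSpace T E := ⟨y, hy⟩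

/-- Sampling a path on finer and finer grids gives step paths that converge to it in the `J₁`
topology: the time change moves each jump to the grid point just after it. -/
theorem IsCadlag.tendsto_step (hx : IsCadlag x) {E : Type*} [PseudoEMetricSpace E] {e : S → E}
    (he : Continuous e) {T : ℝ≥0} (hT : 0 < T) :
    Tendsto (fun n => SkorokhodSpace.ofCadlag _
      (isCadlag_step T n fun k => e (x (k / ((n + 1 : ℕ) / T))))) atTop
      (𝓝 (SkorokhodSpace.ofCadlag _ (hx.comp_restrict he T))) := by
  rw [EMetric.tendsto_nhds]
  intro ε hε
  obtain ⟨ε', hε', hεε⟩ : ∃ ε' : ℝ, 0 < ε' ∧ ENNReal.ofReal ε' < ε := by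
    obtain ⟨r, hr0, hr⟩ := ENNReal.lt_iff_exists_nnreal_btwn.1 hε
    exact ⟨r, by simpa using hr0, by simpa using hr⟩
  let J : Finset ℝ≥0 := (hx.finite_jumpSet T).toFinset ∪ {0, T}
  have hJle : ∀ a ∈ J, a ≤ T := fun a ha => by
    simp only [J, Finset.mem_union, Set.Finite.mem_toFinset, Finset.mem_insert,
      Finset.mem_singleton] at ha
    rcases ha with ha | rfl | rfl
    exacts [ha.2.2, zero_le, le_rfl]
  obtain ⟨η, hη, htc⟩ := exists_timeChange (J.image ((↑) : ℝ≥0 → ℝ)) hε'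
  have hmesh : ∀ᶠ n : ℕ in atTop, (T : ℝ) / (n + 1 : ℕ) < η := by
    have := (tendsto_const_div_atTop_nhds_zero_nat (T : ℝ)).comp (tendsto_add_atTop_nat 1)
    exact this.eventually (gt_mem_nhds hη)
  filter_upwards [hmesh] with n hn
  set c : ℝ≥0 := (n + 1 : ℕ) / T with hc
  have hc0 : 0 < c := div_pos (by simp) hT
  -- the grid point just after a time
  let r : ℝ≥0 → ℝ≥0 := fun a => ⌈a * c⌉₊ / c
  have hr1 : ∀ a, a ≤ r a := fun a => (le_div_iff₀ hc0).2 (Nat.le_ceil _)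
  have hr2 : ∀ a, r a ≤ a + 1 / c := fun a => by
    rw [div_le_iff₀ hc0, add_mul, one_div, inv_mul_cancel₀ hc0.ne']
    exact (Nat.ceil_lt_add_one zero_le).le
  have hr0 : r 0 = 0 := by simp [r]
  have hrT : r T = T := by
    have : T * c = (n + 1 : ℕ) := by rw [hc, mul_div_cancel₀ _ hT.ne']
    simp only [r]
    rw [this, Nat.ceil_natCast, ← this, mul_div_cancel_right₀ _ hc0.ne']
  obtain ⟨h, hmono, hcont, hJ, hclose⟩ := htc (fun y => r y.toNNReal) (fun a ha => by
    obtain ⟨a, -, rfl⟩ := Finset.mem_image.1 ha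
    have h1 := NNReal.coe_le_coe.2 (hr1 a)
    have h2 := NNReal.coe_le_coe.2 (hr2 a)
    have h3 : ((1 / c : ℝ≥0) : ℝ) = T / (n + 1 : ℕ) := by
      rw [hc, one_div_div]; push_cast; rfl
    rw [NNReal.coe_add, h3] at h2
    rw [Real.toNNReal_coe, abs_of_nonneg (by linarith)]
    linarith)
  have hJ' : ∀ a ∈ J, h a = r a := fun a ha => by
    rw [hJ _ (Finset.mem_image_of_mem _ ha), Real.toNNReal_coe]
  obtain ⟨θ, hθ⟩ := exists_orderIso_Icc (T := T) hmono hcont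
    (by simpa [hr0] using hJ' 0 (by simp [J])) (by simpa [hrT] using hJ' T (by simp [J]))
  rw [edist_comm]
  refine lt_of_le_of_lt ((iInf_le _ θ).trans (max_le (iSup_le fun t => ?_)
    (iSup_le fun t => ?_))) hεε
  · rw [Subtype.edist_eq, edist_nndist, ← ENNReal.ofReal_coe_nnreal, coe_nndist, NNReal.dist_eq, hθ]
    exact ENNReal.ofReal_le_ofReal (hclose _)
  · -- no jump separates `t` from the grid point before `θ t`
    have key : ∀ a ∈ J, a ≤ gridIndex T n (θ t) / c ↔ a ≤ t := fun a ha => by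
      have h1 : a ≤ gridIndex T n (θ t) / c ↔ r a ≤ (θ t : ℝ≥0) := by
        rw [le_div_iff₀ hc0, ← Nat.ceil_le, gridIndex, Nat.le_floor_iff zero_le,
          div_le_iff₀ hc0]
      rw [h1, ← NNReal.coe_le_coe, ← hJ' a ha, hθ, hmono.le_iff_le, NNReal.coe_le_coe]
    have hgT : (gridIndex T n (θ t) : ℝ≥0) / c ≤ T := by
      refine le_trans ?_ (θ t).2.2
      rw [div_le_iff₀ hc0]
      exact Nat.floor_le zero_le
    have hnj : ∀ a b : ℝ≥0, b ≤ T → (∀ r ∈ J, r ≤ b → r ≤ a) →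
        ∀ r, a < r → r ≤ b → r ∉ jumpSet x := fun a b hb hab r har hrb hj =>
      absurd (hab r (by simp [J, hj, hrb.trans hb]) hrb) (not_le.2 har)
    have hxeq : x t = x (gridIndex T n (θ t) / c) := by
      rcases le_total (t : ℝ≥0) (gridIndex T n (θ t) / c) with hle | hle
      · exact hx.eq_of_no_jump hle (hnj _ _ hgT fun r hr => (key r hr).1)
      · exact (hx.eq_of_no_jump hle (hnj _ _ t.2.2 fun r hr => (key r hr).2)).symm
    change edist (e (x t)) (e (x (gridIndex T n (θ t) / c))) ≤ _
    rw [hxeq, edist_self]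
    exact zero_le

/-- A random càdlàg path with values in a countable discrete space is a random element of the
Skorokhod space. -/
theorem measurable_skorokhod_path [Countable S] [MeasurableSpace S] [MeasurableSingletonClass S]
    {Ω : Type*} [MeasurableSpace Ω] {X : ℝ≥0 → Ω → S} (hX : ∀ t, Measurable (X t))
    (hc : ∀ ω, IsCadlag fun t => X t ω) {E : Type*} [PseudoEMetricSpace E] {e : S → E}
    (he : Continuous e) {T : ℝ≥0} (hT : 0 < T) :
    Measurable fun ω => SkorokhodSpace.ofCadlag _ ((hc ω).comp_restrict he T) := by
  refine measurable_of_tendsto_metrizable (fun n => ?_)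
    (tendsto_pi_nhds.2 fun ω => (hc ω).tendsto_step he hT)
  -- a step path is a function of finitely many values
  have hle : ∀ t : Set.Icc (0 : ℝ≥0) T, gridIndex T n t < n + 2 := fun t => by
    rw [gridIndex, Nat.floor_lt zero_le]
    calc (t : ℝ≥0) * ((n + 1 : ℕ) / T) ≤ T * ((n + 1 : ℕ) / T) := by
          gcongr; exact t.2.2
      _ = (n + 1 : ℕ) := mul_div_cancel₀ _ hT.ne'
      _ < _ := by exact_mod_cast Nat.lt_succ_self _
  let Φ : (Fin (n + 2) → S) → SkorokhodSpace T E := fun v =>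
    .ofCadlag _ (isCadlag_step T n fun k => if hk : k < n + 2 then e (v ⟨k, hk⟩) else e (v 0))
  have h1 : Measurable fun ω => fun i : Fin (n + 2) =>
      X ((i : ℕ) / ((n + 1 : ℕ) / T) : ℝ≥0) ω := measurable_pi_lambda _ fun i => hX _
  convert (measurable_of_countable Φ).comp h1 using 1
  ext1 ω
  refine Subtype.ext (funext fun t => ?_)
  change e (X (gridIndex T n t / ((n + 1 : ℕ) / T)) ω) =
    if hk : gridIndex T n t < n + 2 then e (X (gridIndex T n t / ((n + 1 : ℕ) / T)) ω) else _
  rw [dif_pos (hle t)]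

end Discrete

/-! ### The polynomial form of the drift -/

/-- The polynomial `∑_{i < d} a ^ i b ^ (d - 1 - i)`, equal to `(a ^ d - b ^ d) / (a - b)` for
`a ≠ b`. -/
def geomQuot (d : ℕ) (a b : ℝ) : ℝ := ∑ i ∈ Finset.range d, a ^ i * b ^ (d - 1 - i)

theorem geomQuot_mul (d : ℕ) (a b : ℝ) : geomQuot d a b * (a - b) = a ^ d - b ^ d :=
  (Commute.all a b).geom_sum₂_mul d

/-- The right-hand side of the system of ODEs with the difference quotient replaced by the
polynomial that it stands for. -/
def polyRHS {K M : ℕ} (d : ℕ) (lam xi : ℝ) (u v : Fin M → ℝ) (w : Fin K → ℝ)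
    (p : Fin K → Fin M → ℝ) (q : Fin M × ℕ → ℝ) (m : Fin M) (l : ℕ) : ℝ :=
  -u m * (q (m, l + 1) - q (m, l + 2)) +
    lam * xi * (q (m, l) - q (m, l + 1)) * ∑ k, p k m * w k / limDeg v p k *
      geomQuot d (weightedOcc v p q k l) (weightedOcc v p q k (l + 1))

theorem odeRHS_eq_polyRHS {K M : ℕ} {d : ℕ} {lam xi : ℝ} {u v : Fin M → ℝ} {w : Fin K → ℝ}
    {p : Fin K → Fin M → ℝ} (hv : ∀ m, 0 < v m) (hp0 : ∀ k m, 0 ≤ p k m)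
    (hp : ∀ k, 0 < limDeg v p k) {q : Fin M × ℕ → ℝ} (hq : q ∈ occSetBar M) (m : Fin M) (l : ℕ) :
    odeRHS d lam xi u v w p q m l = polyRHS d lam xi u v w p q m l := by
  unfold odeRHS polyRHS
  congr 1
  rw [Finset.mul_sum, Finset.mul_sum]
  refine Finset.sum_congr rfl fun k _ => ?_
  by_cases h : weightedOcc v p q k l = weightedOcc v p q k (l + 1)
  · -- the coefficient vanishes together with the denominator
    have h0 : ∑ m, v m * p k m / limDeg v p k * (q (m, l) - q (m, l + 1)) = 0 := by
      simp only [mul_sub, Finset.sum_sub_distrib]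
      exact sub_eq_zero.2 h
    have h1 := (Finset.sum_eq_zero_iff_of_nonneg fun m _ => mul_nonneg
      (div_nonneg (mul_nonneg (hv m).le (hp0 k m)) (hp k).le) (sub_nonneg.2 (hq.2.2 m l))).1 h0 m
      (Finset.mem_univ m)
    have h2 : p k m * (q (m, l) - q (m, l + 1)) = 0 := by
      have := (hv m).ne'
      have := (hp k).ne'
      field_simp at h1
      rw [mul_zero] at h1
      rcases mul_eq_zero.1 h1 with h1 | h1
      · rcases mul_eq_zero.1 h1 with h1 | h1
        · contradiction
        · rw [h1, zero_mul]
      · rw [h1, mul_zero]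
    linear_combination (lam * xi * (w k / limDeg v p k) *
      ((weightedOcc v p q k l ^ d - weightedOcc v p q k (l + 1) ^ d) /
        (weightedOcc v p q k l - weightedOcc v p q k (l + 1)) -
        geomQuot d (weightedOcc v p q k l) (weightedOcc v p q k (l + 1)))) * h2
  · rw [← geomQuot_mul, mul_div_cancel_right₀ _ (sub_ne_zero.2 h)]

/-! ### Uniformly Lipschitz functionals -/

/-- A sequence of functionals of occupancies that are bounded, and Lipschitz in the supremum norm,
uniformly on `[0, 1]`-valued families. -/
def UnifLip {M : ℕ} (f : ℕ → (Fin M × ℕ → ℝ) → ℝ) : Prop :=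
  ∃ C, 0 ≤ C ∧ ∀ l q, (∀ a, q a ∈ Set.Icc (0 : ℝ) 1) → |f l q| ≤ C ∧
    ∀ q' δ, (∀ a, q' a ∈ Set.Icc (0 : ℝ) 1) → 0 ≤ δ → (∀ a, |q a - q' a| ≤ δ) →
      |f l q - f l q'| ≤ C * δ

namespace UnifLip

variable {M : ℕ} {f g : ℕ → (Fin M × ℕ → ℝ) → ℝ}

theorem const (c : ℝ) : UnifLip fun (_ : ℕ) (_ : Fin M × ℕ → ℝ) => c :=
  ⟨|c|, abs_nonneg _, fun l q _ => ⟨le_rfl, fun q' δ _ hδ _ => by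
    rw [sub_self, abs_zero]; positivity⟩⟩

theorem coord (m : Fin M) (k : ℕ) : UnifLip fun l (q : Fin M × ℕ → ℝ) => q (m, l + k) :=
  ⟨1, zero_le_one, fun l q hq => ⟨abs_le.2 ⟨by linarith [(hq (m, l + k)).1], (hq _).2⟩,
    fun q' δ _ _ h => by rw [one_mul]; exact h _⟩⟩

theorem add (hf : UnifLip f) (hg : UnifLip g) : UnifLip fun l q => f l q + g l q := by
  obtain ⟨C, hC, hf⟩ := hf
  obtain ⟨D, hD, hg⟩ := hg
  refine ⟨C + D, add_nonneg hC hD, fun l q hq => ⟨(abs_add_le _ _).trans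
    (add_le_add (hf l q hq).1 (hg l q hq).1), fun q' δ hq' hδ h => ?_⟩⟩
  rw [add_sub_add_comm, add_mul]
  exact (abs_add_le _ _).trans
    (add_le_add ((hf l q hq).2 q' δ hq' hδ h) ((hg l q hq).2 q' δ hq' hδ h))

theorem mul (hf : UnifLip f) (hg : UnifLip g) : UnifLip fun l q => f l q * g l q := by
  obtain ⟨C, hC, hf⟩ := hf
  obtain ⟨D, hD, hg⟩ := hg
  refine ⟨C * D + C * D, by positivity, fun l q hq => ⟨?_, fun q' δ hq' hδ h => ?_⟩⟩
  · rw [abs_mul]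
    have := mul_le_mul (hf l q hq).1 (hg l q hq).1 (abs_nonneg _) hC
    linarith [mul_nonneg hC hD]
  · have h1 := mul_le_mul ((hf l q hq).2 q' δ hq' hδ h) (hg l q hq).1 (abs_nonneg _)
      (by positivity)
    have h2 := mul_le_mul (hf l q' hq').1 ((hg l q hq).2 q' δ hq' hδ h) (abs_nonneg _) hC
    calc |f l q * g l q - f l q' * g l q'|
        = |(f l q - f l q') * g l q + f l q' * (g l q - g l q')| := by congr 1; ring
      _ ≤ |f l q - f l q'| * |g l q| + |f l q'| * |g l q - g l q'| := by
        rw [← abs_mul, ← abs_mul]; exact abs_add_le _ _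
      _ ≤ C * δ * D + C * (D * δ) := add_le_add h1 h2
      _ = _ := by ring

theorem sum {ι : Type*} (s : Finset ι) {f : ι → ℕ → (Fin M × ℕ → ℝ) → ℝ}
    (hf : ∀ i ∈ s, UnifLip (f i)) : UnifLip fun l q => ∑ i ∈ s, f i l q := by
  classical
  induction s using Finset.induction_on with
  | empty => simpa using const 0
  | insert i s hi ih =>
    simp only [Finset.sum_insert hi]
    exact (hf i (Finset.mem_insert_self i s)).add
      (ih fun j hj => hf j (Finset.mem_insert_of_mem hj))

theorem pow (hf : UnifLip f) (n : ℕ) : UnifLip fun l q => f l q ^ n := by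
  induction n with
  | zero => simpa using const 1
  | succ n ih => simpa only [pow_succ] using ih.mul hf

end UnifLip

section

variable {K M : ℕ} (d : ℕ) (lam xi : ℝ) (u v : Fin M → ℝ) (w : Fin K → ℝ) (p : Fin K → Fin M → ℝ)

theorem unifLip_polyRHS (m : Fin M) :
    UnifLip fun l q => polyRHS d lam xi u v w p q m l := by
  have hc := fun (m : Fin M) (k : ℕ) => UnifLip.coord m k
  have hsub : ∀ i j : ℕ, UnifLip fun l (q : Fin M × ℕ → ℝ) => q (m, l + i) - q (m, l + j) :=
    fun i j => by simpa [sub_eq_add_neg] using (hc m i).add ((UnifLip.const (-1)).mul (hc m j))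
  have hw : ∀ (k : Fin K) (i : ℕ), UnifLip fun l q => weightedOcc v p q k (l + i) := fun k i =>
    UnifLip.sum _ fun m _ => (UnifLip.const _).mul (hc m i)
  refine ((UnifLip.const (-u m)).mul (hsub 1 2)).add
    (((UnifLip.const (lam * xi)).mul (hsub 0 1)).mul (UnifLip.sum _ fun k _ =>
      (UnifLip.const _).mul (UnifLip.sum _ fun i _ => ((hw k 0).pow i).mul ((hw k 1).pow _))))

/-- A Lipschitz constant of the drift in the supremum norm, and a bound of the drift. -/
theorem exists_lipschitz_polyRHS : ∃ C, 0 < C ∧ ∀ m l q, (∀ a, q a ∈ Set.Icc (0 : ℝ) 1) →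
    |polyRHS d lam xi u v w p q m l| ≤ C ∧
    ∀ q' δ, (∀ a, q' a ∈ Set.Icc (0 : ℝ) 1) → 0 ≤ δ → (∀ a, |q a - q' a| ≤ δ) →
      |polyRHS d lam xi u v w p q m l - polyRHS d lam xi u v w p q' m l| ≤ C * δ := by
  choose C hC h using unifLip_polyRHS d lam xi u v w p
  have hle : ∀ m, C m ≤ ∑ m, C m + 1 := fun m =>
    (Finset.single_le_sum (fun m _ => hC m) (Finset.mem_univ m)).trans (by linarith)
  refine ⟨∑ m, C m + 1, add_pos_of_nonneg_of_pos (Finset.sum_nonneg fun m _ => hC m) one_pos,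
    fun m l q hq => ⟨(h m l q hq).1.trans (hle m), fun q' δ hq' hδ hqq =>
      ((h m l q hq).2 q' δ hq' hδ hqq).trans (mul_le_mul_of_nonneg_right (hle m) hδ)⟩⟩

/-! ### Approximate solutions of the system of ODEs -/

/-- `x` satisfies, up to the error `η` on `[0, T]`, the integrated system of ODEs started
at `q0`. -/
structure IsApproxSol (T : ℝ≥0) (η : ℝ) (q0 : Fin M × ℕ → ℝ) (x : ℝ≥0 → Fin M × ℕ → ℝ) :
    Prop where
  mem : ∀ t, x t ∈ occSetBar M
  measurable : ∀ a, Measurable fun s : ℝ => x s.toNNReal a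
  abs_le : ∀ t ≤ T, ∀ m l, |x t (m, l + 1) - q0 (m, l + 1) -
    ∫ s in (0 : ℝ)..t, polyRHS d lam xi u v w p (x s.toNNReal) m l| ≤ η

variable {d lam xi u v w p}

theorem measurable_polyRHS {x : ℝ → Fin M × ℕ → ℝ} (hx : ∀ a, Measurable fun s => x s a)
    (m : Fin M) (l : ℕ) : Measurable fun s => polyRHS d lam xi u v w p (x s) m l := by
  unfold polyRHS geomQuot weightedOcc
  have := fun a => hx a
  fun_prop

theorem intervalIntegrable_polyRHS {x : ℝ → Fin M × ℕ → ℝ} (hx : ∀ a, Measurable fun s => x s a)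
    (hmem : ∀ s a, x s a ∈ Set.Icc (0 : ℝ) 1) (m : Fin M) (l : ℕ) (a b : ℝ) :
    IntervalIntegrable (fun s => polyRHS d lam xi u v w p (x s) m l) volume a b := by
  obtain ⟨C, hC, h⟩ := exists_lipschitz_polyRHS d lam xi u v w p
  refine (intervalIntegrable_const (c := C)).mono_fun
    (measurable_polyRHS hx m l).aestronglyMeasurable (ae_of_all _ fun r => ?_)
  exact ((h m l _ (hmem r)).1).trans (le_abs_self C)

/-- Two approximate solutions are close: a Gronwall estimate in the supremum norm over all
coordinates, with the exponential weight `exp (-2 C t)` on the paths. -/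
theorem exists_approxSol_dist_le (d : ℕ) (lam xi : ℝ) (u v : Fin M → ℝ) (w : Fin K → ℝ)
    (p : Fin K → Fin M → ℝ) (T : ℝ≥0) :
    ∃ D, 0 < D ∧ ∀ (q0 : Fin M × ℕ → ℝ) (x y : ℝ≥0 → Fin M × ℕ → ℝ) (η η' : ℝ),
      0 ≤ η → 0 ≤ η' → IsApproxSol d lam xi u v w p T η q0 x →
      IsApproxSol d lam xi u v w p T η' q0 y →
      ∀ t ≤ T, ∀ a, |x t a - y t a| ≤ D * (η + η') := by
  obtain ⟨C, hC, hlip⟩ := exists_lipschitz_polyRHS d lam xi u v w p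
  refine ⟨2 * Real.exp (2 * C * T), by positivity, fun q0 x y η η' hη hη' hx hy t ht a => ?_⟩
  let F : (Fin M × ℕ) × Set.Iic T → ℝ := fun z =>
    Real.exp (-(2 * C * z.2)) * |x z.2 z.1 - y z.2 z.1|
  have hone : ∀ t a, |x t a - y t a| ≤ 1 := fun t a => by
    have h1 := (hx.mem t).1 a
    have h2 := (hy.mem t).1 a
    exact abs_le.2 ⟨by linarith [h1.1, h2.2], by linarith [h1.2, h2.1]⟩
  have hbdd : BddAbove (Set.range F) := ⟨1, by
    rintro _ ⟨z, rfl⟩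
    refine mul_le_one₀ (Real.exp_le_one_iff.2 ?_) (abs_nonneg _) (hone _ _)
    exact neg_nonpos.2 (mul_nonneg (by positivity) z.2.1.coe_nonneg)⟩
  set D := ⨆ z, F z with hD
  have hFD : ∀ z, F z ≤ D := fun z => le_ciSup hbdd z
  have hD0 : 0 ≤ D := (mul_nonneg (Real.exp_pos _).le (abs_nonneg _)).trans (hFD (a, ⟨t, ht⟩))
  have hxy : ∀ s ≤ T, ∀ b, |x s b - y s b| ≤ Real.exp (2 * C * s) * D := fun s hs b => by
    have := hFD (b, ⟨s, hs⟩)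
    simp only [F, Real.exp_neg] at this
    rwa [inv_mul_le_iff₀ (Real.exp_pos _)] at this
  have hint : ∀ s : ℝ≥0, ∫ r in (0 : ℝ)..s, C * (Real.exp (2 * C * r) * D) ≤
      Real.exp (2 * C * s) * (D / 2) := fun s => by
    have h1 : ∫ r in (0 : ℝ)..s, C * (Real.exp (2 * C * r) * D) =
        Real.exp (2 * C * s) * (D / 2) - Real.exp (2 * C * 0) * (D / 2) := by
      refine intervalIntegral.integral_eq_sub_of_hasDerivAt
        (f := fun r => Real.exp (2 * C * r) * (D / 2)) (fun r _ => ?_)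
        (Continuous.intervalIntegrable (by fun_prop) _ _)
      have := (((hasDerivAt_id r).const_mul (2 * C)).exp).mul_const (D / 2)
      refine this.congr_deriv ?_
      simp; ring
    rw [h1]
    have : 0 ≤ Real.exp (2 * C * 0) * (D / 2) := by positivity
    linarith
  have hstep : D ≤ η + η' + D / 2 := by
    have : Nonempty ((Fin M × ℕ) × Set.Iic T) := ⟨(a, ⟨t, ht⟩)⟩
    refine ciSup_le ?_
    rintro ⟨⟨m, l⟩, s, hs⟩
    rcases l with - | l
    · simp only [F, (hx.mem s).2.1 m, (hy.mem s).2.1 m, sub_self, abs_zero, mul_zero]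
      positivity
    · have i1 := intervalIntegrable_polyRHS (d := d) (lam := lam) (xi := xi) (u := u) (v := v)
        (w := w) (p := p) hx.measurable (fun r => (hx.mem r.toNNReal).1) m l 0 s
      have i2 := intervalIntegrable_polyRHS (d := d) (lam := lam) (xi := xi) (u := u) (v := v)
        (w := w) (p := p) hy.measurable (fun r => (hy.mem r.toNNReal).1) m l 0 s
      have h3 : |∫ r in (0 : ℝ)..s, (polyRHS d lam xi u v w p (x r.toNNReal) m l -
          polyRHS d lam xi u v w p (y r.toNNReal) m l)| ≤ Real.exp (2 * C * s) * (D / 2) := by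
        refine le_trans ?_ (hint s)
        rw [← Real.norm_eq_abs]
        refine intervalIntegral.norm_integral_le_of_norm_le (μ := volume)
          (g := fun r => C * (Real.exp (2 * C * r) * D)) s.coe_nonneg
          (ae_of_all _ fun r hr => ?_) (Continuous.intervalIntegrable (by fun_prop) _ _)
        have hr0 : (r.toNNReal : ℝ) = r := Real.coe_toNNReal _ hr.1.le
        have hrT : r.toNNReal ≤ T := (Real.toNNReal_le_iff_le_coe.2 hr.2).trans hs
        refine (hlip m l _ (hx.mem _).1).2 _ _ (hy.mem _).1 (by positivity) fun b => ?_
        have := hxy _ hrT b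
        rwa [hr0] at this
      rw [intervalIntegral.integral_sub i1 i2] at h3
      have h1 := hx.abs_le s hs m l
      have h2 := hy.abs_le s hs m l
      have h4 : |x s (m, l + 1) - y s (m, l + 1)| ≤ η + η' + Real.exp (2 * C * s) * (D / 2) := by
        rw [abs_le] at *
        constructor <;> linarith [h1.1, h1.2, h2.1, h2.2, h3.1, h3.2]
      have h5 : 1 ≤ Real.exp (2 * C * s) :=
        Real.one_le_exp (mul_nonneg (by positivity) s.coe_nonneg)
      simp only [F]
      rw [Real.exp_neg, inv_mul_le_iff₀ (Real.exp_pos _), mul_add]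
      refine h4.trans (add_le_add_left ?_ _)
      exact le_mul_of_one_le_left (by positivity) h5
  calc |x t a - y t a| ≤ Real.exp (2 * C * t) * D := hxy t ht a
    _ ≤ Real.exp (2 * C * T) * (2 * (η + η')) := by
      refine mul_le_mul (Real.exp_le_exp.2 ?_) (by linarith) hD0 (Real.exp_pos _).le
      exact mul_le_mul_of_nonneg_left (NNReal.coe_le_coe.2 ht) (by positivity)
    _ = _ := by ring

end

/-! ### Tails and the `ℓ₁` norm -/

section

variable {M : ℕ}

/-- The part of the `ℓ₁` norm carried by the levels `L, …, L + R - 1`. -/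
def tailSum (L R : ℕ) (f : Fin M × ℕ → ℝ) : ℝ := ∑ m, ∑ l ∈ Finset.range R, f (m, L + l)

theorem tailSum_mono {L L' : ℕ} (hL : L ≤ L') {R : ℕ} {f : Fin M × ℕ → ℝ} (hf : ∀ a, 0 ≤ f a) :
    tailSum L' R f ≤ tailSum L (L' - L + R) f := by
  refine Finset.sum_le_sum fun m _ => ?_
  rw [Finset.sum_range_add]
  refine le_add_of_nonneg_of_le (Finset.sum_nonneg fun l _ => hf _) (le_of_eq ?_)
  refine Finset.sum_congr rfl fun l _ => ?_
  congr 2; omega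

theorem OccSpace.hasSum_norm (f : OccSpace M) : HasSum (fun a => |f a|) ‖f‖ := by
  have := lp.hasSum_norm (p := 1) (by simp) f
  simpa using this

theorem OccSpace.abs_apply_le (f : OccSpace M) (a : Fin M × ℕ) : |f a| ≤ ‖f‖ :=
  le_hasSum (OccSpace.hasSum_norm f) a fun _ _ => abs_nonneg _

theorem tailSum_eq_sum (L R : ℕ) (f : Fin M × ℕ → ℝ) :
    tailSum L R f = ∑ a ∈ Finset.univ ×ˢ (Finset.range R).map (addLeftEmbedding L), f a := by
  rw [Finset.sum_product]
  simp [tailSum]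

theorem OccSpace.tailSum_abs_le (f : OccSpace M) (L R : ℕ) :
    tailSum L R (fun a => |f a|) ≤ ‖f‖ := by
  rw [tailSum_eq_sum]
  exact sum_le_hasSum _ (fun _ _ => abs_nonneg _) (OccSpace.hasSum_norm f)

theorem tailSum_zero_add (L R : ℕ) (f : Fin M × ℕ → ℝ) :
    tailSum 0 (L + R) f = tailSum 0 L f + tailSum L R f := by
  simp only [tailSum, ← Finset.sum_add_distrib, zero_add]
  exact Finset.sum_congr rfl fun m _ => Finset.sum_range_add _ _ _

/-- Every finite set of coordinates lies below some level. -/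
theorem sum_le_tailSum_zero (s : Finset (Fin M × ℕ)) {f : Fin M × ℕ → ℝ} (hf : ∀ a, 0 ≤ f a) :
    ∃ R₀, ∀ R ≥ R₀, ∑ a ∈ s, f a ≤ tailSum 0 R f := by
  refine ⟨s.sup Prod.snd + 1, fun R hR => ?_⟩
  rw [tailSum_eq_sum]
  refine Finset.sum_le_sum_of_subset_of_nonneg (fun a ha => ?_) fun a _ _ => hf a
  have := Finset.le_sup (f := Prod.snd) ha
  simp only [Finset.mem_product, Finset.mem_univ, true_and, Finset.mem_map, Finset.mem_range]
  exact ⟨a.2, by omega, by simp⟩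

/-- The tails of an element of `ℓ₁` vanish. -/
theorem OccSpace.exists_tailSum_le (f : OccSpace M) {ε : ℝ} (hε : 0 < ε) :
    ∃ L, ∀ R, tailSum L R (fun a => |f a|) ≤ ε := by
  have hs := OccSpace.hasSum_norm f
  obtain ⟨s, hs'⟩ := (hs.eventually (lt_mem_nhds (sub_lt_self ‖f‖ hε))).exists
  obtain ⟨R₀, hR₀⟩ := sum_le_tailSum_zero s (f := fun a => |f a|) fun a => abs_nonneg _
  refine ⟨R₀, fun R => ?_⟩
  have h1 := hR₀ R₀ le_rfl
  have h2 := OccSpace.tailSum_abs_le f 0 (R₀ + R)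
  rw [tailSum_zero_add] at h2
  linarith

/-- Closeness of finitely many coordinates and smallness of the tails give closeness in `ℓ₁`. -/
theorem OccSpace.norm_sub_le_of_sum (f g : OccSpace M) (hf : ∀ a, 0 ≤ f a) (hg : ∀ a, 0 ≤ g a)
    {L : ℕ} {ε ε' : ℝ} (hfL : ∀ R, tailSum L R f ≤ ε) (hgL : ∀ R, tailSum L R g ≤ ε') :
    ‖f - g‖ ≤ tailSum 0 L (fun a => |f a - g a|) + ε + ε' := by
  have hs := OccSpace.hasSum_norm (f - g)
  refine hasSum_le_of_sum_le hs fun s => ?_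
  obtain ⟨R₀, hR₀⟩ := sum_le_tailSum_zero s (f := fun a => |(f - g) a|) fun a => abs_nonneg _
  refine (hR₀ (L + R₀) (Nat.le_add_left _ _)).trans ?_
  rw [tailSum_zero_add, add_assoc]
  refine add_le_add le_rfl ((le_trans ?_ (add_le_add (hfL R₀) (hgL R₀))))
  simp only [tailSum, ← Finset.sum_add_distrib]
  refine Finset.sum_le_sum fun m _ => Finset.sum_le_sum fun l _ => ?_
  refine (abs_sub _ _).trans (le_of_eq ?_)
  rw [abs_of_nonneg (hf _), abs_of_nonneg (hg _)]

/-- A nonnegative family with a finite tail belongs to `ℓ₁`. -/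
theorem memℓp_of_tailSum_le {f : Fin M × ℕ → ℝ} (hf : ∀ a, f a ∈ Set.Icc (0 : ℝ) 1) {L : ℕ} {ε : ℝ}
    (h : ∀ R, tailSum L R f ≤ ε) : Memℓp f 1 := by
  refine memℓp_gen ?_
  simp only [ENNReal.toReal_one, Real.rpow_one, Real.norm_eq_abs]
  refine summable_of_sum_le (c := tailSum 0 L f + ε) (fun a => abs_nonneg _) fun s => ?_
  obtain ⟨R₀, hR₀⟩ := sum_le_tailSum_zero s (f := f) fun a => (hf a).1
  calc ∑ a ∈ s, |f a| = ∑ a ∈ s, f a := Finset.sum_congr rfl fun a _ => abs_of_nonneg (hf a).1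
    _ ≤ tailSum 0 (L + R₀) f := hR₀ _ (Nat.le_add_left _ _)
    _ ≤ _ := by rw [tailSum_zero_add]; linarith [h R₀]

theorem tailSum_le_add (f g : OccSpace M) (L R : ℕ) : tailSum L R f ≤ tailSum L R g + ‖f - g‖ := by
  have h := OccSpace.tailSum_abs_le (f - g) L R
  have h2 : tailSum L R f - tailSum L R g ≤ tailSum L R fun a => |(f - g) a| := by
    simp only [tailSum, ← Finset.sum_sub_distrib]
    exact Finset.sum_le_sum fun m _ => Finset.sum_le_sum fun l _ => le_abs_self _
  linarith

end

/-! ### Existence and uniqueness of the limit -/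

section

variable {K M : ℕ} {d : ℕ} {lam xi : ℝ} {u v : Fin M → ℝ} {w : Fin K → ℝ} {p : Fin K → Fin M → ℝ}

/-- Solutions of the system are approximate solutions with error `0`. -/
theorem IsODESolution.isApproxSol (hv : ∀ m, 0 < v m) (hp0 : ∀ k m, 0 ≤ p k m)
    (hp : ∀ k, 0 < limDeg v p k) {q0 : Fin M × ℕ → ℝ} {y : ℝ≥0 → Fin M × ℕ → ℝ}
    (hy : IsODESolution d lam xi u v w p q0 y) (T : ℝ≥0) :
    IsApproxSol d lam xi u v w p T 0 q0 y := by
  obtain ⟨h0, hmem, hder⟩ := hy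
  have hcont : ∀ m l, ContinuousOn (fun s : ℝ => y s.toNNReal (m, l + 1)) (Set.Ici 0) :=
    fun m l s hs => by
      have := (hder s.toNNReal m l).continuousWithinAt
      rwa [Real.coe_toNNReal _ hs] at this
  have hmeas : ∀ a, Measurable fun s : ℝ => y s.toNNReal a := by
    rintro ⟨m, l⟩
    rcases l with - | l
    · simp only [(hmem _).2.1 m]
      exact measurable_const
    · have h1 : Continuous fun s : ℝ => y (max s 0).toNNReal (m, l + 1) :=
        (hcont m l).comp_continuous (continuous_id.max continuous_const)
          fun s => Set.mem_Ici.2 (le_max_right s 0)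
      have h2 : ∀ s : ℝ, (max s 0).toNNReal = s.toNNReal := fun s => by
        ext; simp
      simp only [h2] at h1
      exact h1.measurable
  refine ⟨hmem, hmeas, fun t _ m l => ?_⟩
  have hint := intervalIntegral.integral_eq_sub_of_hasDeriv_right_of_le (a := 0) (b := (t : ℝ))
    t.coe_nonneg (f := fun s : ℝ => y s.toNNReal (m, l + 1))
    (f' := fun s => polyRHS d lam xi u v w p (y s.toNNReal) m l)
    ((hcont m l).mono Set.Icc_subset_Ici_self) (fun s hs => ?_)
    (intervalIntegrable_polyRHS hmeas (fun r => (hmem _).1) m l 0 t)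
  · rw [hint, Real.toNNReal_coe, Real.toNNReal_zero, h0, sub_self, abs_zero]
  · have := hder s.toNNReal m l
    rw [Real.coe_toNNReal _ hs.1.le, odeRHS_eq_polyRHS hv hp0 hp (hmem _)] at this
    exact this.mono fun r hr => hs.1.le.trans (le_of_lt hr)

/-- Approximate solutions with vanishing errors converge to a solution of the integrated system. -/
theorem exists_integral_solution {q0 : Fin M × ℕ → ℝ}
    (H : ∀ (T : ℝ≥0) (η : ℝ), 0 < η → ∃ x, IsApproxSol d lam xi u v w p T η q0 x) :
    ∃ q, ∀ T, IsApproxSol d lam xi u v w p T 0 q0 q := by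
  have hpos : ∀ n : ℕ, 0 < 1 / ((n : ℝ) + 1) := fun n => Nat.one_div_pos_of_nat
  choose x hx using fun n : ℕ => H n (1 / ((n : ℝ) + 1)) (hpos n)
  have hxT : ∀ (T : ℝ≥0) (n : ℕ), T ≤ n →
      IsApproxSol d lam xi u v w p T (1 / ((n : ℝ) + 1)) q0 (x n) := fun T n hn =>
    ⟨(hx n).mem, (hx n).measurable, fun t ht => (hx n).abs_le t (ht.trans hn)⟩
  have hlim0 : Tendsto (fun n : ℕ => 1 / ((n : ℝ) + 1)) atTop (𝓝 0) :=
    tendsto_one_div_add_atTop_nhds_zero_nat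
  have hcauchy : ∀ t a, CauchySeq fun n => x n t a := fun t a => by
    obtain ⟨D, hD, hdist⟩ := exists_approxSol_dist_le d lam xi u v w p t
    obtain ⟨n₀, hn₀⟩ := exists_nat_ge t
    rw [Metric.cauchySeq_iff']
    intro ε hε
    have h2 : Tendsto (fun n : ℕ => D * (1 / ((n : ℝ) + 1) + 1 / ((n : ℝ) + 1))) atTop (𝓝 0) := by
      simpa using (hlim0.add hlim0).const_mul D
    obtain ⟨N, hN, hNn⟩ := ((h2.eventually (gt_mem_nhds hε)).and (eventually_ge_atTop n₀)).exists
    refine ⟨N, fun n hn => lt_of_le_of_lt ?_ hN⟩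
    have hNt : t ≤ N := hn₀.trans (by exact_mod_cast hNn)
    have hnt : t ≤ n := hNt.trans (by exact_mod_cast hn)
    refine (hdist q0 _ _ _ _ (hpos n).le (hpos N).le (hxT t n hnt) (hxT t N hNt) t le_rfl
      a).trans ?_
    gcongr
  choose q hq using fun t a => cauchySeq_tendsto_of_complete (hcauchy t a)
  have hmem : ∀ t, q t ∈ occSetBar M := fun t =>
    ⟨fun a => isClosed_Icc.mem_of_tendsto (hq t a)
      (Eventually.of_forall fun n => ((hx n).mem t).1 a),
      fun m => tendsto_nhds_unique (hq t (m, 0))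
        (tendsto_const_nhds.congr fun n => (((hx n).mem t).2.1 m).symm),
      fun m l => le_of_tendsto_of_tendsto' (hq t _) (hq t _) fun n => ((hx n).mem t).2.2 m l⟩
  have hmeas : ∀ a, Measurable fun s : ℝ => q s.toNNReal a := fun a =>
    measurable_of_tendsto_metrizable (fun n => (hx n).measurable a)
      (tendsto_pi_nhds.2 fun s => hq _ a)
  refine ⟨q, fun T => ⟨hmem, hmeas, fun t _ m l => ?_⟩⟩
  obtain ⟨C, hC, hlip⟩ := exists_lipschitz_polyRHS d lam xi u v w p
  have hcontRHS : ∀ s : ℝ≥0, Tendsto (fun n => polyRHS d lam xi u v w p (x n s) m l) atTop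
      (𝓝 (polyRHS d lam xi u v w p (q s) m l)) := fun s => by
    have : Continuous fun z : Fin M × ℕ → ℝ => polyRHS d lam xi u v w p z m l := by
      unfold polyRHS geomQuot weightedOcc
      fun_prop
    exact (this.tendsto _).comp (tendsto_pi_nhds.2 fun a => hq s a)
  have hint : Tendsto (fun n => ∫ s in (0 : ℝ)..t, polyRHS d lam xi u v w p (x n s.toNNReal) m l)
      atTop (𝓝 (∫ s in (0 : ℝ)..t, polyRHS d lam xi u v w p (q s.toNNReal) m l)) := by
    refine intervalIntegral.tendsto_integral_filter_of_dominated_convergence (fun _ => C)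
      (Eventually.of_forall fun n =>
        (measurable_polyRHS (hx n).measurable m l).aestronglyMeasurable)
      (Eventually.of_forall fun n => ae_of_all _ fun s _ => (hlip m l _ ((hx n).mem _).1).1)
      intervalIntegrable_const (ae_of_all _ fun s _ => hcontRHS _)
  obtain ⟨n₀, hn₀⟩ := exists_nat_ge t
  refine le_of_tendsto_of_tendsto (((hq t (m, l + 1)).sub_const _).sub hint).abs hlim0 ?_
  filter_upwards [eventually_ge_atTop n₀] with n hn
  exact (hx n).abs_le t (hn₀.trans (by exact_mod_cast hn)) m l

/-- Solutions of the integrated system solve the system of ODEs. -/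
theorem isODESolution_of_integral (hv : ∀ m, 0 < v m) (hp0 : ∀ k m, 0 ≤ p k m)
    (hp : ∀ k, 0 < limDeg v p k) {q0 : Fin M × ℕ → ℝ} (hq0 : q0 ∈ occSetBar M)
    {q : ℝ≥0 → Fin M × ℕ → ℝ} (hq : ∀ T, IsApproxSol d lam xi u v w p T 0 q0 q) :
    IsODESolution d lam xi u v w p q0 q ∧ ∀ a, Continuous fun t => q t a := by
  have hmem := (hq 0).mem
  have hii := fun (m : Fin M) (l : ℕ) (a b : ℝ) =>
    intervalIntegrable_polyRHS (d := d) (lam := lam) (xi := xi) (u := u) (v := v)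
      (w := w) (p := p) (hq 0).measurable (fun r => (hmem r.toNNReal).1) m l a b
  have heq : ∀ (t : ℝ≥0) m l, q t (m, l + 1) = q0 (m, l + 1) +
      ∫ s in (0 : ℝ)..t, polyRHS d lam xi u v w p (q s.toNNReal) m l := fun t m l => by
    have := abs_nonpos_iff.1 ((hq t).abs_le t le_rfl m l)
    linarith
  have hcont : ∀ a, Continuous fun t : ℝ≥0 => q t a := by
    rintro ⟨m, l⟩
    rcases l with - | l
    · simp only [(hmem _).2.1 m]
      exact continuous_const
    · simp only [heq]
      exact continuous_const.add
        ((intervalIntegral.continuous_primitive (hii m l) 0).comp NNReal.continuous_coe)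
  have hcr : ∀ m l, Continuous fun s : ℝ => polyRHS d lam xi u v w p (q s.toNNReal) m l :=
    fun m l => by
      have h1 : ∀ a, Continuous fun s : ℝ => q s.toNNReal a := fun a =>
        (hcont a).comp continuous_real_toNNReal
      unfold polyRHS geomQuot weightedOcc
      fun_prop
  refine ⟨⟨?_, hmem, fun t m l => ?_⟩, hcont⟩
  · funext ⟨m, l⟩
    rcases l with - | l
    · rw [(hmem 0).2.1 m, hq0.2.1 m]
    · simp [heq 0 m l]
  · rw [odeRHS_eq_polyRHS hv hp0 hp (hmem t)]
    have h1 := ((hcr m l).integral_hasStrictDerivAt 0 (t : ℝ)).hasDerivAt.hasDerivWithinAt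
      (s := Set.Ici 0)
    rw [Real.toNNReal_coe] at h1
    refine (h1.const_add (q0 (m, l + 1))).congr (fun s hs => ?_) ?_
    · rw [heq, Real.coe_toNNReal _ hs]
    · rw [heq, Real.toNNReal_coe]

/-- Approximate solutions with uniformly small tails force the existence of a unique solution of the
system of ODEs, which they approximate in `ℓ₁`. -/
theorem exists_odeSolution (hv : ∀ m, 0 < v m) (hp0 : ∀ k m, 0 ≤ p k m)
    (hp : ∀ k, 0 < limDeg v p k) {q0 : OccSpace M} (hq0 : q0 ∈ occSet M)
    (H : ∀ (T : ℝ≥0) (ε : ℝ), 0 < ε → ∃ L, ∀ η, 0 < η → ∃ x,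
      IsApproxSol d lam xi u v w p T η q0 x ∧ ∀ t ≤ T, ∀ R, tailSum L R (x t) ≤ ε) :
    ∃ q : ℝ≥0 → OccSpace M, Continuous q ∧ (∀ t, q t ∈ occSet M) ∧
      IsODESolution d lam xi u v w p q0 (fun t => q t) ∧
      (∀ y, IsODESolution d lam xi u v w p q0 y → y = fun t => (q t : Fin M × ℕ → ℝ)) ∧
      ∀ (T : ℝ≥0) (ε : ℝ), 0 < ε → ∀ L, ∃ η, 0 < η ∧ ∀ x : ℝ≥0 → OccSpace M,
        IsApproxSol d lam xi u v w p T η q0 (fun t => x t) →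
        (∀ t ≤ T, ∀ R, tailSum L R (x t) ≤ ε / 4) → ∀ t ≤ T, ‖x t - q t‖ ≤ ε := by
  obtain ⟨q, hq⟩ := exists_integral_solution (d := d) (lam := lam) (xi := xi) (u := u) (v := v)
    (w := w) (p := p) (q0 := q0) fun T η hη => by
      obtain ⟨L, hL⟩ := H T 1 one_pos
      obtain ⟨x, hx, -⟩ := hL η hη
      exact ⟨x, hx⟩
  obtain ⟨hode, hcont⟩ := isODESolution_of_integral hv hp0 hp hq0 hq
  have hmem := (hq 0).mem
  have htail : ∀ (T : ℝ≥0) (ε : ℝ), 0 < ε → ∃ L, ∀ t ≤ T, ∀ R, tailSum L R (q t) ≤ ε := by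
    intro T ε hε
    obtain ⟨L, hL⟩ := H T ε hε
    obtain ⟨D, hD, hdist⟩ := exists_approxSol_dist_le d lam xi u v w p T
    refine ⟨L, fun t ht R => le_of_forall_pos_le_add fun δ hδ => ?_⟩
    have hc : (0 : ℝ) < M * (R * D) + 1 := by positivity
    obtain ⟨x, hx, hxL⟩ := hL (δ / (M * (R * D) + 1)) (div_pos hδ hc)
    have h1 : tailSum L R (q t) - tailSum L R (x t) ≤ M * (R * (D * (δ / (M * (R * D) + 1)))) := by
      simp only [tailSum, ← Finset.sum_sub_distrib]
      refine (Finset.sum_le_card_nsmul _ _ (R * (D * (δ / (M * (R * D) + 1)))) fun m _ => ?_).trans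
        (by simp)
      refine (Finset.sum_le_card_nsmul _ _ (D * (δ / (M * (R * D) + 1))) fun l _ => ?_).trans
        (by simp)
      have := hdist q0 _ _ _ _ le_rfl (div_pos hδ hc).le (hq T) hx t ht (m, L + l)
      rw [zero_add] at this
      exact (le_abs_self _).trans this
    have h2 : M * (R * (D * (δ / (M * (R * D) + 1)))) ≤ δ := by
      rw [show (M : ℝ) * (R * (D * (δ / (M * (R * D) + 1)))) =
        δ * (M * (R * D)) / (M * (R * D) + 1) by ring, div_le_iff₀ hc]
      exact mul_le_mul_of_nonneg_left (by linarith) hδ.le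
    linarith [hxL t ht R]
  have hℓ : ∀ t, Memℓp (q t) 1 := fun t => by
    obtain ⟨L, hL⟩ := htail t 1 one_pos
    exact memℓp_of_tailSum_le (hmem t).1 (hL t le_rfl)
  refine ⟨fun t => ⟨q t, hℓ t⟩, ?_, hmem, hode, fun y hy => ?_, fun T ε hε L => ?_⟩
  · -- continuity in `ℓ₁`: finitely many coordinates matter
    rw [continuous_iff_continuousAt]
    intro t
    rw [ContinuousAt, tendsto_iff_norm_sub_tendsto_zero, Metric.tendsto_nhds]
    intro ε hε
    obtain ⟨L, hL⟩ := htail (t + 1) (ε / 4) (by positivity)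
    have h1 : Tendsto (fun s => ∑ m, ∑ l ∈ Finset.range L, |q s (m, l) - q t (m, l)|) (𝓝 t)
        (𝓝 0) := by
      have : Continuous fun s => ∑ m, ∑ l ∈ Finset.range L, |q s (m, l) - q t (m, l)| := by
        fun_prop
      simpa using this.tendsto t
    have h2 : ∀ᶠ s in 𝓝 t, s ≤ t + 1 :=
      (gt_mem_nhds (lt_add_one t)).mono fun s hs => le_of_lt hs
    filter_upwards [h1.eventually (gt_mem_nhds (half_pos hε)), h2] with s hs hst
    rw [Real.dist_eq, sub_zero, abs_norm]
    refine lt_of_le_of_lt (OccSpace.norm_sub_le_of_sum _ _ (fun a => ((hmem s).1 a).1)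
      (fun a => ((hmem t).1 a).1) (hL s hst) (hL t (by simp))) ?_
    change tailSum 0 L (fun a => |q s a - q t a|) + _ + _ < _
    simp only [tailSum, zero_add]
    linarith
  · funext t a
    obtain ⟨D, hD, hdist⟩ := exists_approxSol_dist_le d lam xi u v w p t
    have := hdist q0 y q 0 0 le_rfl le_rfl (hy.isApproxSol hv hp0 hp t) (hq t) t le_rfl a
    rw [add_zero, mul_zero] at this
    exact sub_eq_zero.1 (abs_nonpos_iff.1 this)
  · obtain ⟨L', hL'⟩ := htail T (ε / 4) (by positivity)
    obtain ⟨D, hD, hdist⟩ := exists_approxSol_dist_le d lam xi u v w p T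
    have hc : (0 : ℝ) < M * ((max L L' : ℕ) * D) + 1 := by positivity
    have hη : 0 < ε / 2 / (M * ((max L L' : ℕ) * D) + 1) := by positivity
    refine ⟨_, hη, fun x hx hxL t ht => ?_⟩
    have hxmem := (hx.mem t).1
    have hmax : ∀ (J : ℕ) (f : Fin M × ℕ → ℝ), J ≤ max L L' → (∀ a, 0 ≤ f a) →
        (∀ R, tailSum J R f ≤ ε / 4) → ∀ R, tailSum (max L L') R f ≤ ε / 4 :=
      fun J f hJ hf h R => (tailSum_mono hJ hf).trans (h _)
    refine (OccSpace.norm_sub_le_of_sum (x t) ⟨q t, hℓ t⟩ (fun a => (hxmem a).1)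
      (fun a => ((hmem t).1 a).1) (hmax L _ (le_max_left _ _) (fun a => (hxmem a).1) (hxL t ht))
      (hmax L' (q t) (le_max_right _ _) (fun a => ((hmem t).1 a).1) (hL' t ht))).trans ?_
    have h1 : tailSum 0 (max L L') (fun a => |x t a - q t a|) ≤
        M * ((max L L' : ℕ) * (D * (ε / 2 / (M * ((max L L' : ℕ) * D) + 1)))) := by
      refine (Finset.sum_le_card_nsmul _ _
        ((max L L' : ℕ) * (D * (ε / 2 / (M * ((max L L' : ℕ) * D) + 1)))) fun m _ => ?_).trans
        (by simp)
      refine (Finset.sum_le_card_nsmul _ _ (D * (ε / 2 / (M * ((max L L' : ℕ) * D) + 1)))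
        fun l _ => ?_).trans (by simp)
      have := hdist q0 _ _ _ _ hη.le le_rfl hx (hq T) t ht (m, 0 + l)
      rwa [add_zero] at this
    have h2 : M * ((max L L' : ℕ) * (D * (ε / 2 / (M * ((max L L' : ℕ) * D) + 1)))) ≤ ε / 2 := by
      rw [show (M : ℝ) * ((max L L' : ℕ) * (D * (ε / 2 / (M * ((max L L' : ℕ) * D) + 1)))) =
        ε / 2 * (M * ((max L L' : ℕ) * D)) / (M * ((max L L' : ℕ) * D) + 1) by ring,
        div_le_iff₀ hc]
      exact mul_le_mul_of_nonneg_left (by linarith) (by positivity)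
    change tailSum 0 (max L L') (fun a => |x t a - q t a|) + _ + _ ≤ _
    linarith

end

/-! ### Uniform asymptotic equality -/

/-- Two families of functions with varying index sets are asymptotically equal, uniformly over the
index sets. -/
def UnifClose {ι : ℕ → Type*} (a b : ∀ n, ι n → ℝ) : Prop :=
  ∀ ε, 0 < ε → ∀ᶠ n in atTop, ∀ z, |a n z - b n z| ≤ ε

/-- A family of functions is eventually bounded by a common constant. -/
def UnifBdd {ι : ℕ → Type*} (a : ∀ n, ι n → ℝ) : Prop :=
  ∃ C, 0 ≤ C ∧ ∀ᶠ n in atTop, ∀ z, |a n z| ≤ C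

namespace UnifClose

variable {ι : ℕ → Type*} {a b c a' b' : ∀ n, ι n → ℝ}

theorem refl (a : ∀ n, ι n → ℝ) : UnifClose a a := fun ε hε =>
  Eventually.of_forall fun n z => by rw [sub_self, abs_zero]; exact hε.le

theorem trans (h : UnifClose a b) (h' : UnifClose b c) : UnifClose a c := fun ε hε => by
  filter_upwards [h (ε / 2) (half_pos hε), h' (ε / 2) (half_pos hε)] with n h1 h2 z
  exact (abs_sub_le _ _ _).trans (by linarith [h1 z, h2 z])

theorem add (h : UnifClose a b) (h' : UnifClose a' b') :
    UnifClose (fun n z => a n z + a' n z) fun n z => b n z + b' n z := fun ε hε => by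
  filter_upwards [h (ε / 2) (half_pos hε), h' (ε / 2) (half_pos hε)] with n h1 h2 z
  rw [add_sub_add_comm]
  exact (abs_add_le _ _).trans (by linarith [h1 z, h2 z])

theorem sum {κ : Type*} (s : Finset κ) {a b : κ → ∀ n, ι n → ℝ}
    (h : ∀ k ∈ s, UnifClose (a k) (b k)) :
    UnifClose (fun n z => ∑ k ∈ s, a k n z) fun n z => ∑ k ∈ s, b k n z := by
  classical
  induction s using Finset.induction_on with
  | empty => simpa using refl (fun (_ : ℕ) _ => (0 : ℝ))
  | insert k s hk ih =>
    simp only [Finset.sum_insert hk]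
    exact (h k (Finset.mem_insert_self k s)).add
      (ih fun j hj => h j (Finset.mem_insert_of_mem hj))

theorem bdd (h : UnifClose a b) (hb : UnifBdd b) : UnifBdd a := by
  obtain ⟨C, hC, hb⟩ := hb
  refine ⟨C + 1, by positivity, ?_⟩
  filter_upwards [hb, h 1 one_pos] with n h1 h2 z
  have := abs_sub_abs_le_abs_sub (a n z) (b n z)
  linarith [h1 z, h2 z]

theorem mul (h : UnifClose a b) (h' : UnifClose a' b') (hb : UnifBdd b) (hb' : UnifBdd b') :
    UnifClose (fun n z => a n z * a' n z) fun n z => b n z * b' n z := fun ε hε => by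
  obtain ⟨C, hC, ha⟩ := h.bdd hb
  obtain ⟨D, hD, hb'⟩ := hb'
  have h0 : 0 < ε / (C + D + 1) := by positivity
  filter_upwards [h _ h0, h' _ h0, ha, hb'] with n h1 h2 h3 h4 z
  calc |a n z * a' n z - b n z * b' n z|
      = |a n z * (a' n z - b' n z) + (a n z - b n z) * b' n z| := by congr 1; ring
    _ ≤ |a n z| * |a' n z - b' n z| + |a n z - b n z| * |b' n z| := by
      rw [← abs_mul, ← abs_mul]; exact abs_add_le _ _
    _ ≤ C * (ε / (C + D + 1)) + ε / (C + D + 1) * D :=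
      add_le_add (mul_le_mul (h3 z) (h2 z) (abs_nonneg _) hC)
        (mul_le_mul (h1 z) (h4 z) (abs_nonneg _) h0.le)
    _ = ε * ((C + D) / (C + D + 1)) := by ring
    _ ≤ ε := mul_le_of_le_one_right hε.le (div_le_one_of_le₀ (by linarith) (by positivity))

theorem of_tendsto {f : ℕ → ℝ} {c : ℝ} (h : Tendsto f atTop (𝓝 c)) :
    UnifClose (fun n (_ : ι n) => f n) fun _ _ => c := fun ε hε => by
  filter_upwards [Metric.tendsto_nhds.1 h ε hε] with n hn _
  exact hn.le

theorem comp {ι' : ℕ → Type*} (h : UnifClose a b) (g : ∀ n, ι' n → ι n) :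
    UnifClose (fun n z => a n (g n z)) fun n z => b n (g n z) := fun ε hε =>
  (h ε hε).mono fun n hn z => hn (g n z)

/-- Inversion, at a positive limit. -/
theorem inv {c : ℝ} (h : UnifClose a fun _ _ => c) (hc : 0 < c) :
    UnifClose (fun n z => (a n z)⁻¹) fun _ _ => c⁻¹ := fun ε hε => by
  have hc2 : 0 < c / 2 := half_pos hc
  filter_upwards [h _ hc2, h (ε * (c / 2 * c)) (by positivity)] with n h1 h2 z
  have h3 : c / 2 ≤ a n z := by linarith [(abs_le.1 (h1 z)).1]
  have h4 : 0 < a n z := hc2.trans_le h3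
  rw [inv_sub_inv h4.ne' hc.ne', abs_div, abs_of_pos (mul_pos h4 hc), div_le_iff₀ (by positivity),
    abs_sub_comm]
  refine (h2 z).trans (mul_le_mul_of_nonneg_left ?_ hε.le)
  exact mul_le_mul_of_nonneg_right h3 hc.le

end UnifClose

namespace UnifBdd

variable {ι : ℕ → Type*} {a b : ∀ n, ι n → ℝ}

theorem const (c : ℝ) : UnifBdd fun (n : ℕ) (_ : ι n) => c :=
  ⟨|c|, abs_nonneg c, Eventually.of_forall fun _ _ => le_rfl⟩

theorem of_le (C : ℝ) (hC : 0 ≤ C) (h : ∀ n z, |a n z| ≤ C) : UnifBdd a :=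
  ⟨C, hC, Eventually.of_forall h⟩

theorem add (ha : UnifBdd a) (hb : UnifBdd b) : UnifBdd fun n z => a n z + b n z := by
  obtain ⟨C, hC, ha⟩ := ha
  obtain ⟨D, hD, hb⟩ := hb
  refine ⟨C + D, by positivity, ?_⟩
  filter_upwards [ha, hb] with n h1 h2 z
  exact (abs_add_le _ _).trans (add_le_add (h1 z) (h2 z))

theorem mul (ha : UnifBdd a) (hb : UnifBdd b) : UnifBdd fun n z => a n z * b n z := by
  obtain ⟨C, hC, ha⟩ := ha
  obtain ⟨D, hD, hb⟩ := hb
  refine ⟨C * D, by positivity, ?_⟩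
  filter_upwards [ha, hb] with n h1 h2 z
  rw [abs_mul]
  exact mul_le_mul (h1 z) (h2 z) (abs_nonneg _) hC

theorem sum {κ : Type*} (s : Finset κ) {a : κ → ∀ n, ι n → ℝ} (h : ∀ k ∈ s, UnifBdd (a k)) :
    UnifBdd fun n z => ∑ k ∈ s, a k n z := by
  classical
  induction s using Finset.induction_on with
  | empty => simpa using const 0
  | insert k s hk ih =>
    simp only [Finset.sum_insert hk]
    exact (h k (Finset.mem_insert_self k s)).add
      (ih fun j hj => h j (Finset.mem_insert_of_mem hj))

end UnifBdd

/-! ### Sampling without replacement -/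

/-- The product `t (t - h) ⋯ (t - (d - 1) h)`. For `h = 1 / n` and `t = a / n` it is the falling
factorial of `a`, divided by `n ^ d`. -/
def fallProd (h : ℝ) (d : ℕ) (t : ℝ) : ℝ := ∏ i ∈ Finset.range d, (t - i * h)

/-- The divided difference of `fallProd`. -/
def fallQuot (h : ℝ) : ℕ → ℝ → ℝ → ℝ
  | 0, _, _ => 0
  | d + 1, s, t => fallProd h d s + (t - d * h) * fallQuot h d s t

theorem fallQuot_mul (h : ℝ) (d : ℕ) (s t : ℝ) :
    fallQuot h d s t * (s - t) = fallProd h d s - fallProd h d t := by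
  induction d with
  | zero => simp [fallQuot, fallProd]
  | succ d ih =>
    simp only [fallQuot, fallProd, Finset.prod_range_succ] at ih ⊢
    linear_combination (t - d * h) * ih

theorem fallProd_natCast (d a : ℕ) {n : ℕ} (hn : 0 < n) :
    fallProd (1 / n) d (a / n) = a.descFactorial d / (n : ℝ) ^ d := by
  have hn' : (n : ℝ) ≠ 0 := by positivity
  induction d with
  | zero => simp [fallProd]
  | succ d ih =>
    rw [fallProd, Finset.prod_range_succ, ← fallProd, ih, Nat.descFactorial_succ, pow_succ]
    rcases le_or_gt d a with h | h
    · push_cast [Nat.cast_sub h]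
      field_simp
    · rw [Nat.descFactorial_of_lt h]
      simp

theorem geomQuot_succ (d : ℕ) (s t : ℝ) : geomQuot (d + 1) s t = s ^ d + t * geomQuot d s t := by
  rw [geomQuot, Finset.sum_range_succ, geomQuot, Finset.mul_sum, add_comm]
  congr 1
  · simp
  · refine Finset.sum_congr rfl fun i hi => ?_
    have := Finset.mem_range.1 hi
    rw [show d + 1 - 1 - i = (d - 1 - i) + 1 by omega, pow_succ]
    ring

/-- Pairs of points of the unit interval. -/
abbrev UnitPair : Type := Set.Icc (0 : ℝ) 1 × Set.Icc (0 : ℝ) 1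

theorem unifBdd_unit {ι : ℕ → Type*} (f : ∀ n, ι n → Set.Icc (0 : ℝ) 1) :
    UnifBdd fun n z => (f n z : ℝ) :=
  UnifBdd.of_le 1 zero_le_one fun n z =>
    abs_le.2 ⟨by linarith [(f n z).2.1], (f n z).2.2⟩

theorem unifClose_fallProd {ι : ℕ → Type*} (d : ℕ) (f : ∀ n, ι n → Set.Icc (0 : ℝ) 1) :
    UnifClose (fun n z => fallProd (1 / n) d (f n z)) (fun n z => (f n z : ℝ) ^ d) ∧
      UnifBdd fun n z => (f n z : ℝ) ^ d := by
  have hb := unifBdd_unit f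
  induction d with
  | zero => exact ⟨by simpa [fallProd] using UnifClose.refl _, by simpa using UnifBdd.const 1⟩
  | succ d ih =>
    simp only [fallProd, Finset.prod_range_succ, pow_succ]
    refine ⟨ih.1.mul ?_ ih.2 hb, ih.2.mul hb⟩
    have h0 : Tendsto (fun n : ℕ => -((d : ℝ) * (1 / n))) atTop (𝓝 0) := by
      simpa using (tendsto_one_div_atTop_nhds_zero_nat (𝕜 := ℝ)).const_mul (d : ℝ) |>.neg
    simpa [sub_eq_add_neg] using
      (UnifClose.refl fun n z => (f n z : ℝ)).add (UnifClose.of_tendsto h0)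

theorem unifClose_fallQuot (d : ℕ) :
    UnifClose (fun n (z : UnitPair) => fallQuot (1 / n) d z.1 z.2)
      (fun _ z => geomQuot d z.1 z.2) ∧ UnifBdd fun _ (z : UnitPair) => geomQuot d z.1 z.2 := by
  have hb := unifBdd_unit (fun _ (z : UnitPair) => z.2)
  induction d with
  | zero =>
    simp only [fallQuot, geomQuot, Finset.range_zero, Finset.sum_empty]
    exact ⟨UnifClose.refl _, UnifBdd.const 0⟩
  | succ d ih =>
    have h0 : Tendsto (fun n : ℕ => -((d : ℝ) * (1 / n))) atTop (𝓝 0) := by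
      simpa using (tendsto_one_div_atTop_nhds_zero_nat (𝕜 := ℝ)).const_mul (d : ℝ) |>.neg
    have h1 := unifClose_fallProd d (fun _ (z : UnitPair) => z.1)
    have h2 : UnifClose (fun n (z : UnitPair) => (z.2 : ℝ) - d * (1 / n)) fun _ z => (z.2 : ℝ) := by
      simpa [sub_eq_add_neg] using
        (UnifClose.refl fun _ (z : UnitPair) => (z.2 : ℝ)).add (UnifClose.of_tendsto h0)
    simp only [fallQuot, geomQuot_succ]
    exact ⟨h1.1.add (h2.mul ih.1 hb ih.2), h1.2.add (hb.mul ih.2)⟩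

namespace CompatSystem

variable {K M N : ℕ} (G : CompatSystem K M N)

/-- Servers with equal queue lengths are equally likely to be chosen. -/
theorem sum_mem_shortest_eq (x : Fin N → ℕ) (A : Finset (Fin N)) (d : ℕ) {j j' : Fin N}
    (hj : j ∈ A) (hj' : j' ∈ A) (h : x j = x j') :
    (∑ S ∈ A.powersetCard d, if j ∈ shortest x S then 1 / ((shortest x S).card : ℝ) else 0) =
      ∑ S ∈ A.powersetCard d, if j' ∈ shortest x S then 1 / ((shortest x S).card : ℝ) else 0 := by
  set σ := Equiv.swap j j' with hσ
  have hxσ : ∀ i, x (σ i) = x i := fun i => by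
    rcases eq_or_ne i j with rfl | h1
    · rw [hσ, Equiv.swap_apply_left, h]
    rcases eq_or_ne i j' with rfl | h2
    · rw [hσ, Equiv.swap_apply_right, h]
    rw [hσ, Equiv.swap_apply_of_ne_of_ne h1 h2]
  have hAσ : ∀ i, i ∈ A → σ i ∈ A := fun i hi => by
    rcases eq_or_ne i j with rfl | h1
    · rwa [hσ, Equiv.swap_apply_left]
    rcases eq_or_ne i j' with rfl | h2
    · rwa [hσ, Equiv.swap_apply_right]
    rwa [hσ, Equiv.swap_apply_of_ne_of_ne h1 h2]
  have hσσ : ∀ i, σ (σ i) = i := fun i => Equiv.swap_apply_self _ _ _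
  have hshort : ∀ S : Finset (Fin N), shortest x (S.map σ.toEmbedding) =
      (shortest x S).map σ.toEmbedding := fun S => by
    ext i
    simp only [shortest, Finset.mem_filter, Finset.mem_map_equiv, hσ, Equiv.symm_swap]
    rw [← hσ]
    refine and_congr_right fun _ => ⟨fun H i' hi' => ?_, fun H i' hi' => ?_⟩
    · have := H (σ i') (by rwa [hσσ])
      rwa [hxσ, ← hxσ i] at this
    · have := H (σ i') hi'
      rwa [hxσ, hxσ] at this
  refine Finset.sum_bij' (fun S _ => S.map σ.toEmbedding) (fun S _ => S.map σ.toEmbedding)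
    ?_ ?_ ?_ ?_ ?_
  · intro S hS
    rw [Finset.mem_powersetCard] at hS ⊢
    refine ⟨fun i hi => ?_, by rw [Finset.card_map, hS.2]⟩
    obtain ⟨i', hi', rfl⟩ := Finset.mem_map.1 hi
    exact hAσ _ (hS.1 hi')
  · intro S hS
    rw [Finset.mem_powersetCard] at hS ⊢
    refine ⟨fun i hi => ?_, by rw [Finset.card_map, hS.2]⟩
    obtain ⟨i', hi', rfl⟩ := Finset.mem_map.1 hi
    exact hAσ _ (hS.1 hi')
  · intro S _
    ext i
    simp [Finset.mem_map_equiv, hσ]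
  · intro S _
    ext i
    simp [Finset.mem_map_equiv, hσ]
  · intro S _
    rw [hshort, Finset.card_map]
    congr 1
    rw [Finset.mem_map_equiv, hσ, Equiv.symm_swap, Equiv.swap_apply_right]

/-- A sample contributes to level `l` if and only if its smallest queue length is `l`. -/
theorem sum_level_mem_shortest (x : Fin N → ℕ) {A S : Finset (Fin N)} (hS : S ⊆ A) (l : ℕ) :
    (∑ j ∈ A.filter fun j => x j = l,
      if j ∈ shortest x S then 1 / ((shortest x S).card : ℝ) else 0) =
      (if S ⊆ A.filter (fun j => l ≤ x j) then 1 else 0) -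
        if S ⊆ A.filter (fun j => l + 1 ≤ x j) then 1 else 0 := by
  rw [← Finset.sum_filter, Finset.sum_const, nsmul_eq_mul, mul_one_div]
  by_cases h2 : S ⊆ A.filter (fun j => l + 1 ≤ x j)
  · have h1 : S ⊆ A.filter (fun j => l ≤ x j) := h2.trans fun j hj => by
      rw [Finset.mem_filter] at hj ⊢
      exact ⟨hj.1, by omega⟩
    have h0 : ((A.filter fun j => x j = l).filter fun j => j ∈ shortest x S) = ∅ := by
      refine Finset.filter_false_of_mem fun j hj hjs => ?_
      have := (Finset.mem_filter.1 (h2 (Finset.mem_filter.1 hjs).1)).2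
      have := (Finset.mem_filter.1 hj).2
      omega
    rw [h0, if_pos h1, if_pos h2]
    simp
  by_cases h1 : S ⊆ A.filter (fun j => l ≤ x j)
  · -- the minimum is attained at level `l`
    obtain ⟨j₀, hj₀S, hj₀⟩ : ∃ j ∈ S, x j = l := by
      by_contra! hne
      refine h2 fun j hj => Finset.mem_filter.2 ⟨hS hj, ?_⟩
      have := (Finset.mem_filter.1 (h1 hj)).2
      have := hne j hj
      omega
    have hsh : ((A.filter fun j => x j = l).filter fun j => j ∈ shortest x S) = shortest x S := by
      ext j
      simp only [Finset.mem_filter, shortest]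
      refine ⟨fun h => h.2, fun h => ⟨⟨hS h.1, ?_⟩, h⟩⟩
      have := (Finset.mem_filter.1 (h1 h.1)).2
      have := h.2 j₀ hj₀S
      omega
    have hne : (shortest x S).Nonempty := ⟨j₀, Finset.mem_filter.2 ⟨hj₀S, fun j' hj' => by
      rw [hj₀]; exact (Finset.mem_filter.1 (h1 hj')).2⟩⟩
    rw [hsh, div_self (by exact_mod_cast hne.card_pos.ne'), if_pos h1, if_neg h2, sub_zero]
  · have h0 : ((A.filter fun j => x j = l).filter fun j => j ∈ shortest x S) = ∅ := by
      refine Finset.filter_false_of_mem fun j hj hjs => h1 fun j' hj' => ?_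
      have := (Finset.mem_filter.1 hjs).2 j' hj'
      have := (Finset.mem_filter.1 hj).2
      exact Finset.mem_filter.2 ⟨hS hj', by omega⟩
    rw [h0, if_neg h1, if_neg h2]
    simp

/-- The number of neighbors of dispatcher `i` with queue length at least `l`. -/
def nbrGE (x : Fin N → ℕ) (i : Fin G.numDisp) (l : ℕ) : ℕ :=
  ((G.nbr i).filter fun j => l ≤ x j).card

theorem card_level_eq_nbrGE_sub (x : Fin N → ℕ) (i : Fin G.numDisp) (l : ℕ) :
    (((G.nbr i).filter fun j => x j = l).card : ℝ) =
      (G.nbrGE x i l : ℝ) - G.nbrGE x i (l + 1) := by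
  rw [eq_sub_iff_add_eq, nbrGE, nbrGE, ← Nat.cast_add, ← Finset.card_union_of_disjoint]
  · congr 2
    ext j
    simp only [Finset.mem_union, Finset.mem_filter]
    constructor
    · rintro (⟨h1, h2⟩ | ⟨h1, h2⟩)
      exacts [⟨h1, h2.ge⟩, ⟨h1, by omega⟩]
    · rintro ⟨h1, h2⟩
      rcases h2.eq_or_lt with h | h
      exacts [Or.inl ⟨h1, h.symm⟩, Or.inr ⟨h1, h⟩]
  · rw [Finset.disjoint_filter]
    intro j _ h
    omega

theorem sum_powersetCard_ite_subset {α : Type*} [DecidableEq α] (A B : Finset α) (hB : B ⊆ A)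
    (d : ℕ) : ∑ S ∈ A.powersetCard d, (if S ⊆ B then (1 : ℝ) else 0) = (B.card.choose d : ℝ) := by
  rw [← Finset.sum_filter, Finset.sum_const, nsmul_one, ← Finset.card_powersetCard]
  congr 2
  ext S
  simp only [Finset.mem_filter, Finset.mem_powersetCard]
  exact ⟨fun h => ⟨h.2, h.1.2⟩, fun h => ⟨⟨h.1.trans hB, h.2⟩, h.1⟩⟩

/-- The probability that a task joins a given server with queue length `l` is the difference
quotient of the probabilities that all sampled queues have length at least `l`. -/
theorem assignProb_mul (d : ℕ) (x : Fin N → ℕ) {i : Fin G.numDisp} {j : Fin N} (hj : j ∈ G.nbr i)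
    (hd : d ≤ (G.nbr i).card) :
    G.assignProb d x i j * (((G.nbr i).card.choose d : ℝ) *
      ((G.nbrGE x i (x j) : ℝ) - G.nbrGE x i (x j + 1))) =
      ((G.nbrGE x i (x j)).choose d : ℝ) - (G.nbrGE x i (x j + 1)).choose d := by
  have hc : ((G.nbr i).card.choose d : ℝ) ≠ 0 := Nat.cast_ne_zero.2 (Nat.choose_pos hd).ne'
  have hsum : ∑ j' ∈ (G.nbr i).filter (fun j' => x j' = x j), (∑ S ∈ (G.nbr i).powersetCard d,
      if j' ∈ shortest x S then 1 / ((shortest x S).card : ℝ) else 0) =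
      ((G.nbrGE x i (x j)).choose d : ℝ) - (G.nbrGE x i (x j + 1)).choose d := by
    rw [Finset.sum_comm, Finset.sum_congr rfl fun S hS =>
      sum_level_mem_shortest x (Finset.mem_powersetCard.1 hS).1 (x j), Finset.sum_sub_distrib,
      sum_powersetCard_ite_subset _ _ (Finset.filter_subset _ _),
      sum_powersetCard_ite_subset _ _ (Finset.filter_subset _ _)]
    rfl
  rw [Finset.sum_congr rfl fun j' hj' => sum_mem_shortest_eq x (G.nbr i) d
    (Finset.mem_filter.1 hj').1 hj (Finset.mem_filter.1 hj').2, Finset.sum_const, nsmul_eq_mul,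
    card_level_eq_nbrGE_sub] at hsum
  rw [← hsum, assignProb, if_pos hd, ← mul_assoc, div_mul_cancel₀ _ hc, mul_comm]

/-- The fraction of the neighbors of dispatcher `i` with queue length at least `l`. -/
def nbrFrac (x : Fin N → ℕ) (i : Fin G.numDisp) (l : ℕ) : ℝ :=
  (G.nbrGE x i l : ℝ) / (G.nbr i).card

theorem nbrFrac_mem (x : Fin N → ℕ) (i : Fin G.numDisp) (l : ℕ) :
    G.nbrFrac x i l ∈ Set.Icc (0 : ℝ) 1 :=
  ⟨by unfold nbrFrac; positivity, div_le_one_of_le₀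
    (by exact_mod_cast Finset.card_le_card (Finset.filter_subset _ _)) (by positivity)⟩

/-- `assignProb_mul` in terms of the fractions of the neighbors with long queues: the exact form of
the assignment probability, of which `geomQuot` is the limit for large neighborhoods. -/
theorem card_mul_assignProb {d : ℕ} (hd : 1 ≤ d) (x : Fin N → ℕ) {i : Fin G.numDisp} {j : Fin N}
    (hj : j ∈ G.nbr i) (hdn : d ≤ (G.nbr i).card) :
    (G.nbr i).card * G.assignProb d x i j * fallProd (1 / (G.nbr i).card) d 1 =
      fallQuot (1 / (G.nbr i).card) d (G.nbrFrac x i (x j)) (G.nbrFrac x i (x j + 1)) := by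
  set n := (G.nbr i).card with hn
  have hn0 : 0 < n := hd.trans hdn
  have hn' : (n : ℝ) ≠ 0 := by positivity
  have h := G.assignProb_mul d x hj hdn
  rw [← hn] at h
  have hlt : G.nbrGE x i (x j + 1) < G.nbrGE x i (x j) := by
    refine Finset.card_lt_card ⟨fun j' hj' => ?_, fun hsub => ?_⟩
    · rw [Finset.mem_filter] at hj' ⊢
      exact ⟨hj'.1, by omega⟩
    · have := (Finset.mem_filter.1 (hsub (Finset.mem_filter.2 ⟨hj, le_rfl⟩))).2
      omega
  have hlt' : ((G.nbrGE x i (x j) : ℝ) - G.nbrGE x i (x j + 1)) ≠ 0 :=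
    sub_ne_zero.2 (by exact_mod_cast hlt.ne')
  have hne : G.nbrFrac x i (x j) - G.nbrFrac x i (x j + 1) ≠ 0 := by
    rw [nbrFrac, nbrFrac, ← hn, ← sub_div]
    exact div_ne_zero hlt' hn'
  refine mul_right_cancel₀ hne ?_
  have h1 : fallProd (1 / n) d 1 = n.descFactorial d / (n : ℝ) ^ d := by
    rw [← fallProd_natCast d n hn0, div_self hn']
  rw [fallQuot_mul, nbrFrac, nbrFrac, ← hn, fallProd_natCast d _ hn0, fallProd_natCast d _ hn0, h1]
  simp only [Nat.descFactorial_eq_factorial_mul_choose]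
  push_cast
  field_simp
  linear_combination h

end CompatSystem

/-- For a dispatcher with many neighbors, sampling without replacement is asymptotically the same
as sampling with replacement. -/
theorem CompatSystem.exists_card_mul_assignProb_close {d : ℕ} (hd : 1 ≤ d) {ε : ℝ} (hε : 0 < ε) :
    ∃ n₀ : ℕ, ∀ {K M N : ℕ} (G : CompatSystem K M N) (x : Fin N → ℕ) (i : Fin G.numDisp)
      (j : Fin N), j ∈ G.nbr i → n₀ ≤ (G.nbr i).card →
      |(G.nbr i).card * G.assignProb d x i j -
        geomQuot d (G.nbrFrac x i (x j)) (G.nbrFrac x i (x j + 1))| ≤ ε := by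
  have h1 := (unifClose_fallProd d (fun _ (_ : UnitPair) => ⟨1, zero_le_one, le_rfl⟩)).1
  simp only [one_pow] at h1
  have h2 := (unifClose_fallQuot d).1.mul (h1.inv one_pos) (unifClose_fallQuot d).2
    (UnifBdd.const _)
  obtain ⟨n₀, hn₀⟩ := eventually_atTop.1 ((h2 ε hε).and (h1 (1 / 2) (by norm_num)))
  refine ⟨max n₀ d, fun G x i j hj hn => ?_⟩
  obtain ⟨h3, h4⟩ := hn₀ _ (le_of_max_le_left hn)
  let z : UnitPair := (⟨_, G.nbrFrac_mem x i (x j)⟩, ⟨_, G.nbrFrac_mem x i (x j + 1)⟩)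
  have h5 := h3 z
  have h6 := (abs_le.1 (h4 z)).1
  have h7 := G.card_mul_assignProb hd x hj (le_of_max_le_right hn)
  simp only [z, inv_one, mul_one] at h5 h6
  rwa [← h7, mul_inv_cancel_right₀ (by linarith)] at h5

/-! ### Counting edges -/

namespace CompatSystem

section

variable {K M N : ℕ} (G : CompatSystem K M N)

theorem card_edgesTo_eq_sum (k : Fin K) (U : Finset (Fin N)) :
    (G.edgesTo k U).card =
      ∑ i ∈ G.dispOf k, ∑ j ∈ U, if (i, j) ∈ G.edges then 1 else 0 := by
  rw [← Finset.sum_product', ← Finset.card_filter]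
  congr 1
  ext e
  simp only [edgesTo, Finset.mem_filter, Finset.mem_product]
  tauto

theorem card_edgesTo_eq_sum_degV (k : Fin K) (U : Finset (Fin N)) :
    (G.edgesTo k U).card = ∑ j ∈ U, G.degV k j := by
  rw [card_edgesTo_eq_sum, Finset.sum_comm]
  exact Finset.sum_congr rfl fun j _ => (Finset.card_filter _ _).symm

theorem card_nbr_inter (i : Fin G.numDisp) (U : Finset (Fin N)) :
    (G.nbr i ∩ U).card = ∑ j ∈ U, if (i, j) ∈ G.edges then 1 else 0 := by
  rw [← Finset.card_filter]
  congr 1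
  ext j
  simp [nbr, and_comm]

theorem card_edgesTo_eq_sum_nbr (k : Fin K) (U : Finset (Fin N)) :
    (G.edgesTo k U).card = ∑ i ∈ G.dispOf k, (G.nbr i ∩ U).card := by
  simp only [card_edgesTo_eq_sum, card_nbr_inter]

theorem degW_eq (i : Fin G.numDisp) (m : Fin M) : G.degW i m = (G.nbr i ∩ G.servOf m).card := by
  rw [card_nbr_inter, ← Finset.card_filter]
  rfl

/-- Decomposition of a sum over servers by their types. -/
theorem sum_servOf {β : Type*} [AddCommMonoid β] (U : Finset (Fin N)) (f : Fin N → β) :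
    ∑ j ∈ U, f j = ∑ m, ∑ j ∈ U ∩ G.servOf m, f j := by
  rw [← Finset.sum_fiberwise U G.servType f]
  refine Finset.sum_congr rfl fun m _ => Finset.sum_congr ?_ fun _ _ => rfl
  ext j
  simp [servOf]

theorem sum_dispOf {β : Type*} [AddCommMonoid β] (f : Fin G.numDisp → β) :
    ∑ i, f i = ∑ k, ∑ i ∈ G.dispOf k, f i := by
  rw [← Finset.sum_fiberwise Finset.univ G.dispType f]
  rfl

theorem card_nbr_eq (i : Fin G.numDisp) : (G.nbr i).card = ∑ m, G.degW i m := by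
  have := G.sum_servOf (G.nbr i) fun _ => 1
  simpa [degW_eq] using this

theorem degW_le (i : Fin G.numDisp) (m : Fin M) : G.degW i m ≤ (G.servOf m).card :=
  Finset.card_le_card (Finset.filter_subset _ _)

theorem degV_le (k : Fin K) (j : Fin N) : G.degV k j ≤ (G.dispOf k).card :=
  Finset.card_le_card (Finset.filter_subset _ _)

theorem card_servOf_le (m : Fin M) : (G.servOf m).card ≤ N :=
  (Finset.card_le_univ _).trans (by simp)

/-- The fraction of the servers of type `m` that lie in `U`. -/
def servFrac (U : Finset (Fin N)) (m : Fin M) : ℝ :=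
  ((U ∩ G.servOf m).card : ℝ) / (G.servOf m).card

theorem servFrac_mem (U : Finset (Fin N)) (m : Fin M) : G.servFrac U m ∈ Set.Icc (0 : ℝ) 1 :=
  ⟨by unfold servFrac; positivity, div_le_one_of_le₀
    (by exact_mod_cast Finset.card_le_card Finset.inter_subset_right) (by positivity)⟩

/-- The servers with queue length at least `l`. -/
def levelSet (x : Fin N → ℕ) (l : ℕ) : Finset (Fin N) := Finset.univ.filter fun j => l ≤ x j

theorem servFrac_levelSet (x : Fin N → ℕ) (m : Fin M) (l : ℕ) :
    G.servFrac (levelSet x l) m = G.occFun x (m, l) := by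
  unfold servFrac occFun
  congr 3
  ext j
  simp [levelSet, and_comm]

theorem occFun_mem_Icc (x : Fin N → ℕ) (a : Fin M × ℕ) : G.occFun x a ∈ Set.Icc (0 : ℝ) 1 := by
  rw [← servFrac_levelSet]
  exact G.servFrac_mem _ _

theorem nbrFrac_eq (x : Fin N → ℕ) (i : Fin G.numDisp) (l : ℕ) :
    G.nbrFrac x i l = ((G.nbr i ∩ levelSet x l).card : ℝ) / (G.nbr i).card := by
  unfold nbrFrac nbrGE
  congr 3
  ext j
  simp [levelSet]

/-- The servers of type `m` with queue length `l`. -/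
def levelOf (x : Fin N → ℕ) (m : Fin M) (l : ℕ) : Finset (Fin N) :=
  (G.servOf m).filter fun j => x j = l

theorem card_levelOf (x : Fin N → ℕ) (m : Fin M) (l : ℕ) :
    ((G.levelOf x m l).card : ℝ) / (G.servOf m).card =
      G.occFun x (m, l) - G.occFun x (m, l + 1) := by
  unfold occFun levelOf
  rw [← sub_div]
  congr 1
  rw [eq_sub_iff_add_eq, ← Nat.cast_add, ← Finset.card_union_of_disjoint]
  · congr 2
    ext j
    simp only [Finset.mem_union, Finset.mem_filter]
    constructor
    · rintro (⟨h1, h2⟩ | ⟨h1, h2⟩)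
      exacts [⟨h1, h2.ge⟩, ⟨h1, by omega⟩]
    · rintro ⟨h1, h2⟩
      rcases h2.eq_or_lt with h | h
      exacts [Or.inl ⟨h1, h.symm⟩, Or.inr ⟨h1, h⟩]
  · rw [Finset.disjoint_filter]
    intro j _ h
    omega

theorem occFun_mem_occSetBar (h : ∀ m, 0 < (G.servOf m).card) (x : Fin N → ℕ) :
    G.occFun x ∈ occSetBar M := by
  refine ⟨G.occFun_mem_Icc x, fun m => ?_, fun m l => ?_⟩
  · have : ((G.servOf m).card : ℝ) ≠ 0 := by exact_mod_cast (h m).ne'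
    simp [occFun, div_self this]
  · rw [← sub_nonneg, ← card_levelOf]
    positivity

end

end CompatSystem

/-! ### Asymptotic regularity of the degrees -/

theorem le_mul_of_maxMinRatio {α : Type*} {s : Finset α} {f : α → ℕ} {ε : ℝ}
    (h : |maxMinRatio s f - 1| ≤ ε) (hε0 : 0 ≤ ε) (hε : ε < 1) {a b : α} (ha : a ∈ s) (hb : b ∈ s) :
    (f a : ℝ) ≤ (1 + ε) * f b := by
  unfold maxMinRatio at h
  split_ifs at h with h0
  · simp [h0 a ha, h0 b hb]
  · have h1 := abs_le.1 h
    have hmin : sInf (f '' s) ≠ 0 := by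
      intro h2
      rw [h2] at h1
      simp only [Nat.cast_zero, div_zero] at h1
      linarith
    have hpos : (0 : ℝ) < (sInf (f '' s) : ℕ) := by exact_mod_cast Nat.pos_of_ne_zero hmin
    have h2 : ((s.sup f : ℕ) : ℝ) ≤ (1 + ε) * (sInf (f '' s) : ℕ) := by
      rw [← div_le_iff₀ hpos]; linarith
    have h3 : (f a : ℝ) ≤ (s.sup f : ℕ) := by exact_mod_cast Finset.le_sup (f := f) ha
    have h4 : ((sInf (f '' s) : ℕ) : ℝ) ≤ f b := by
      exact_mod_cast Nat.sInf_le (Set.mem_image_of_mem f (show b ∈ (s : Set α) from hb))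
    exact h3.trans (h2.trans (mul_le_mul_of_nonneg_left h4 (by linarith)))

/-- If the values of `f` are asymptotically equal, they are asymptotically equal to their average.
The values, which are at most `B`, and `B` are scaled by `N`. -/
theorem unifClose_of_maxMinRatio {α : ℕ → Type*} (s : ∀ N, Finset (α N)) (f : ∀ N, α N → ℕ)
    (B : ℕ → ℕ) {p β : ℝ} (hfB : ∀ N, ∀ a ∈ s N, f N a ≤ B N)
    (hratio : Tendsto (fun N => maxMinRatio (s N) (f N)) atTop (𝓝 1))
    (havg : Tendsto (fun N => ((∑ a ∈ s N, f N a : ℕ) : ℝ) / ((s N).card * B N)) atTop (𝓝 p))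
    (hB : Tendsto (fun N : ℕ => (B N : ℝ) / N) atTop (𝓝 β)) :
    UnifClose (fun N (a : {a // a ∈ s N}) => (f N a : ℝ) / N) fun _ _ => p * β := by
  have h1 : UnifClose (fun N (a : {a // a ∈ s N}) => (f N a : ℝ) / B N)
      fun N _ => ((∑ a ∈ s N, f N a : ℕ) : ℝ) / ((s N).card * B N) := by
    intro ε hε
    have hε' : 0 < min ε (1 / 2) := lt_min hε (by norm_num)
    filter_upwards [Metric.tendsto_nhds.1 hratio _ hε'] with N hN
    rintro ⟨a, ha⟩
    have hr : ∀ {a b}, a ∈ s N → b ∈ s N → (f N a : ℝ) ≤ f N b + ε * B N := fun {a b} ha hb => by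
      have h := le_mul_of_maxMinRatio hN.le hε'.le ((min_le_right _ _).trans_lt (by norm_num)) ha hb
      have h2 : (f N b : ℝ) ≤ B N := by exact_mod_cast hfB N b hb
      have h3 := mul_le_mul (min_le_left ε (1 / 2)) h2 (by positivity) hε.le
      linarith
    rcases Nat.eq_zero_or_pos (B N) with h0 | h0
    · simp [h0, hε.le]
    have hs : (0 : ℝ) < (s N).card := by exact_mod_cast Finset.card_pos.2 ⟨a, ha⟩
    have hB0 : (0 : ℝ) < B N := by exact_mod_cast h0
    rw [show (f N a : ℝ) / B N - ((∑ a ∈ s N, f N a : ℕ) : ℝ) / ((s N).card * B N) =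
      (∑ b ∈ s N, ((f N a : ℝ) - f N b)) / ((s N).card * B N) by
        rw [Finset.sum_sub_distrib, Finset.sum_const, nsmul_eq_mul]; push_cast; field_simp,
      abs_div, abs_of_pos (mul_pos hs hB0), div_le_iff₀ (mul_pos hs hB0)]
    calc |∑ b ∈ s N, ((f N a : ℝ) - f N b)| ≤ ∑ b ∈ s N, |(f N a : ℝ) - f N b| :=
          Finset.abs_sum_le_sum_abs _ _
      _ ≤ ∑ b ∈ s N, ε * B N := Finset.sum_le_sum fun b hb => abs_le.2
          ⟨by linarith [hr hb ha], by linarith [hr ha hb]⟩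
      _ = _ := by rw [Finset.sum_const, nsmul_eq_mul]; ring
  have h2 := (h1.trans (UnifClose.of_tendsto havg)).mul
    (UnifClose.of_tendsto (ι := fun N => {a // a ∈ s N}) hB) (UnifBdd.const _) (UnifBdd.const _)
  convert h2 using 3 with N a
  rcases Nat.eq_zero_or_pos (B N) with h0 | h0
  · have := hfB N a a.2
    rw [h0, Nat.le_zero] at this
    simp [this, h0]
  · have : (B N : ℝ) ≠ 0 := by positivity
    field_simp

section Asymptotics

variable {K M : ℕ} {G : ∀ N, CompatSystem K M N} {xi : ℝ} {w : Fin K → ℝ} {v : Fin M → ℝ}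
  {p : Fin K → Fin M → ℝ}

theorem HasProportions.tendsto_dispOf (h : HasProportions G xi w v) (k : Fin K) :
    Tendsto (fun N : ℕ => (((G N).dispOf k).card : ℝ) / N) atTop (𝓝 (w k * xi)) := by
  refine ((h.2.1 k).mul h.1).congr fun N => ?_
  rcases Nat.eq_zero_or_pos (G N).numDisp with h0 | h0
  · have : ((G N).dispOf k).card = 0 :=
      Nat.le_zero.1 ((Finset.card_le_univ _).trans (by simp [h0]))
    simp [this]
  · have : ((G N).numDisp : ℝ) ≠ 0 := by positivity
    field_simp

theorem HasCompatMatrix.nonneg (h : HasCompatMatrix G p) (k : Fin K) (m : Fin M) : 0 ≤ p k m :=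
  ge_of_tendsto' (h k m).1 fun N => by positivity

theorem unifClose_degW (hprop : HasProportions G xi w v) (hcompat : HasCompatMatrix G p)
    (k : Fin K) (m : Fin M) :
    UnifClose (fun N (i : {i // i ∈ (G N).dispOf k}) => ((G N).degW i m : ℝ) / N)
      fun _ _ => p k m * v m := by
  refine unifClose_of_maxMinRatio _ (fun N i => (G N).degW i m) (fun N => ((G N).servOf m).card)
    (fun N i _ => (G N).degW_le i m) (hcompat k m).2.1 ?_ (hprop.2.2 m)
  refine (hcompat k m).1.congr fun N => ?_
  rw [CompatSystem.card_edgesTo_eq_sum_nbr]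
  simp only [CompatSystem.degW_eq]

theorem unifClose_degV (hprop : HasProportions G xi w v) (hcompat : HasCompatMatrix G p)
    (k : Fin K) (m : Fin M) :
    UnifClose (fun N (j : {j // j ∈ (G N).servOf m}) => ((G N).degV k j : ℝ) / N)
      fun _ _ => p k m * (w k * xi) := by
  refine unifClose_of_maxMinRatio _ (fun N j => (G N).degV k j) (fun N => ((G N).dispOf k).card)
    (fun N j _ => (G N).degV_le k j) (hcompat k m).2.2 ?_ (hprop.tendsto_dispOf k)
  refine (hcompat k m).1.congr fun N => ?_
  rw [CompatSystem.card_edgesTo_eq_sum_degV, mul_comm]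

theorem unifClose_card_nbr (hprop : HasProportions G xi w v) (hcompat : HasCompatMatrix G p)
    (k : Fin K) :
    UnifClose (fun N (i : {i // i ∈ (G N).dispOf k}) => (((G N).nbr i).card : ℝ) / N)
      fun _ _ => limDeg v p k := by
  have h := UnifClose.sum Finset.univ fun m _ => unifClose_degW hprop hcompat k m
  convert h using 3 with N i
  · rw [CompatSystem.card_nbr_eq, ← Finset.sum_div]
    push_cast; rfl
  · rfl

/-- The number of edges into a set of servers of one type is asymptotically proportional to its
size. -/
theorem eventually_sum_degV (hprop : HasProportions G xi w v) (hcompat : HasCompatMatrix G p)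
    (k : Fin K) (m : Fin M) {ε : ℝ} (hε : 0 < ε) :
    ∀ᶠ N in atTop, ∀ A ⊆ (G N).servOf m,
      |(∑ j ∈ A, ((G N).degV k j : ℝ)) / N - p k m * (w k * xi) * A.card| ≤ ε * A.card := by
  filter_upwards [unifClose_degV hprop hcompat k m ε hε] with N hN A hA
  calc |(∑ j ∈ A, ((G N).degV k j : ℝ)) / N - p k m * (w k * xi) * A.card|
      = |∑ j ∈ A, (((G N).degV k j : ℝ) / N - p k m * (w k * xi))| := by
        rw [Finset.sum_sub_distrib, Finset.sum_const, nsmul_eq_mul, Finset.sum_div]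
        congr 2; ring
    _ ≤ ∑ j ∈ A, ε := (Finset.abs_sum_le_sum_abs _ _).trans
        (Finset.sum_le_sum fun j hj => hN ⟨j, hA hj⟩)
    _ = _ := by rw [Finset.sum_const, nsmul_eq_mul, mul_comm]

theorem unifClose_card_edgesTo (hprop : HasProportions G xi w v) (hcompat : HasCompatMatrix G p)
    (k : Fin K) :
    UnifClose (fun N (U : Finset (Fin N)) => (((G N).edgesTo k U).card : ℝ) / N / N)
      fun N U => ∑ m, p k m * (w k * xi) * (v m * (G N).servFrac U m) := by
  have h1 : ∀ m, UnifClose (fun N (U : Finset (Fin N)) =>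
      (∑ j ∈ U ∩ (G N).servOf m, ((G N).degV k j : ℝ)) / N / N)
      fun N U => p k m * (w k * xi) * (v m * (G N).servFrac U m) := fun m => by
    have h2 : UnifClose (fun N (U : Finset (Fin N)) =>
        (∑ j ∈ U ∩ (G N).servOf m, ((G N).degV k j : ℝ)) / N / N)
        fun N U => p k m * (w k * xi) * (((U ∩ (G N).servOf m).card : ℝ) / N) := fun ε hε => by
      filter_upwards [eventually_sum_degV hprop hcompat k m hε, eventually_gt_atTop 0]
        with N hN hN0 U
      have hN' : (0 : ℝ) < N := by exact_mod_cast hN0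
      have h3 := hN (U ∩ (G N).servOf m) Finset.inter_subset_right
      have h4 : ((U ∩ (G N).servOf m).card : ℝ) ≤ N := by
        exact_mod_cast (Finset.card_le_univ _).trans (by simp)
      rw [mul_div_assoc', ← sub_div, abs_div, abs_of_pos hN', div_le_iff₀ hN']
      exact h3.trans (mul_le_mul_of_nonneg_left h4 hε.le)
    have h5 : UnifClose (fun N (U : Finset (Fin N)) => ((U ∩ (G N).servOf m).card : ℝ) / N)
        fun N U => v m * (G N).servFrac U m := by
      have hb : UnifBdd fun N (U : Finset (Fin N)) => (G N).servFrac U m :=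
        unifBdd_unit fun N (U : Finset (Fin N)) => ⟨_, (G N).servFrac_mem U m⟩
      have h6 := (UnifClose.of_tendsto (ι := fun N => Finset (Fin N)) (hprop.2.2 m)).mul
        (UnifClose.refl fun N (U : Finset (Fin N)) => (G N).servFrac U m) (UnifBdd.const _) hb
      convert h6 using 3 with N U
      rcases Nat.eq_zero_or_pos ((G N).servOf m).card with h0 | h0
      · have : (U ∩ (G N).servOf m).card = 0 :=
          Nat.le_zero.1 ((Finset.card_le_card Finset.inter_subset_right).trans h0.le)
        simp [this, h0]
      · have : (((G N).servOf m).card : ℝ) ≠ 0 := by positivity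
        unfold CompatSystem.servFrac
        field_simp
    refine h2.trans ((UnifClose.refl _).mul h5 (UnifBdd.const _) ?_)
    exact (UnifBdd.const _).mul (unifBdd_unit fun N (U : Finset (Fin N)) =>
      ⟨_, (G N).servFrac_mem U m⟩)
  have h := UnifClose.sum Finset.univ fun m _ => h1 m
  convert h using 3 with N U
  rw [CompatSystem.card_edgesTo_eq_sum_degV, Nat.cast_sum, (G N).sum_servOf U, Finset.sum_div,
    Finset.sum_div]

/-- The fraction of the edges of the dispatchers of type `k` that lead to `U`. -/
theorem unifClose_edge_ratio (hprop : HasProportions G xi w v) (hcompat : HasCompatMatrix G p)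
    (hxi : 0 < xi) (hw : ∀ k, 0 < w k) (hv : ∀ m, 0 < v m) (hp : ∀ k, 0 < limDeg v p k)
    (k : Fin K) :
    UnifClose (fun N (U : Finset (Fin N)) =>
        (((G N).edgesTo k U).card : ℝ) / ((G N).edgesTo k Finset.univ).card)
      fun N U => ∑ m, v m * p k m / limDeg v p k * (G N).servFrac U m := by
  have h1 := unifClose_card_edgesTo hprop hcompat k
  have hwx : 0 < w k * xi := mul_pos (hw k) hxi
  have hfull : UnifClose (fun N (_ : Finset (Fin N)) =>
      (((G N).edgesTo k Finset.univ).card : ℝ) / N / N)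
      fun _ _ => w k * xi * limDeg v p k := by
    refine (h1.comp fun N (_ : Finset (Fin N)) => Finset.univ).trans ?_
    have h2 : ∀ m, UnifClose (fun N (_ : Finset (Fin N)) => (G N).servFrac Finset.univ m)
        fun _ _ => 1 := fun m ε hε => by
      filter_upwards [(hprop.2.2 m).eventually (lt_mem_nhds (hv m))] with N hN _
      have : (((G N).servOf m).card : ℝ) ≠ 0 := fun h0 => by simp [h0] at hN
      rw [CompatSystem.servFrac, Finset.univ_inter, div_self this, sub_self, abs_zero]
      exact hε.le
    have h3 := UnifClose.sum Finset.univ fun m _ =>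
      (UnifClose.refl fun N (_ : Finset (Fin N)) => p k m * (w k * xi) * v m).mul (h2 m)
        (UnifBdd.const _) (UnifBdd.const _)
    convert h3 using 3 with N U N U
    · exact Finset.sum_congr rfl fun m _ => by ring
    · rw [limDeg, Finset.mul_sum]
      exact Finset.sum_congr rfl fun m _ => by ring
  have h4 := h1.mul (hfull.inv (mul_pos hwx (hp k)))
    (UnifBdd.sum _ fun m _ => (UnifBdd.const _).mul ((UnifBdd.const _).mul
      (unifBdd_unit fun N (U : Finset (Fin N)) => ⟨_, (G N).servFrac_mem U m⟩)))
    (UnifBdd.const _)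
  intro ε hε
  filter_upwards [h4 ε hε, eventually_gt_atTop 0] with N hN hN0 U
  have hN' : (N : ℝ) ≠ 0 := by positivity
  convert hN U using 3
  · by_cases h0 : (((G N).edgesTo k Finset.univ).card : ℝ) = 0
    · simp [h0]
    · field_simp
  · rw [Finset.sum_mul]
    have := (hp k).ne'
    have := (hw k).ne'
    refine Finset.sum_congr rfl fun m _ => ?_
    field_simp

end Asymptotics

/-! ### The drift of the occupancy process -/

theorem exists_geomQuot_le (d : ℕ) :
    ∃ C, 0 ≤ C ∧ ∀ z : UnitPair, |geomQuot d z.1 z.2| ≤ C := by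
  obtain ⟨C, hC, h⟩ := (unifClose_fallQuot d).2
  obtain ⟨n, hn⟩ := h.exists
  exact ⟨C, hC, hn⟩

theorem exists_geomQuot_sub_le (d : ℕ) {ε : ℝ} (hε : 0 < ε) :
    ∃ η, 0 < η ∧ ∀ z z' : UnitPair, |(z.1 : ℝ) - z'.1| < η → |(z.2 : ℝ) - z'.2| < η →
      |geomQuot d z.1 z.2 - geomQuot d z'.1 z'.2| ≤ ε := by
  have hc : Continuous fun z : UnitPair => geomQuot d z.1 z.2 := by
    unfold geomQuot; unfold UnitPair; fun_prop
  have hu := CompactSpace.uniformContinuous_of_continuous hc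
  obtain ⟨η, hη, h⟩ := Metric.uniformContinuous_iff.1 hu ε hε
  exact ⟨η, hη, fun z z' h1 h2 => (h (max_lt h1 h2 : dist z z' < η)).le⟩

namespace CompatSystem

variable {K M N : ℕ} (G : CompatSystem K M N)

theorem assignProb_eq_zero (d : ℕ) (x : Fin N → ℕ) {i : Fin G.numDisp} {j : Fin N}
    (hj : j ∉ G.nbr i) : G.assignProb d x i j = 0 := by
  unfold assignProb
  rw [if_neg hj, ite_eq_right_iff]
  intro _
  rw [Finset.sum_eq_zero, zero_div]
  intro S hS
  refine if_neg fun h => hj ?_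
  exact (Finset.mem_powersetCard.1 hS).1 (Finset.mem_filter.1 h).1

/-- The change of `occFun` at an arrival. -/
theorem occFun_update_succ (x : Fin N → ℕ) (m : Fin M) (l : ℕ) (j : Fin N) :
    G.occFun (Function.update x j (x j + 1)) (m, l + 1) - G.occFun x (m, l + 1) =
      if j ∈ G.levelOf x m l then 1 / ((G.servOf m).card : ℝ) else 0 := by
  unfold occFun
  rw [← sub_div, Finset.card_filter, Finset.card_filter]
  push_cast
  rw [← Finset.sum_sub_distrib]
  have h : ∀ j' ∈ G.servOf m, ((if l + 1 ≤ Function.update x j (x j + 1) j' then (1 : ℝ) else 0) -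
      if l + 1 ≤ x j' then 1 else 0) = if j = j' then (if x j = l then 1 else 0) else 0 := by
    intro j' _
    rcases eq_or_ne j j' with rfl | h
    · rw [Function.update_self, if_pos rfl]
      rcases lt_trichotomy (x j) l with h | h | h
      · rw [if_neg (by omega), if_neg (by omega), if_neg (by omega), sub_zero]
      · rw [if_pos (by omega), if_neg (by omega), if_pos h, sub_zero]
      · rw [if_pos (by omega), if_pos (by omega), if_neg (by omega), sub_self]
    · rw [Function.update_of_ne h.symm, sub_self, if_neg h]
  rw [Finset.sum_congr rfl h, Finset.sum_ite_eq]
  simp only [levelOf, Finset.mem_filter]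
  split_ifs <;> simp_all

/-- The change of `occFun` at a departure. -/
theorem occFun_update_pred (x : Fin N → ℕ) (m : Fin M) (l : ℕ) {j : Fin N} (hj : 0 < x j) :
    G.occFun (Function.update x j (x j - 1)) (m, l + 1) - G.occFun x (m, l + 1) =
      -if j ∈ G.levelOf x m (l + 1) then 1 / ((G.servOf m).card : ℝ) else 0 := by
  have h := G.occFun_update_succ (Function.update x j (x j - 1)) m l j
  rw [Function.update_self, Function.update_idem, Nat.sub_add_cancel hj,
    Function.update_eq_self] at h
  rw [← neg_sub, h]
  have h2 : j ∈ G.levelOf (Function.update x j (x j - 1)) m l ↔ j ∈ G.levelOf x m (l + 1) := by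
    simp only [levelOf, Finset.mem_filter, Function.update_self]
    exact and_congr_right fun _ => by omega
  simp only [h2]

/-- The rate, up to the factor `lam`, at which the tasks of type `k` are assigned to servers of type
`m` with queue length `l`, per server of type `m`. -/
def arrivalRate (d : ℕ) (x : Fin N → ℕ) (k : Fin K) (m : Fin M) (l : ℕ) : ℝ :=
  (∑ i ∈ G.dispOf k, ∑ j ∈ G.levelOf x m l, G.assignProb d x i j) / (G.servOf m).card

theorem generator_occFun (d : ℕ) (lam : ℝ) (u : Fin M → ℝ) (x : Fin N → ℕ) (m : Fin M) (l : ℕ) :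
    G.generator d lam u (fun x => G.occFun x (m, l + 1)) x =
      -u m * (G.occFun x (m, l + 1) - G.occFun x (m, l + 2)) +
        lam * ∑ k, G.arrivalRate d x k m l := by
  unfold generator
  rw [add_comm]
  congr 1
  · rw [show l + 2 = l + 1 + 1 from rfl, ← card_levelOf]
    calc _ = ∑ j, if j ∈ G.levelOf x m (l + 1) then
            -u m * (1 / ((G.servOf m).card : ℝ)) else 0 := by
          refine Finset.sum_congr rfl fun j _ => ?_
          split_ifs with h1 h2 h2
          · rw [occFun_update_pred _ _ _ _ h1, if_pos h2,
              (Finset.mem_filter.1 (Finset.mem_filter.1 h2).1).2]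
            ring
          · rw [occFun_update_pred _ _ _ _ h1, if_neg h2, neg_zero, mul_zero]
          · exact absurd ((Finset.mem_filter.1 h2).2 ▸ Nat.succ_pos l) h1
          · rfl
      _ = _ := by
          rw [← Finset.sum_filter, Finset.filter_univ_mem, Finset.sum_const, nsmul_eq_mul]
          ring
  · unfold arrivalRate
    rw [← Finset.sum_div, ← sum_dispOf, Finset.sum_div, Finset.mul_sum]
    refine Finset.sum_congr rfl fun i _ => ?_
    simp only [occFun_update_succ, mul_ite, mul_zero]
    rw [← Finset.sum_filter, Finset.filter_univ_mem, Finset.sum_div, Finset.mul_sum]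
    exact Finset.sum_congr rfl fun j _ => by ring

end CompatSystem

/-- The assumptions on the sequence of systems and its limiting parameters. -/
structure LimitRegime {K M : ℕ} (G : ∀ N, CompatSystem K M N) (xi : ℝ) (w : Fin K → ℝ)
    (v : Fin M → ℝ) (p : Fin K → Fin M → ℝ) : Prop where
  prop : HasProportions G xi w v
  compat : HasCompatMatrix G p
  sparse : ClusteredProportionallySparse G
  xi_pos : 0 < xi
  w_pos : ∀ k, 0 < w k
  v_pos : ∀ m, 0 < v m
  limDeg_pos : ∀ k, 0 < limDeg v p k

theorem weightedOcc_mem {K M : ℕ} {v : Fin M → ℝ} {p : Fin K → Fin M → ℝ} (hv : ∀ m, 0 < v m)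
    (hp0 : ∀ k m, 0 ≤ p k m) (hp : ∀ k, 0 < limDeg v p k) {q : Fin M × ℕ → ℝ}
    (hq : ∀ a, q a ∈ Set.Icc (0 : ℝ) 1) (k : Fin K) (l : ℕ) :
    weightedOcc v p q k l ∈ Set.Icc (0 : ℝ) 1 := by
  have h0 : ∀ m, 0 ≤ v m * p k m / limDeg v p k := fun m =>
    div_nonneg (mul_nonneg (hv m).le (hp0 k m)) (hp k).le
  refine ⟨Finset.sum_nonneg fun m _ => mul_nonneg (h0 m) (hq _).1, ?_⟩
  calc weightedOcc v p q k l ≤ ∑ m, v m * p k m / limDeg v p k :=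
        Finset.sum_le_sum fun m _ => mul_le_of_le_one_right (h0 m) (hq _).2
    _ = 1 := by
      rw [← Finset.sum_div, div_eq_one_iff_eq (hp k).ne']
      exact Finset.sum_congr rfl fun m _ => mul_comm _ _

theorem ClusteredProportionallySparse.eventually {K M : ℕ} {G : ∀ N, CompatSystem K M N}
    (h : ClusteredProportionallySparse G) {ε η : ℝ} (hε : 0 < ε) (hη : 0 < η) :
    ∀ᶠ N in atTop, ∀ (k : Fin K) (U : Finset (Fin N)),
      ((((G N).dispOf k).filter fun i =>
        ε ≤ |(((G N).nbr i ∩ U).card : ℝ) / (((G N).nbr i).card : ℝ) -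
          (((G N).edgesTo k U).card : ℝ) / (((G N).edgesTo k Finset.univ).card : ℝ)|).card : ℝ) ≤
        η * ((G N).dispOf k).card := by
  filter_upwards [(h ε hε).eventually (gt_mem_nhds hη)] with N hN k U
  rcases Nat.eq_zero_or_pos ((G N).dispOf k).card with h0 | h0
  · have := Nat.le_zero.1 ((Finset.card_le_card (Finset.filter_subset (fun i =>
        ε ≤ |(((G N).nbr i ∩ U).card : ℝ) / (((G N).nbr i).card : ℝ) -
          (((G N).edgesTo k U).card : ℝ) / (((G N).edgesTo k Finset.univ).card : ℝ)|)
          ((G N).dispOf k))).trans h0.le)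
    rw [this, h0]; simp
  · rw [← div_le_iff₀ (by exact_mod_cast h0)]
    refine le_trans ?_ hN.le
    refine le_ciSup_of_le (Set.finite_range _).bddAbove k ?_
    exact le_ciSup (f := fun U : Finset (Fin N) => ((((G N).dispOf k).filter fun i =>
      ε ≤ |(((G N).nbr i ∩ U).card : ℝ) / (((G N).nbr i).card : ℝ) -
        (((G N).edgesTo k U).card : ℝ) / (((G N).edgesTo k Finset.univ).card : ℝ)|).card : ℝ) /
      (((G N).dispOf k).card : ℝ)) (Set.finite_range _).bddAbove U

namespace LimitRegime

variable {K M : ℕ} {G : ∀ N, CompatSystem K M N} {xi : ℝ} {w : Fin K → ℝ} {v : Fin M → ℝ}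
  {p : Fin K → Fin M → ℝ}

theorem eventually_le_card_nbr (h : LimitRegime G xi w v p) (k : Fin K) (n₀ : ℕ) :
    ∀ᶠ N in atTop, ∀ i ∈ (G N).dispOf k, n₀ ≤ ((G N).nbr i).card := by
  have hδ := h.limDeg_pos k
  have h1 : ∀ᶠ N : ℕ in atTop, (n₀ : ℝ) ≤ N * (limDeg v p k / 2) :=
    (tendsto_natCast_atTop_atTop.atTop_mul_const (half_pos hδ)).eventually_ge_atTop _
  filter_upwards [unifClose_card_nbr h.prop h.compat k _ (half_pos hδ), h1,
    eventually_gt_atTop 0] with N hN h2 hN0 i hi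
  have hN' : (0 : ℝ) < N := by exact_mod_cast hN0
  have h3 : limDeg v p k / 2 ≤ (((G N).nbr i).card : ℝ) / N := by
    linarith [(abs_le.1 (hN ⟨i, hi⟩)).1]
  rw [le_div_iff₀ hN'] at h3
  exact_mod_cast (show (n₀ : ℝ) ≤ ((G N).nbr i).card by linarith)

/-- The probability of assignment to a given neighbor, scaled by the number of servers. -/
theorem unifClose_assignProb (h : LimitRegime G xi w v p) {d : ℕ} (hd : 1 ≤ d) (k : Fin K) :
    UnifClose (fun N (z : {i // i ∈ (G N).dispOf k} × (Fin N → ℕ) × Fin N) =>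
        N * (G N).assignProb d z.2.1 z.1 z.2.2)
      fun N z => (limDeg v p k)⁻¹ * if z.2.2 ∈ (G N).nbr z.1 then
        geomQuot d ((G N).nbrFrac z.2.1 z.1 (z.2.1 z.2.2))
          ((G N).nbrFrac z.2.1 z.1 (z.2.1 z.2.2 + 1)) else 0 := by
  have h1 : UnifClose (fun N (z : {i // i ∈ (G N).dispOf k} × (Fin N → ℕ) × Fin N) =>
        ((G N).nbr z.1).card * (G N).assignProb d z.2.1 z.1 z.2.2)
      fun N z => if z.2.2 ∈ (G N).nbr z.1 then
        geomQuot d ((G N).nbrFrac z.2.1 z.1 (z.2.1 z.2.2))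
          ((G N).nbrFrac z.2.1 z.1 (z.2.1 z.2.2 + 1)) else 0 := fun ε hε => by
    obtain ⟨n₀, hn₀⟩ := CompatSystem.exists_card_mul_assignProb_close hd hε
    filter_upwards [h.eventually_le_card_nbr k n₀] with N hN
    rintro ⟨⟨i, hi⟩, x, j⟩
    by_cases hj : j ∈ (G N).nbr i
    · simp only [if_pos hj]
      exact hn₀ (G N) x i j hj (hN i hi)
    · simp only [if_neg hj, (G N).assignProb_eq_zero d x hj, mul_zero, sub_zero, abs_zero]
      exact hε.le
  have h2 := (unifClose_card_nbr h.prop h.compat k).inv (h.limDeg_pos k)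
  have hb : UnifBdd fun N (z : {i // i ∈ (G N).dispOf k} × (Fin N → ℕ) × Fin N) =>
      if z.2.2 ∈ (G N).nbr z.1 then
        geomQuot d ((G N).nbrFrac z.2.1 z.1 (z.2.1 z.2.2))
          ((G N).nbrFrac z.2.1 z.1 (z.2.1 z.2.2 + 1)) else 0 := by
    obtain ⟨C, hC, hle⟩ := exists_geomQuot_le d
    refine UnifBdd.of_le C hC fun N z => ?_
    split_ifs
    · exact hle (⟨_, (G N).nbrFrac_mem _ _ _⟩, ⟨_, (G N).nbrFrac_mem _ _ _⟩)
    · rwa [abs_zero]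
  have h3 := (h2.comp fun N (z : {i // i ∈ (G N).dispOf k} × (Fin N → ℕ) × Fin N) => z.1).mul h1
    (UnifBdd.const _) hb
  convert h3 using 3 with N z
  rcases Nat.eq_zero_or_pos ((G N).nbr z.1).card with h0 | h0
  · rw [(G N).assignProb_eq_zero, mul_zero, mul_zero, mul_zero]
    rw [Finset.card_eq_zero.1 h0]
    exact Finset.notMem_empty _
  · have : (((G N).nbr z.1).card : ℝ) ≠ 0 := by positivity
    field_simp

/-- A task joins a given server with probability of order `1 / N`, uniformly. -/
theorem eventually_assignProb_le (h : LimitRegime G xi w v p) {d : ℕ} (hd : 1 ≤ d) :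
    ∃ C, 0 ≤ C ∧ ∀ᶠ N in atTop, ∀ x i j, N * (G N).assignProb d x i j ≤ C := by
  obtain ⟨C, hC, hle⟩ := exists_geomQuot_le d
  have h1 : ∀ k, ∃ D, 0 ≤ D ∧ ∀ᶠ N in atTop, ∀ i ∈ (G N).dispOf k, ∀ x j,
      N * (G N).assignProb d x i j ≤ D := fun k => by
    have hδ := h.limDeg_pos k
    refine ⟨(limDeg v p k)⁻¹ * C + 1, by positivity, ?_⟩
    filter_upwards [h.unifClose_assignProb hd k 1 one_pos] with N hN i hi x j
    have h2 := (abs_le.1 (hN (⟨i, hi⟩, x, j))).2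
    have h3 : (if j ∈ (G N).nbr i then geomQuot d ((G N).nbrFrac x i (x j))
        ((G N).nbrFrac x i (x j + 1)) else 0) ≤ C := by
      split_ifs
      · exact (le_abs_self _).trans
          (hle (⟨_, (G N).nbrFrac_mem x i _⟩, ⟨_, (G N).nbrFrac_mem x i _⟩))
      · exact hC
    have h4 := mul_le_mul_of_nonneg_left h3 (inv_pos.2 hδ).le
    simp only at h2
    linarith
  choose D hD hN using h1
  refine ⟨∑ k, D k, Finset.sum_nonneg fun k _ => hD k, ?_⟩
  filter_upwards [eventually_all.2 hN] with N hN x i j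
  refine (hN ((G N).dispType i) i (by simp [CompatSystem.dispOf]) x j).trans ?_
  exact Finset.single_le_sum (fun k _ => hD k) (Finset.mem_univ _)

theorem p_nonneg (h : LimitRegime G xi w v p) (k : Fin K) (m : Fin M) : 0 ≤ p k m :=
  h.compat.nonneg k m

theorem weightedOcc_occFun_mem (h : LimitRegime G xi w v p) {N : ℕ} (x : Fin N → ℕ) (k : Fin K)
    (l : ℕ) :
    weightedOcc v p ((G N).occFun x) k l ∈ Set.Icc (0 : ℝ) 1 :=
  weightedOcc_mem h.v_pos h.p_nonneg h.limDeg_pos ((G N).occFun_mem_Icc x) k l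

/-- By clustered proportional sparsity, most dispatchers of type `k` see the same queue length
distribution among their neighbors, the one given by the weighted occupancy. -/
theorem eventually_sum_geomQuot_sub_le (h : LimitRegime G xi w v p) (d : ℕ) (k : Fin K) {ε : ℝ}
    (hε : 0 < ε) :
    ∀ᶠ N in atTop, ∀ (x : Fin N → ℕ) (l : ℕ), ∑ i ∈ (G N).dispOf k,
      |geomQuot d ((G N).nbrFrac x i l) ((G N).nbrFrac x i (l + 1)) -
        geomQuot d (weightedOcc v p ((G N).occFun x) k l)
          (weightedOcc v p ((G N).occFun x) k (l + 1))| ≤ ε * ((G N).dispOf k).card := by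
  obtain ⟨C, hC, hle⟩ := exists_geomQuot_le d
  obtain ⟨η, hη, hunif⟩ := exists_geomQuot_sub_le d (half_pos hε)
  have hκ : 0 < ε / (4 * (2 * C + 1)) := by positivity
  filter_upwards [h.sparse.eventually (half_pos hη) hκ,
    unifClose_edge_ratio h.prop h.compat h.xi_pos h.w_pos h.v_pos h.limDeg_pos k _ (half_pos hη)]
    with N hbad hratio x l
  -- the dispatchers whose neighborhoods are not representative for the level `l`
  set bad : ℕ → Finset (Fin (G N).numDisp) := fun l => ((G N).dispOf k).filter fun i =>
    η / 2 ≤ |(((G N).nbr i ∩ CompatSystem.levelSet x l).card : ℝ) / (((G N).nbr i).card : ℝ) -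
      (((G N).edgesTo k (CompatSystem.levelSet x l)).card : ℝ) /
        (((G N).edgesTo k Finset.univ).card : ℝ)| with hbad_def
  have hgood : ∀ i ∈ (G N).dispOf k, ∀ l, i ∉ bad l →
      |(G N).nbrFrac x i l - weightedOcc v p ((G N).occFun x) k l| < η := fun i hi l hil => by
    simp only [hbad_def, Finset.mem_filter, not_and, not_le] at hil
    have h1 := hil hi
    have h2 := hratio (CompatSystem.levelSet x l)
    simp only [CompatSystem.servFrac_levelSet] at h2
    rw [CompatSystem.nbrFrac_eq]
    exact (abs_sub_le _ _ _).trans_lt (by rw [← add_halves η]; exact add_lt_add_of_lt_of_le h1 h2)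
  have hpt : ∀ i ∈ (G N).dispOf k,
      |geomQuot d ((G N).nbrFrac x i l) ((G N).nbrFrac x i (l + 1)) -
        geomQuot d (weightedOcc v p ((G N).occFun x) k l)
          (weightedOcc v p ((G N).occFun x) k (l + 1))| ≤
      ε / 2 + ((if i ∈ bad l then 2 * C else 0) + if i ∈ bad (l + 1) then 2 * C else 0) := by
    intro i hi
    let z : UnitPair := (⟨_, (G N).nbrFrac_mem x i l⟩, ⟨_, (G N).nbrFrac_mem x i (l + 1)⟩)
    let z' : UnitPair :=
      (⟨_, h.weightedOcc_occFun_mem x k l⟩, ⟨_, h.weightedOcc_occFun_mem x k (l + 1)⟩)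
    have hz : |geomQuot d z.1 z.2 - geomQuot d z'.1 z'.2| ≤ 2 * C :=
      (abs_sub _ _).trans (by linarith [hle z, hle z'])
    by_cases h1 : i ∈ bad l
    · rw [if_pos h1]
      refine hz.trans ?_
      split_ifs <;> linarith
    by_cases h2 : i ∈ bad (l + 1)
    · rw [if_neg h1, if_pos h2]
      exact hz.trans (by linarith)
    · rw [if_neg h1, if_neg h2]
      exact (hunif z z' (hgood i hi l h1) (hgood i hi _ h2)).trans (by linarith)
  have hsum : ∀ l, ∑ i ∈ (G N).dispOf k, (if i ∈ bad l then 2 * C else 0) ≤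
      ε / 4 * ((G N).dispOf k).card := fun l => by
    rw [← Finset.sum_filter, Finset.sum_const, nsmul_eq_mul]
    have h1 : ((((G N).dispOf k).filter fun i => i ∈ bad l).card : ℝ) ≤ (bad l).card := by
      exact_mod_cast Finset.card_le_card fun i hi => (Finset.mem_filter.1 hi).2
    calc _ ≤ ε / (4 * (2 * C + 1)) * ((G N).dispOf k).card * (2 * C) :=
          mul_le_mul_of_nonneg_right (h1.trans (hbad k _)) (by positivity)
      _ = ε / 4 * ((G N).dispOf k).card * (2 * C / (2 * C + 1)) := by field_simp
      _ ≤ _ := mul_le_of_le_one_right (by positivity)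
          (div_le_one_of_le₀ (by linarith) (by positivity))
  calc _ ≤ _ := Finset.sum_le_sum hpt
    _ ≤ _ := by
      rw [Finset.sum_add_distrib, Finset.sum_add_distrib, Finset.sum_const, nsmul_eq_mul]
      linarith [hsum l, hsum (l + 1)]

/-- Three replacements: the scaled assignment probabilities by difference quotients, these by the
quotient at the weighted occupancies, and the number of edges into a level by its size. -/
theorem unifClose_arrivalRate (h : LimitRegime G xi w v p) {d : ℕ} (hd : 1 ≤ d) (k : Fin K)
    (m : Fin M) :
    UnifClose (fun N (z : (Fin N → ℕ) × ℕ) => (G N).arrivalRate d z.1 k m z.2)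
      fun N z => xi * (((G N).occFun z.1 (m, z.2) - (G N).occFun z.1 (m, z.2 + 1)) *
        (p k m * w k / limDeg v p k * geomQuot d (weightedOcc v p ((G N).occFun z.1) k z.2)
          (weightedOcc v p ((G N).occFun z.1) k (z.2 + 1)))) := by
  obtain ⟨C, hC, hle⟩ := exists_geomQuot_le d
  have hδ := h.limDeg_pos k
  set δ := limDeg v p k with hδ_def
  set Q : ∀ N, (Fin N → ℕ) → ℕ → ℝ := fun N x l =>
    geomQuot d (weightedOcc v p ((G N).occFun x) k l) (weightedOcc v p ((G N).occFun x) k (l + 1))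
    with hQ
  -- the number of dispatchers per server is bounded
  set B := w k * xi + 1 with hB
  have hB0 : 0 < B := by have := mul_pos (h.w_pos k) h.xi_pos; positivity
  intro ε hε
  have h1 : 0 < ε / (3 * B) := by positivity
  have h2 : 0 < ε * δ / (3 * B) := by positivity
  have h3 : 0 < ε * δ / (3 * (C + 1)) := by positivity
  filter_upwards [h.unifClose_assignProb hd k _ h1, h.eventually_sum_geomQuot_sub_le d k h2,
    eventually_sum_degV h.prop h.compat k m h3,
    (h.prop.tendsto_dispOf k).eventually (gt_mem_nhds (lt_add_one _)), eventually_gt_atTop 0,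
    (h.prop.2.2 m).eventually (lt_mem_nhds (h.v_pos m))] with N hassign hgq hdeg hdisp hN0 hV
  rintro ⟨x, l⟩
  have hN : (0 : ℝ) < N := by exact_mod_cast hN0
  have hVm : (0 : ℝ) < ((G N).servOf m).card := by
    by_contra h0
    have : (((G N).servOf m).card : ℝ) = 0 := le_antisymm (not_lt.1 h0) (by positivity)
    simp [this] at hV
  set A := (G N).levelOf x m l with hA
  set V : ℝ := (((G N).servOf m).card : ℝ) with hV_def
  have hAV : (A.card : ℝ) ≤ V := Nat.cast_le.2 (Finset.card_le_card (Finset.filter_subset _ _))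
  have hW : (((G N).dispOf k).card : ℝ) ≤ B * N := by rw [← div_le_iff₀ hN]; exact hdisp.le
  have hx : ∀ j ∈ A, x j = l := fun j hj => (Finset.mem_filter.1 hj).2
  set g : Fin (G N).numDisp → ℝ := fun i =>
    geomQuot d ((G N).nbrFrac x i l) ((G N).nbrFrac x i (l + 1)) with hg
  have e1 : |N * ∑ i ∈ (G N).dispOf k, ∑ j ∈ A, (G N).assignProb d x i j -
      δ⁻¹ * ∑ i ∈ (G N).dispOf k, ∑ j ∈ A, (if j ∈ (G N).nbr i then g i else 0)| ≤
      ε / 3 * (N * V) := by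
    simp only [Finset.mul_sum]
    rw [← Finset.sum_sub_distrib]
    refine (Finset.abs_sum_le_sum_abs _ _).trans ?_
    calc _ ≤ ∑ i ∈ (G N).dispOf k, ε / (3 * B) * V := Finset.sum_le_sum fun i hi => ?_
      _ = ε / (3 * B) * V * ((G N).dispOf k).card := by
        rw [Finset.sum_const, nsmul_eq_mul, mul_comm]
      _ ≤ ε / (3 * B) * V * (B * N) := mul_le_mul_of_nonneg_left hW (by positivity)
      _ = _ := by field_simp
    rw [← Finset.sum_sub_distrib]
    refine (Finset.abs_sum_le_sum_abs _ _).trans ?_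
    calc _ ≤ ∑ j ∈ A, ε / (3 * B) := Finset.sum_le_sum fun j hj => by
          have := hassign (⟨i, hi⟩, x, j)
          simp only [hx j hj] at this
          exact this
      _ = ε / (3 * B) * A.card := by rw [Finset.sum_const, nsmul_eq_mul, mul_comm]
      _ ≤ _ := mul_le_mul_of_nonneg_left hAV h1.le
  have e2 : |δ⁻¹ * ∑ i ∈ (G N).dispOf k, ∑ j ∈ A, (if j ∈ (G N).nbr i then g i else 0) -
      δ⁻¹ * ((∑ j ∈ A, ((G N).degV k j : ℝ)) * Q N x l)| ≤ ε / 3 * (N * V) := by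
    have hswap : (∑ j ∈ A, ((G N).degV k j : ℝ)) * Q N x l =
        ∑ i ∈ (G N).dispOf k, ∑ j ∈ A, (if j ∈ (G N).nbr i then Q N x l else 0) := by
      rw [Finset.sum_comm, Finset.sum_mul]
      refine Finset.sum_congr rfl fun j _ => ?_
      rw [← Finset.sum_filter, Finset.sum_const, nsmul_eq_mul]
      congr 2
      refine congrArg Finset.card ?_
      ext i
      simp [CompatSystem.nbr]
    rw [hswap, ← mul_sub, abs_mul, abs_of_pos (inv_pos.2 hδ), ← Finset.sum_sub_distrib]
    calc _ ≤ δ⁻¹ * ∑ i ∈ (G N).dispOf k, |g i - Q N x l| * V := by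
          refine mul_le_mul_of_nonneg_left ((Finset.abs_sum_le_sum_abs _ _).trans
            (Finset.sum_le_sum fun i _ => ?_)) (inv_pos.2 hδ).le
          rw [← Finset.sum_sub_distrib]
          refine (Finset.abs_sum_le_sum_abs _ _).trans ?_
          calc _ ≤ ∑ j ∈ A, |g i - Q N x l| := Finset.sum_le_sum fun j _ => by
                split_ifs
                · exact le_rfl
                · rw [sub_zero, abs_zero]; positivity
            _ = |g i - Q N x l| * A.card := by rw [Finset.sum_const, nsmul_eq_mul, mul_comm]
            _ ≤ _ := mul_le_mul_of_nonneg_left hAV (abs_nonneg _)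
      _ ≤ δ⁻¹ * (ε * δ / (3 * B) * (B * N) * V) := by
          rw [← Finset.sum_mul]
          refine mul_le_mul_of_nonneg_left (mul_le_mul_of_nonneg_right ?_ hVm.le)
            (inv_pos.2 hδ).le
          exact (hgq x l).trans (mul_le_mul_of_nonneg_left hW h2.le)
      _ = _ := by field_simp
  have hQC : |Q N x l| ≤ C :=
    hle (⟨_, h.weightedOcc_occFun_mem x k l⟩, ⟨_, h.weightedOcc_occFun_mem x k (l + 1)⟩)
  have e3 : |δ⁻¹ * ((∑ j ∈ A, ((G N).degV k j : ℝ)) * Q N x l) -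
      δ⁻¹ * (N * (p k m * (w k * xi) * A.card) * Q N x l)| ≤ ε / 3 * (N * V) := by
    have h4 := hdeg A (Finset.filter_subset _ _)
    have h5 : (∑ j ∈ A, ((G N).degV k j : ℝ)) - N * (p k m * (w k * xi) * A.card) =
        N * ((∑ j ∈ A, ((G N).degV k j : ℝ)) / N - p k m * (w k * xi) * A.card) := by
      field_simp
    rw [← mul_sub, ← sub_mul, h5, abs_mul, abs_mul, abs_mul, abs_of_pos (inv_pos.2 hδ),
      abs_of_pos hN]
    calc _ ≤ δ⁻¹ * (N * (ε * δ / (3 * (C + 1)) * V) * (C + 1)) := by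
          refine mul_le_mul_of_nonneg_left (mul_le_mul ?_ (by linarith) (abs_nonneg _)
            (by positivity)) (inv_pos.2 hδ).le
          exact mul_le_mul_of_nonneg_left (h4.trans (mul_le_mul_of_nonneg_left hAV h3.le)) hN.le
      _ = _ := by field_simp
  have hNV : 0 < N * V := mul_pos hN hVm
  have key : |N * ∑ i ∈ (G N).dispOf k, ∑ j ∈ A, (G N).assignProb d x i j -
      δ⁻¹ * (N * (p k m * (w k * xi) * A.card) * Q N x l)| ≤ ε * (N * V) := by
    calc _ ≤ ε / 3 * (N * V) + (ε / 3 * (N * V) + ε / 3 * (N * V)) :=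
          (abs_sub_le _ _ _).trans (add_le_add e1 ((abs_sub_le _ _ _).trans (add_le_add e2 e3)))
      _ = _ := by ring
  rw [← (G N).card_levelOf, CompatSystem.arrivalRate]
  refine le_of_mul_le_mul_right (le_trans (le_of_eq ?_) key) hNV
  rw [← abs_of_pos hNV, ← abs_mul]
  congr 1
  simp only [← hA, ← hV_def, hQ]
  field_simp

/-- The drift of the occupancy process is asymptotically the right-hand side of the system of ODEs,
uniformly in the state and in the queue length. -/
theorem unifClose_generator (h : LimitRegime G xi w v p) {d : ℕ} (hd : 1 ≤ d) (lam : ℝ)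
    (u : Fin M → ℝ) (m : Fin M) :
    UnifClose (fun N (z : (Fin N → ℕ) × ℕ) =>
        (G N).generator d lam u (fun x => (G N).occFun x (m, z.2 + 1)) z.1)
      fun N z => polyRHS d lam xi u v w p ((G N).occFun z.1) m z.2 := by
  have h1 := UnifClose.sum Finset.univ fun k _ => h.unifClose_arrivalRate hd k m
  intro ε hε
  have h2 : 0 < ε / (|lam| + 1) := by positivity
  filter_upwards [h1 _ h2] with N hN z
  rw [CompatSystem.generator_occFun, polyRHS, add_sub_add_left_eq_sub]
  have h3 : lam * xi * ((G N).occFun z.1 (m, z.2) - (G N).occFun z.1 (m, z.2 + 1)) *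
      ∑ k, p k m * w k / limDeg v p k * geomQuot d (weightedOcc v p ((G N).occFun z.1) k z.2)
          (weightedOcc v p ((G N).occFun z.1) k (z.2 + 1)) =
      lam * ∑ k, xi * (((G N).occFun z.1 (m, z.2) - (G N).occFun z.1 (m, z.2 + 1)) *
        (p k m * w k / limDeg v p k * geomQuot d (weightedOcc v p ((G N).occFun z.1) k z.2)
          (weightedOcc v p ((G N).occFun z.1) k (z.2 + 1)))) := by
    simp only [Finset.mul_sum]
    exact Finset.sum_congr rfl fun k _ => by ring
  rw [h3, ← mul_sub, abs_mul]
  calc _ ≤ |lam| * (ε / (|lam| + 1)) := mul_le_mul_of_nonneg_left (hN z) (abs_nonneg _)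
    _ = ε * (|lam| / (|lam| + 1)) := by ring
    _ ≤ ε := mul_le_of_le_one_right hε.le (div_le_one_of_le₀ (by linarith) (by positivity))

end LimitRegime

/-! ### Events of vanishing probability -/

/-- The (outer) probability of the event `A N` vanishes as `N → ∞`. -/
def AsympNull {Ω : ℕ → Type*} [∀ N, MeasurableSpace (Ω N)] (P : ∀ N, Measure (Ω N))
    (A : ∀ N, Set (Ω N)) : Prop :=
  Tendsto (fun N => P N (A N)) atTop (𝓝 0)

namespace AsympNull

variable {Ω : ℕ → Type*} [∀ N, MeasurableSpace (Ω N)] {P : ∀ N, Measure (Ω N)}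
  {A B : ∀ N, Set (Ω N)}

theorem of_le {r : ℕ → ℝ≥0∞} (hr : Tendsto r atTop (𝓝 0)) (h : ∀ᶠ N in atTop, P N (A N) ≤ r N) :
    AsympNull P A :=
  tendsto_of_tendsto_of_tendsto_of_le_of_le' tendsto_const_nhds hr
    (Eventually.of_forall fun _ => zero_le) h

theorem mono (hB : AsympNull P B) (h : ∀ᶠ N in atTop, A N ⊆ B N) : AsympNull P A :=
  of_le hB (h.mono fun _ hN => measure_mono hN)

theorem union (hA : AsympNull P A) (hB : AsympNull P B) : AsympNull P fun N => A N ∪ B N := by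
  have h := hA.add hB
  rw [add_zero] at h
  exact of_le h (Eventually.of_forall fun N => measure_union_le _ _)

theorem biUnion {κ : Type*} (s : Finset κ) {A : κ → ∀ N, Set (Ω N)}
    (h : ∀ k ∈ s, AsympNull P (A k)) : AsympNull P fun N => ⋃ k ∈ s, A k N := by
  have h := tendsto_finsetSum s h
  rw [Finset.sum_const_zero] at h
  exact of_le h (Eventually.of_forall fun N => measure_biUnion_finset_le _ _)

theorem exists_notMem [∀ N, IsProbabilityMeasure (P N)] (hA : AsympNull P A) :
    ∀ᶠ N in atTop, ∃ ω, ω ∉ A N := by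
  filter_upwards [hA.eventually (gt_mem_nhds one_pos)] with N hN
  by_contra! h
  rw [Set.eq_univ_of_forall h, measure_univ] at hN
  exact lt_irrefl _ hN

end AsympNull

/-! ### The total mass beyond a level -/

namespace CompatSystem

variable {K M N : ℕ} (G : CompatSystem K M N)

/-- The number of tasks in the positions `L + 1, …, L + R` of the queues, per server. -/
def tailMass (L R : ℕ) (x : Fin N → ℕ) : ℝ := (∑ j, (min (x j - L) R : ℕ) : ℝ) / N

theorem tailMass_nonneg (L R : ℕ) (x : Fin N → ℕ) : 0 ≤ tailMass L R x := by
  unfold tailMass; positivity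

theorem tailMass_le (L R : ℕ) (x : Fin N → ℕ) : |tailMass L R x| ≤ R := by
  rw [abs_of_nonneg (tailMass_nonneg L R x)]
  refine div_le_of_le_mul₀ (by positivity) (by positivity) ?_
  calc (∑ j, (min (x j - L) R : ℕ) : ℝ) ≤ ∑ _j : Fin N, (R : ℝ) :=
        Finset.sum_le_sum fun j _ => by exact_mod_cast min_le_right _ _
    _ = _ := by simp [mul_comm]

theorem tailMass_mono (L : ℕ) (x : Fin N → ℕ) : Monotone fun R => tailMass L R x := fun R R' h => by
  refine div_le_div_of_nonneg_right (Finset.sum_le_sum fun j _ => ?_) (by positivity)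
  exact_mod_cast min_le_min_left _ h

theorem tailMass_update (L R : ℕ) (x : Fin N → ℕ) (j : Fin N) (n : ℕ) :
    tailMass L R (Function.update x j n) - tailMass L R x =
      ((min (n - L) R : ℕ) - (min (x j - L) R : ℕ) : ℝ) / N := by
  unfold tailMass
  rw [← sub_div, ← Finset.sum_sub_distrib, Finset.sum_eq_single j]
  · rw [Function.update_self]
  · intro j' _ h
    rw [Function.update_of_ne h, sub_self]
  · simp

theorem tailMass_update_succ_le (L R : ℕ) (x : Fin N → ℕ) (j : Fin N) :
    tailMass L R (Function.update x j (x j + 1)) - tailMass L R x ≤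
      (if L ≤ x j then 1 else 0) / N := by
  rw [tailMass_update]
  refine div_le_div_of_nonneg_right ?_ (by positivity)
  rw [sub_le_iff_le_add]
  split_ifs
  · exact_mod_cast (show min (x j + 1 - L) R ≤ 1 + min (x j - L) R by omega)
  · rw [zero_add]
    exact_mod_cast (show min (x j + 1 - L) R ≤ min (x j - L) R by omega)

theorem abs_tailMass_update_succ_le (L R : ℕ) (x : Fin N → ℕ) (j : Fin N) :
    |tailMass L R (Function.update x j (x j + 1)) - tailMass L R x| ≤ 1 / N := by
  rw [tailMass_update, abs_div, abs_of_nonneg (Nat.cast_nonneg (α := ℝ) N)]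
  refine div_le_div_of_nonneg_right (abs_le.2 ⟨?_, ?_⟩) (by positivity)
  · rw [neg_le_sub_iff_le_add]
    exact_mod_cast (show min (x j - L) R ≤ min (x j + 1 - L) R + 1 by omega)
  · rw [sub_le_iff_le_add]
    exact_mod_cast (show min (x j + 1 - L) R ≤ 1 + min (x j - L) R by omega)

theorem abs_tailMass_update_pred_le (L R : ℕ) (x : Fin N → ℕ) (j : Fin N) :
    |tailMass L R (Function.update x j (x j - 1)) - tailMass L R x| ≤ 1 / N := by
  rw [tailMass_update, abs_div, abs_of_nonneg (Nat.cast_nonneg (α := ℝ) N)]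
  refine div_le_div_of_nonneg_right (abs_le.2 ⟨?_, ?_⟩) (by positivity)
  · rw [neg_le_sub_iff_le_add]
    exact_mod_cast (show min (x j - L) R ≤ min (x j - 1 - L) R + 1 by omega)
  · rw [sub_le_iff_le_add]
    exact_mod_cast (show min (x j - 1 - L) R ≤ 1 + min (x j - L) R by omega)

theorem tailMass_update_pred_le (L R : ℕ) (x : Fin N → ℕ) (j : Fin N) :
    tailMass L R (Function.update x j (x j - 1)) - tailMass L R x ≤ 0 := by
  rw [tailMass_update]
  refine div_nonpos_of_nonpos_of_nonneg ?_ (by positivity)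
  rw [sub_nonpos]
  exact_mod_cast (show min (x j - 1 - L) R ≤ min (x j - L) R by omega)

/-- A queue of length at least `L` holds `L` tasks. -/
theorem card_levelSet_mul_le (L : ℕ) (x : Fin N → ℕ) :
    ((levelSet x L).card : ℝ) / N * L ≤ tailMass 0 L x := by
  unfold tailMass
  rw [div_mul_eq_mul_div]
  refine div_le_div_of_nonneg_right ?_ (by positivity)
  calc ((levelSet x L).card : ℝ) * L = ∑ j ∈ levelSet x L, (L : ℝ) := by
        rw [Finset.sum_const, nsmul_eq_mul]
    _ ≤ ∑ j ∈ levelSet x L, ((min (x j - 0) L : ℕ) : ℝ) := Finset.sum_le_sum fun j hj => by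
        have := (Finset.mem_filter.1 hj).2
        exact_mod_cast (show L ≤ min (x j - 0) L by omega)
    _ ≤ _ := Finset.sum_le_sum_of_subset_of_nonneg (Finset.subset_univ _) fun _ _ _ => by
        positivity

theorem tailMass_eq (L R : ℕ) (x : Fin N → ℕ) :
    tailMass L R x = ∑ m, ((G.servOf m).card : ℝ) / N *
      ∑ l ∈ Finset.range R, G.occFun x (m, L + 1 + l) := by
  have h : ∀ n : ℕ, ((min (n - L) R : ℕ) : ℝ) =
      ∑ l ∈ Finset.range R, if L + 1 + l ≤ n then 1 else 0 := fun n => by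
    rw [← Finset.sum_filter, Finset.sum_const, nsmul_one]
    congr 1
    rw [show (Finset.range R).filter (fun l => L + 1 + l ≤ n) = Finset.range (min (n - L) R) by
      ext l; simp only [Finset.mem_filter, Finset.mem_range]; omega, Finset.card_range]
  unfold tailMass
  simp only [h]
  rw [G.sum_servOf, Finset.sum_div]
  refine Finset.sum_congr rfl fun m _ => ?_
  rw [Finset.univ_inter, Finset.sum_comm, Finset.sum_div, Finset.mul_sum]
  refine Finset.sum_congr rfl fun l _ => ?_
  rw [← Finset.sum_filter, Finset.sum_const, nsmul_one, occFun]
  rcases Nat.eq_zero_or_pos (G.servOf m).card with h0 | h0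
  · have : ((G.servOf m).filter fun j => L + 1 + l ≤ x j).card = 0 :=
      Nat.le_zero.1 ((Finset.card_le_card (Finset.filter_subset _ _)).trans h0.le)
    simp only [this, h0]; simp
  · have : ((G.servOf m).card : ℝ) ≠ 0 := by positivity
    simp only
    field_simp

theorem tailMass_le_tailSum (L R : ℕ) (x : Fin N → ℕ) :
    tailMass L R x ≤ tailSum (L + 1) R (G.occFun x) := by
  rw [G.tailMass_eq]
  refine Finset.sum_le_sum fun m _ => mul_le_of_le_one_left
    (Finset.sum_nonneg fun l _ => (G.occFun_mem_Icc x _).1) ?_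
  exact div_le_one_of_le₀ (by exact_mod_cast G.card_servOf_le m) (by positivity)

theorem mul_tailSum_le {θ : ℝ} (hθ : ∀ m, θ ≤ ((G.servOf m).card : ℝ) / N) (L R : ℕ)
    (x : Fin N → ℕ) : θ * tailSum (L + 1) R (G.occFun x) ≤ tailMass L R x := by
  rw [G.tailMass_eq, tailSum, Finset.mul_sum]
  exact Finset.sum_le_sum fun m _ => mul_le_mul_of_nonneg_right (hθ m)
    (Finset.sum_nonneg fun l _ => (G.occFun_mem_Icc x _).1)

/-- The drift of the mass beyond the level `L` is bounded by the arrival rate at the queues of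
length at least `L`. -/
theorem generator_tailMass_le (d : ℕ) {lam : ℝ} (hlam : 0 ≤ lam) {u : Fin M → ℝ}
    (hu : ∀ m, 0 ≤ u m) (L R : ℕ) (x : Fin N → ℕ) :
    G.generator d lam u (tailMass L R) x ≤
      lam * (∑ i, ∑ j ∈ levelSet x L, G.assignProb d x i j) / N := by
  unfold generator
  refine (add_le_of_nonpos_right (Finset.sum_nonpos fun j _ => ?_)).trans ?_
  · split_ifs
    · exact mul_nonpos_of_nonneg_of_nonpos (hu _) (tailMass_update_pred_le L R x j)
    · exact le_rfl
  · rw [mul_div_assoc, Finset.sum_div, Finset.mul_sum]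
    refine Finset.sum_le_sum fun i _ => ?_
    calc _ ≤ ∑ j, lam * G.assignProb d x i j * ((if L ≤ x j then 1 else 0) / N) :=
          Finset.sum_le_sum fun j _ => mul_le_mul_of_nonneg_left (tailMass_update_succ_le L R x j)
            (mul_nonneg hlam (G.assignProb_nonneg d x i j))
      _ = _ := by
          rw [levelSet, Finset.sum_filter, Finset.sum_div, Finset.mul_sum]
          refine Finset.sum_congr rfl fun j _ => ?_
          split_ifs <;> ring

theorem generator_tailMass_le_numDisp (d : ℕ) {lam : ℝ} (hlam : 0 ≤ lam) {u : Fin M → ℝ}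
    (hu : ∀ m, 0 ≤ u m) (L R : ℕ) (x : Fin N → ℕ) :
    G.generator d lam u (tailMass L R) x ≤ lam * (G.numDisp / N) := by
  refine (G.generator_tailMass_le d hlam hu L R x).trans ?_
  rw [mul_div_assoc]
  refine mul_le_mul_of_nonneg_left (div_le_div_of_nonneg_right ?_ (by positivity)) hlam
  calc _ ≤ ∑ _i : Fin G.numDisp, (1 : ℝ) := Finset.sum_le_sum fun i _ =>
        (Finset.sum_le_sum_of_subset_of_nonneg (Finset.subset_univ _) fun j _ _ =>
          G.assignProb_nonneg d x i j).trans (G.sum_assignProb_le_one d x i)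
    _ = _ := by simp

theorem generator_tailMass_le_level {d : ℕ} {lam : ℝ} (hlam : 0 ≤ lam) {u : Fin M → ℝ}
    (hu : ∀ m, 0 ≤ u m) {C : ℝ} (hC : ∀ x i j, N * G.assignProb d x i j ≤ C) (L R : ℕ)
    (x : Fin N → ℕ) :
    G.generator d lam u (tailMass L R) x ≤
      lam * (G.numDisp / N) * C * ((levelSet x L).card / N) := by
  rcases Nat.eq_zero_or_pos N with rfl | hN
  · refine (G.generator_tailMass_le d hlam hu L R x).trans ?_
    simp
  have hN' : (0 : ℝ) < N := by exact_mod_cast hN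
  refine (G.generator_tailMass_le d hlam hu L R x).trans ?_
  calc _ ≤ lam * (∑ _i : Fin G.numDisp, ∑ _j ∈ levelSet x L, C / N) / N := by
        refine div_le_div_of_nonneg_right (mul_le_mul_of_nonneg_left (Finset.sum_le_sum fun i _ =>
          Finset.sum_le_sum fun j _ => ?_) hlam) hN'.le
        rw [le_div_iff₀ hN', mul_comm]
        exact hC x i j
    _ = _ := by simp; ring

end CompatSystem

/-! ### Estimates along the queue length processes -/

/-- The maximal inequality, with a bound that depends on the test function only through the order
`c / N` of its jumps. -/
theorem exists_maximal_rate {K M : ℕ} {G : ∀ N, CompatSystem K M N} {xi : ℝ} {w : Fin K → ℝ}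
    {v : Fin M → ℝ} (hprop : HasProportions G xi w v) {d : ℕ} {lam : ℝ} (hlam : 0 ≤ lam)
    {u : Fin M → ℝ} (hu : ∀ m, 0 ≤ u m) {Ω : ℕ → Type*} [∀ N, MeasurableSpace (Ω N)]
    {P : ∀ N, Measure (Ω N)} [∀ N, IsProbabilityMeasure (P N)] {X : ∀ N, ℝ≥0 → Ω N → Fin N → ℕ}
    (hX : ∀ N, (G N).IsQueueChain d lam u (P N) (X N)) (T : ℝ≥0) (c : ℝ) {ε : ℝ} (hε : 0 < ε) :
    ∃ r : ℕ → ℝ≥0∞, Tendsto r atTop (𝓝 0) ∧ ∀ (N : ℕ) (f : (Fin N → ℕ) → ℝ) (B : ℝ),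
      (∀ x, |f x| ≤ B) → (∀ x j, |f (Function.update x j (x j + 1)) - f x| ≤ c / N) →
      (∀ x j, |f (Function.update x j (x j - 1)) - f x| ≤ c / N) →
      P N {ω | ∃ t ≤ T, ε < |f (X N t ω) - f (X N 0 ω) -
        ∫ s in (0 : ℝ)..t, (G N).generator d lam u f (X N s.toNNReal ω)|} ≤ r N := by
  refine ⟨fun N => ENNReal.ofReal ((G N).rateBound lam u * (c / N) ^ 2 * T / ε ^ 2), ?_,
    fun N f B hf hup hdown => (hX N).measure_exists_le hlam hu hf hup hdown T hε⟩
  have h1 : Tendsto (fun N : ℕ => (G N).rateBound lam u / N) atTop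
      (𝓝 (lam * xi + ∑ m, u m * v m)) := by
    refine ((hprop.1.const_mul lam).add (tendsto_finsetSum Finset.univ fun m _ =>
      (hprop.2.2 m).const_mul (u m))).congr fun N => ?_
    rw [CompatSystem.rateBound, add_div, mul_div_assoc, (G N).sum_servOf, Finset.sum_div]
    congr 1
    refine Finset.sum_congr rfl fun m _ => ?_
    rw [Finset.univ_inter, Finset.sum_congr rfl fun j hj => by
      rw [(Finset.mem_filter.1 hj).2], Finset.sum_const, nsmul_eq_mul]
    ring
  have h2 : Tendsto (fun N : ℕ => (G N).rateBound lam u / N * (c ^ 2 * T / ε ^ 2 * (1 / (N : ℝ))))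
      atTop (𝓝 0) := by
    simpa using h1.mul (tendsto_one_div_atTop_nhds_zero_nat.const_mul (c ^ 2 * T / ε ^ 2))
  rw [← ENNReal.ofReal_zero]
  refine ENNReal.tendsto_ofReal (h2.congr fun N => ?_)
  rcases Nat.eq_zero_or_pos N with rfl | hN
  · simp
  · have : (N : ℝ) ≠ 0 := by positivity
    field_simp

/-! ### Control of the occupancy process -/

/-- The maximal inequality turns a bound on the drift into a bound on the path. -/
theorem CompatSystem.IsQueueChain.le_add_of_generator_le {K M N : ℕ} {G : CompatSystem K M N}
    {d : ℕ} {lam : ℝ} {u : Fin M → ℝ} {Ω : Type*} [MeasurableSpace Ω] {P : Measure Ω}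
    {X : ℝ≥0 → Ω → Fin N → ℕ} (hX : G.IsQueueChain d lam u P X) (hlam : 0 ≤ lam)
    (hu : ∀ m, 0 ≤ u m) {f : (Fin N → ℕ) → ℝ} {B : ℝ} (hf : ∀ x, |f x| ≤ B) {c : ℝ} {ω : Ω}
    {t : ℝ≥0} (hc : ∀ s ≤ t, G.generator d lam u f (X s ω) ≤ c) :
    f (X t ω) ≤ f (X 0 ω) + c * t + |f (X t ω) - f (X 0 ω) -
      ∫ s in (0 : ℝ)..t, G.generator d lam u f (X s.toNNReal ω)| := by
  have hg := hX.isBddRightCts (G.abs_generator_le d hlam hu hf)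
  have h1 : ∫ s in (0 : ℝ)..t, G.generator d lam u f (X s.toNNReal ω) ≤ ∫ _s in (0 : ℝ)..t, c :=
    intervalIntegral.integral_mono_on t.2 (hg.intervalIntegrable ω _ _) intervalIntegrable_const
      fun s hs => hc _ (Real.toNNReal_le_iff_le_coe.2 hs.2)
  rw [intervalIntegral.integral_const, smul_eq_mul, sub_zero] at h1
  linarith [le_abs_self (f (X t ω) - f (X 0 ω) -
      ∫ s in (0 : ℝ)..t, G.generator d lam u f (X s.toNNReal ω))]

namespace CompatSystem

variable {K M N : ℕ} (G : CompatSystem K M N)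

theorem abs_occFun_update_succ_le (x : Fin N → ℕ) (m : Fin M) (l : ℕ) (j : Fin N) :
    |G.occFun (Function.update x j (x j + 1)) (m, l + 1) - G.occFun x (m, l + 1)| ≤
      1 / (G.servOf m).card := by
  rw [occFun_update_succ]
  split_ifs
  · rw [abs_of_nonneg (by positivity)]
  · rw [abs_zero]; positivity

theorem abs_occFun_update_pred_le (x : Fin N → ℕ) (m : Fin M) (l : ℕ) (j : Fin N) :
    |G.occFun (Function.update x j (x j - 1)) (m, l + 1) - G.occFun x (m, l + 1)| ≤
      1 / (G.servOf m).card := by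
  rcases Nat.eq_zero_or_pos (x j) with h0 | h0
  · rw [show x j - 1 = x j by omega, Function.update_eq_self, sub_self, abs_zero]; positivity
  · rw [occFun_update_pred _ _ _ _ h0, abs_neg]
    split_ifs
    · rw [abs_of_nonneg (by positivity)]
    · rw [abs_zero]; positivity

end CompatSystem

theorem le_tailSum {M : ℕ} {f : Fin M × ℕ → ℝ} (hf : ∀ a, 0 ≤ f a) {L l : ℕ} (h : L ≤ l)
    (m : Fin M) : f (m, l) ≤ tailSum L (l - L + 1) f := by
  have h1 : f (m, l) ≤ ∑ i ∈ Finset.range (l - L + 1), f (m, L + i) := by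
    have := Finset.single_le_sum (f := fun i => f (m, L + i)) (fun i _ => hf _)
      (Finset.mem_range.2 (Nat.lt_succ_self (l - L)))
    rwa [show L + (l - L) = l by omega] at this
  exact h1.trans (Finset.single_le_sum (f := fun m => ∑ i ∈ Finset.range (l - L + 1), f (m, L + i))
    (fun m _ => Finset.sum_nonneg fun i _ => hf _) (Finset.mem_univ m))

/-- The drift of a coordinate is small where few queues are involved. -/
theorem exists_abs_polyRHS_le_mul {K M : ℕ} (d : ℕ) (lam xi : ℝ) (u v : Fin M → ℝ) (w : Fin K → ℝ)
    (p : Fin K → Fin M → ℝ) :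
    ∃ D, 0 < D ∧ ∀ q ∈ occSetBar M, ∀ m l, |polyRHS d lam xi u v w p q m l| ≤ D * q (m, l) := by
  obtain ⟨D, hD, h⟩ := exists_lipschitz_polyRHS d lam xi u v w p
  refine ⟨D, hD, fun q hq m l => ?_⟩
  -- compare with the same family, set to zero at the levels above `l`
  let q' : Fin M × ℕ → ℝ := fun a => if a.1 = m ∧ l ≤ a.2 then 0 else q a
  have h0 : polyRHS d lam xi u v w p q' m l = 0 := by simp [polyRHS, q']
  have hanti : ∀ l', l ≤ l' → q (m, l') ≤ q (m, l) := fun l' hl' =>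
    antitone_nat_of_succ_le (f := fun l => q (m, l)) (hq.2.2 m) hl'
  have h1 := (h m l q hq.1).2 q' (q (m, l)) (fun a => ?_) (hq.1 _).1 fun a => ?_
  · rwa [h0, sub_zero] at h1
  · simp only [q']
    split_ifs
    · exact ⟨le_rfl, zero_le_one⟩
    · exact hq.1 a
  · obtain ⟨m', l'⟩ := a
    simp only [q']
    split_ifs with h2
    · obtain ⟨rfl, h2⟩ := h2
      rw [sub_zero, abs_of_nonneg (hq.1 _).1]
      exact hanti l' h2
    · rw [sub_self, abs_zero]
      exact (hq.1 _).1

section Control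

variable {K M : ℕ} {G : ∀ N, CompatSystem K M N} {xi : ℝ} {w : Fin K → ℝ} {v : Fin M → ℝ}
  {p : Fin K → Fin M → ℝ} {d : ℕ} {lam : ℝ} {u : Fin M → ℝ} {Ω : ℕ → Type*}
  [∀ N, MeasurableSpace (Ω N)] {P : ∀ N, Measure (Ω N)} [∀ N, IsProbabilityMeasure (P N)]
  {X : ∀ N, ℝ≥0 → Ω N → Fin N → ℕ} {q0 : OccSpace M}

theorem LimitRegime.exists_le_card_servOf (h : LimitRegime G xi w v p) :
    ∃ θ, 0 < θ ∧ ∀ᶠ N in atTop, ∀ m, θ ≤ (((G N).servOf m).card : ℝ) / N := by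
  obtain ⟨θ, hθ, hle⟩ : ∃ θ, 0 < θ ∧ ∀ m, θ < v m := by
    rcases isEmpty_or_nonempty (Fin M) with he | he
    · exact ⟨1, one_pos, fun m => he.elim m⟩
    · obtain ⟨m₀, hm₀⟩ := Finite.exists_min v
      exact ⟨v m₀ / 2, half_pos (h.v_pos _), fun m =>
        (half_lt_self (h.v_pos _)).trans_le (hm₀ m)⟩
  exact ⟨θ, hθ, eventually_all.2 fun m =>
    ((h.prop.2.2 m).eventually (lt_mem_nhds (hle m))).mono fun _ => le_of_lt⟩

theorem LimitRegime.eventually_occFun_mem (h : LimitRegime G xi w v p) :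
    ∀ᶠ N in atTop, ∀ x, (G N).occFun x ∈ occSetBar M := by
  obtain ⟨θ, hθ, hle⟩ := h.exists_le_card_servOf
  filter_upwards [hle] with N hN x
  refine (G N).occFun_mem_occSetBar (fun m => Nat.pos_of_ne_zero fun h0 => ?_) x
  have := hN m
  rw [h0, Nat.cast_zero, zero_div] at this
  linarith

/-- Uniformly on compact time intervals, the occupancy process has small tails: the mass beyond a
high level grows at most at the rate of arrivals at long queues, which are few. -/
theorem asympNull_tailSum (h : LimitRegime G xi w v p) (hd : 1 ≤ d) (hlam : 0 ≤ lam)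
    (hu : ∀ m, 0 ≤ u m) (hX : ∀ N, (G N).IsQueueChain d lam u (P N) (X N)) (hq0 : q0 ∈ occSet M)
    (hinit : ∀ κ, 0 < κ → AsympNull P fun N => {ω | κ < ‖(G N).occ (X N 0 ω) - q0‖})
    (T : ℝ≥0) {ε : ℝ} (hε : 0 < ε) :
    ∃ L, AsympNull P fun N =>
      {ω | ∃ t ≤ T, ∃ R, ε < tailSum L R ((G N).occFun (X N t ω))} := by
  obtain ⟨θ, hθ, hserv⟩ := h.exists_le_card_servOf
  obtain ⟨C, hC, hassign⟩ := h.eventually_assignProb_le hd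
  have hε' : 0 < θ * ε / 4 := by positivity
  obtain ⟨L₀, hL₀⟩ := OccSpace.exists_tailSum_le q0 hε'
  set A := lam * (xi + 1) with hA
  have hA0 : 0 ≤ A := mul_nonneg hlam (by linarith [h.xi_pos])
  -- a bound on the total mass up to time `T`
  set B := ‖q0‖ + 1 + A * T + 1 with hB
  have hB0 : 0 ≤ B := by positivity
  -- beyond `L` the limiting initial state has little mass, and the queues of length at least `L`,
  -- a fraction of at most `B / L` of all queues, receive few tasks up to time `T`
  set L := max (max L₀ 1) ⌈A * C * B * T / (θ * ε / 4)⌉₊ with hL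
  have hL1 : (0 : ℝ) < L := by
    exact_mod_cast Nat.lt_of_lt_of_le Nat.one_pos ((le_max_right L₀ 1).trans (le_max_left _ _))
  have hL2 : A * C * (B / L) * T ≤ θ * ε / 4 := by
    have h1 : A * C * B * T / (θ * ε / 4) ≤ L :=
      (Nat.le_ceil _).trans (by exact_mod_cast le_max_right _ _)
    rw [div_le_iff₀ hε'] at h1
    rw [show A * C * (B / L) * T = A * C * B * T / L by ring, div_le_iff₀ hL1, mul_comm]
    linarith
  set κ := min 1 (θ * ε / 4) with hκ
  have hκ0 : 0 < κ := lt_min one_pos hε'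
  obtain ⟨r₁, hr₁, hmax₁⟩ := exists_maximal_rate h.prop hlam hu hX T 1 one_pos
  obtain ⟨r₂, hr₂, hmax₂⟩ := exists_maximal_rate h.prop hlam hu hX T 1 hε'
  -- the exceptional event for the initial state and for the total mass
  let Bad : ∀ N, Set (Ω N) := fun N => {ω | κ < ‖(G N).occ (X N 0 ω) - q0‖} ∪
    {ω | ∃ t ≤ T, 1 < |CompatSystem.tailMass 0 L (X N t ω) -
      CompatSystem.tailMass 0 L (X N 0 ω) - ∫ s in (0 : ℝ)..t,
        (G N).generator d lam u (CompatSystem.tailMass 0 L) (X N s.toNNReal ω)|}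
  have hnull₁ : AsympNull P fun N => {ω | ∃ t ≤ T, 1 < |CompatSystem.tailMass 0 L (X N t ω) -
      CompatSystem.tailMass 0 L (X N 0 ω) - ∫ s in (0 : ℝ)..t,
        (G N).generator d lam u (CompatSystem.tailMass 0 L) (X N s.toNNReal ω)|} :=
    AsympNull.of_le hr₁ (Eventually.of_forall fun N => hmax₁ N _ L
      (CompatSystem.tailMass_le 0 L) (CompatSystem.abs_tailMass_update_succ_le 0 L)
      (CompatSystem.abs_tailMass_update_pred_le 0 L))
  have hnull : AsympNull P Bad := (hinit κ hκ0).union hnull₁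
  refine ⟨L + 1, (hnull.union (B := fun N => ⋃ R : ℕ,
    {ω | ∃ t ≤ T, θ * ε < CompatSystem.tailMass L R (X N t ω)} \
      Bad N) ?_).mono ?_⟩
  · refine AsympNull.of_le hr₂ ?_
    filter_upwards [hassign, h.prop.1.eventually (gt_mem_nhds (lt_add_one _))] with N hN hdisp
    -- the events increase with `R`, so that a bound uniform in `R` holds for their union
    rw [Monotone.measure_iUnion]
    · refine iSup_le fun R => (measure_mono ?_).trans (hmax₂ N (CompatSystem.tailMass L R) R
        (CompatSystem.tailMass_le L R) (CompatSystem.abs_tailMass_update_succ_le L R)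
        (CompatSystem.abs_tailMass_update_pred_le L R))
      rintro ω ⟨⟨t, ht, htail⟩, hgood⟩
      simp only [Bad, Set.mem_union, Set.mem_ofPred_eq, not_or, not_lt, not_exists, not_and]
        at hgood
      obtain ⟨hω0, hω1⟩ := hgood
      have hA' : lam * ((G N).numDisp / N) ≤ A := mul_le_mul_of_nonneg_left hdisp.le hlam
      have hnorm : ‖(G N).occ (X N 0 ω)‖ ≤ ‖q0‖ + 1 := by
        have h1 := norm_le_norm_add_norm_sub' ((G N).occ (X N 0 ω)) q0
        have h2 : κ ≤ 1 := min_le_left _ _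
        linarith
      have hmass0 : CompatSystem.tailMass 0 L (X N 0 ω) ≤ ‖q0‖ + 1 := by
        refine ((G N).tailMass_le_tailSum 0 L _).trans (le_trans ?_ hnorm)
        refine le_trans (le_of_eq ?_) (OccSpace.tailSum_abs_le ((G N).occ (X N 0 ω)) (0 + 1) L)
        refine Finset.sum_congr rfl fun m _ => Finset.sum_congr rfl fun l _ => ?_
        exact (abs_of_nonneg ((G N).occFun_mem_Icc _ _).1).symm
      have hlev : ∀ s ≤ T, ((CompatSystem.levelSet (X N s ω) L).card : ℝ) / N ≤ B / L := by
        intro s hs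
        rw [le_div_iff₀ hL1]
        refine (CompatSystem.card_levelSet_mul_le L (X N s ω)).trans ?_
        have h1 := (hX N).le_add_of_generator_le hlam hu (CompatSystem.tailMass_le 0 L) (ω := ω)
          (t := s) (c := A) fun r _ =>
            ((G N).generator_tailMass_le_numDisp d hlam hu 0 L _).trans hA'
        have h2 := hω1 s hs
        have h3 : A * s ≤ A * T := mul_le_mul_of_nonneg_left (NNReal.coe_le_coe.2 hs) hA0
        linarith
      refine ⟨t, ht, ?_⟩
      have h1 := (hX N).le_add_of_generator_le hlam hu (CompatSystem.tailMass_le L R) (ω := ω)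
        (t := t) (c := A * C * (B / L)) fun s hs => by
          refine ((G N).generator_tailMass_le_level hlam hu hN L R _).trans ?_
          exact mul_le_mul (mul_le_mul_of_nonneg_right hA' hC) (hlev s (hs.trans ht))
            (by positivity) (by positivity)
      have h2 : A * C * (B / L) * t ≤ A * C * (B / L) * T :=
        mul_le_mul_of_nonneg_left (NNReal.coe_le_coe.2 ht) (by positivity)
      have h3 : CompatSystem.tailMass L R (X N 0 ω) ≤ θ * ε / 4 + θ * ε / 4 := by
        refine ((G N).tailMass_le_tailSum L R _).trans
          ((tailSum_le_add ((G N).occ (X N 0 ω)) q0 (L + 1) R).trans (add_le_add ?_ ?_))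
        · have hq : ∀ a, 0 ≤ q0 a := fun a => (hq0.1 a).1
          have hLL : L₀ ≤ L + 1 :=
            ((le_max_left L₀ 1).trans (le_max_left _ _)).trans (Nat.le_succ L)
          refine (tailSum_mono hLL hq).trans ((le_of_eq ?_).trans (hL₀ (L + 1 - L₀ + R)))
          exact Finset.sum_congr rfl fun m _ => Finset.sum_congr rfl fun l _ =>
            (abs_of_nonneg (hq _)).symm
        · exact hω0.trans (min_le_right _ _)
      linarith
    · intro R R' hR ω hω
      obtain ⟨⟨t, ht, htail⟩, hgood⟩ := hω
      exact ⟨⟨t, ht, htail.trans_le (CompatSystem.tailMass_mono L _ hR)⟩, hgood⟩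
  · filter_upwards [hserv] with N hN
    rintro ω ⟨t, ht, R, htail⟩
    by_cases hω : ω ∈ Bad N
    · exact Or.inl hω
    · refine Or.inr (Set.mem_iUnion.2 ⟨R, ⟨t, ht, ?_⟩, hω⟩)
      exact (mul_lt_mul_of_pos_left htail hθ).trans_le ((G N).mul_tailSum_le hN L R _)

/-- Every coordinate of the occupancy process asymptotically solves its integral equation. -/
theorem asympNull_coord (h : LimitRegime G xi w v p) (hd : 1 ≤ d) (hlam : 0 ≤ lam)
    (hu : ∀ m, 0 ≤ u m) (hX : ∀ N, (G N).IsQueueChain d lam u (P N) (X N))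
    (hinit : ∀ κ, 0 < κ → AsympNull P fun N => {ω | κ < ‖(G N).occ (X N 0 ω) - q0‖})
    (T : ℝ≥0) {η : ℝ} (hη : 0 < η) (m : Fin M) (l : ℕ) :
    AsympNull P fun N => {ω | ∃ t ≤ T, η < |(G N).occFun (X N t ω) (m, l + 1) - q0 (m, l + 1) -
      ∫ s in (0 : ℝ)..t, polyRHS d lam xi u v w p ((G N).occFun (X N s.toNNReal ω)) m l|} := by
  obtain ⟨θ, hθ, hserv⟩ := h.exists_le_card_servOf
  have hη3 : 0 < η / 3 := by positivity
  have hηT : 0 < η / (3 * (T + 1)) := by positivity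
  obtain ⟨r, hr, hmax⟩ := exists_maximal_rate h.prop hlam hu hX T θ⁻¹ hη3
  have habs : ∀ (N : ℕ) (x : Fin N → ℕ) a, |(G N).occFun x a| ≤ 1 := fun N x a => by
    rw [abs_of_nonneg ((G N).occFun_mem_Icc x a).1]
    exact ((G N).occFun_mem_Icc x a).2
  have hnull : AsympNull P fun N => {ω | ∃ t ≤ T, η / 3 < |(G N).occFun (X N t ω) (m, l + 1) -
      (G N).occFun (X N 0 ω) (m, l + 1) - ∫ s in (0 : ℝ)..t,
        (G N).generator d lam u (fun x => (G N).occFun x (m, l + 1)) (X N s.toNNReal ω)|} := by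
    refine AsympNull.of_le hr ?_
    filter_upwards [hserv, eventually_gt_atTop 0] with N hN hN0
    have hN' : (0 : ℝ) < N := by exact_mod_cast hN0
    have hb : 1 / (((G N).servOf m).card : ℝ) ≤ θ⁻¹ / N := by
      have h1 := hN m
      rw [le_div_iff₀ hN'] at h1
      rw [inv_eq_one_div, div_div]
      exact one_div_le_one_div_of_le (by positivity) h1
    exact hmax N (fun x => (G N).occFun x (m, l + 1)) 1 (fun x => habs N x _)
      (fun x j => ((G N).abs_occFun_update_succ_le x m l j).trans hb)
      (fun x j => ((G N).abs_occFun_update_pred_le x m l j).trans hb)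
  refine ((hinit _ hη3).union hnull).mono ?_
  filter_upwards [h.unifClose_generator hd lam u m _ hηT] with N hN
  rintro ω ⟨t, ht, hlt⟩
  by_contra hω
  simp only [Set.mem_union, Set.mem_ofPred_eq, not_or, not_lt, not_exists, not_and] at hω
  have h1 := (OccSpace.abs_apply_le ((G N).occ (X N 0 ω) - q0) (m, l + 1)).trans hω.1
  have h2 := hω.2 t ht
  have hocc := fun a => (hX N).isBddRightCts fun x => habs N x a
  have hg := (hX N).isBddRightCts ((G N).abs_generator_le d hlam hu fun x => habs N x (m, l + 1))
  have hint := intervalIntegrable_polyRHS (d := d) (lam := lam) (xi := xi) (u := u) (v := v)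
    (w := w) (p := p) (fun a => (hocc a).measurable_path ω)
    (fun s a => (G N).occFun_mem_Icc (X N s.toNNReal ω) a) m l 0 t
  have h3 : |(∫ s in (0 : ℝ)..t,
        (G N).generator d lam u (fun x => (G N).occFun x (m, l + 1)) (X N s.toNNReal ω)) -
      ∫ s in (0 : ℝ)..t, polyRHS d lam xi u v w p ((G N).occFun (X N s.toNNReal ω)) m l| ≤
      η / 3 := by
    rw [← intervalIntegral.integral_sub (hg.intervalIntegrable ω _ _) hint]
    have h4 := intervalIntegral.norm_integral_le_of_norm_le_const (a := (0 : ℝ)) (b := t)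
      (f := fun s => (G N).generator d lam u (fun x => (G N).occFun x (m, l + 1))
        (X N s.toNNReal ω) - polyRHS d lam xi u v w p ((G N).occFun (X N s.toNNReal ω)) m l)
      (C := η / (3 * (T + 1))) fun s _ => hN (X N s.toNNReal ω, l)
    rw [sub_zero, abs_of_nonneg t.coe_nonneg, Real.norm_eq_abs] at h4
    refine h4.trans ?_
    have h5 : (t : ℝ) ≤ T + 1 := (NNReal.coe_le_coe.2 ht).trans (by linarith)
    calc _ ≤ η / (3 * (T + 1)) * (T + 1 : ℝ) := mul_le_mul_of_nonneg_left h5 hηT.le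
      _ = η / 3 := by field_simp
  have h4 : |(G N).occFun (X N 0 ω) (m, l + 1) - q0 (m, l + 1)| ≤ η / 3 := h1
  rw [abs_le] at h2 h3 h4
  exact absurd hlt (not_lt.2 (abs_le.2 ⟨by linarith [h2.1, h3.1, h4.1],
    by linarith [h2.2, h3.2, h4.2]⟩))

/-- With high probability, the path of the occupancy process is an approximate solution. -/
theorem asympNull_not_isApproxSol (h : LimitRegime G xi w v p) (hd : 1 ≤ d) (hlam : 0 ≤ lam)
    (hu : ∀ m, 0 ≤ u m) (hX : ∀ N, (G N).IsQueueChain d lam u (P N) (X N)) (hq0 : q0 ∈ occSet M)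
    (hinit : ∀ κ, 0 < κ → AsympNull P fun N => {ω | κ < ‖(G N).occ (X N 0 ω) - q0‖})
    (T : ℝ≥0) {η : ℝ} (hη : 0 < η) :
    AsympNull P fun N => {ω | ¬ IsApproxSol d lam xi u v w p T η q0
      fun t => (G N).occFun (X N t ω)} := by
  obtain ⟨D, hD, hpoly⟩ := exists_abs_polyRHS_le_mul d lam xi u v w p
  -- tails below `ζ` make the integral equation hold up to `η` beyond the level `L`: `hζη`
  set ζ := η / (4 * (1 + D * T)) with hζ
  have hζ0 : 0 < ζ := by positivity
  have hη4 : 0 < η / 4 := by positivity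
  have hζη : ζ + D * ζ * T = η / 4 := by rw [hζ]; field_simp
  have hDT : 0 ≤ D * ζ * T := by positivity
  obtain ⟨L, hL⟩ := asympNull_tailSum h hd hlam hu hX hq0 hinit T hζ0
  have hcoord := AsympNull.biUnion (Finset.univ ×ˢ Finset.range L) fun (a : Fin M × ℕ) _ =>
    asympNull_coord h hd hlam hu hX hinit T hη a.1 a.2
  refine ((hL.union (hinit _ hη4)).union hcoord).mono ?_
  filter_upwards [h.eventually_occFun_mem] with N hmem ω hω
  by_contra hgood
  simp only [Set.mem_union, Set.mem_ofPred_eq, not_or, not_lt, not_exists, not_and,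
    Set.mem_iUnion] at hgood
  obtain ⟨⟨htail, h0⟩, hc⟩ := hgood
  refine hω ⟨fun t => hmem _, fun a => ?_, fun t ht m l => ?_⟩
  · exact ((hX N).isBddRightCts (f := fun x => (G N).occFun x a) (B := 1) fun x => by
      rw [abs_of_nonneg ((G N).occFun_mem_Icc x a).1]
      exact ((G N).occFun_mem_Icc x a).2).measurable_path ω
  by_cases hl : l < L
  · exact hc (m, l) (by simpa using hl) t ht
  -- beyond the level `L` every term is small
  have hsmall : ∀ s ≤ T, ∀ l, L ≤ l → (G N).occFun (X N s ω) (m, l) ≤ ζ := fun s hs l hl =>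
    (le_tailSum (fun a => ((hmem _).1 a).1) hl m).trans (htail s hs _)
  have h1 : |(G N).occFun (X N 0 ω) (m, l + 1) - q0 (m, l + 1)| ≤ η / 4 :=
    (OccSpace.abs_apply_le ((G N).occ (X N 0 ω) - q0) (m, l + 1)).trans h0
  have h2 := hsmall t ht (l + 1) (by omega)
  have h3 := hsmall 0 zero_le (l + 1) (by omega)
  have h4 : |∫ s in (0 : ℝ)..t, polyRHS d lam xi u v w p ((G N).occFun (X N s.toNNReal ω)) m l| ≤
      D * ζ * T := by
    have h5 := intervalIntegral.norm_integral_le_of_norm_le_const (a := (0 : ℝ)) (b := t)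
      (f := fun s => polyRHS d lam xi u v w p ((G N).occFun (X N s.toNNReal ω)) m l)
      (C := D * ζ) fun s hs => by
        rw [Set.uIoc_of_le t.coe_nonneg] at hs
        exact (hpoly _ (hmem _) m l).trans (mul_le_mul_of_nonneg_left
          (hsmall _ ((Real.toNNReal_le_iff_le_coe.2 hs.2).trans ht) l (not_lt.1 hl)) hD.le)
    rw [sub_zero, abs_of_nonneg t.coe_nonneg, Real.norm_eq_abs] at h5
    exact h5.trans (mul_le_mul_of_nonneg_left (NNReal.coe_le_coe.2 ht) (by positivity))
  have h5 := ((hmem (X N t ω)).1 (m, l + 1)).1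
  have h6 := ((hmem (X N 0 ω)).1 (m, l + 1)).1
  have h7 := (hq0.1 (m, l + 1)).1
  rw [abs_le] at h1 h4
  exact abs_le.2 ⟨by linarith [h1.1, h4.2], by linarith [h1.2, h4.1]⟩

end Control

/-! ### Convergence in distribution to a constant -/

section Constant

variable {Ω : ℕ → Type*} [∀ N, MeasurableSpace (Ω N)] {P : ∀ N, Measure (Ω N)}
  [∀ N, IsProbabilityMeasure (P N)] {E : Type*} [PseudoEMetricSpace E] [MeasurableSpace E]
  [BorelSpace E] {Y : ∀ N, Ω N → E} {c : E}

theorem tendstoInDistribution_of_asympNull (hY : ∀ N, Measurable (Y N))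
    (h : ∀ ε : ℝ, 0 < ε → AsympNull P fun N => {ω | ENNReal.ofReal ε < edist (Y N ω) c}) :
    TendstoInDistribution Y atTop (fun _ : Unit => c) P (Measure.dirac ()) where
  forall_aemeasurable N := (hY N).aemeasurable
  aemeasurable_limit := aemeasurable_const
  tendsto := by
    refine tendsto_of_forall_isOpen_le_liminf' fun U hU => ?_
    change (Measure.dirac ()).map (fun _ : Unit => c) U ≤
      liminf (fun N => (P N).map (Y N) U) atTop
    rw [Measure.map_dirac' measurable_const]
    by_cases hc : c ∈ U
    · rw [Measure.dirac_apply_of_mem hc]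
      obtain ⟨ε, hε, hball⟩ := EMetric.isOpen_iff.1 hU c hc
      obtain ⟨δ, hδ, hδε⟩ : ∃ δ : ℝ, 0 < δ ∧ ENNReal.ofReal δ < ε := by
        obtain ⟨δ, -, h0, h1⟩ := ENNReal.lt_iff_exists_real_btwn.1 hε
        exact ⟨δ, ENNReal.ofReal_pos.1 h0, h1⟩
      have h1 : Tendsto (fun N => 1 - P N {ω | ENNReal.ofReal δ < edist (Y N ω) c}) atTop
          (𝓝 1) := by
        have := ENNReal.Tendsto.sub (tendsto_const_nhds (x := (1 : ℝ≥0∞))) (h δ hδ)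
          (Or.inl ENNReal.one_ne_top)
        rwa [tsub_zero] at this
      refine h1.liminf_eq.ge.trans (liminf_le_liminf (Eventually.of_forall fun N => ?_))
      rw [Measure.map_apply (hY N) hU.measurableSet, tsub_le_iff_right, ← measure_univ (μ := P N)]
      refine (measure_mono fun ω _ => ?_).trans (measure_union_le _ _)
      by_cases hω : ENNReal.ofReal δ < edist (Y N ω) c
      · exact Or.inr hω
      · exact Or.inl (hball ((not_lt.1 hω).trans_lt hδε))
    · rw [Measure.dirac_apply' _ hU.measurableSet, Set.indicator_of_notMem hc]
      exact zero_le

theorem asympNull_of_tendstoInDistribution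
    (h : TendstoInDistribution Y atTop (fun _ : Unit => c) P (Measure.dirac ())) {ε : ℝ}
    (hε : 0 < ε) : AsympNull P fun N => {ω | ENNReal.ofReal ε < edist (Y N ω) c} := by
  have hF : IsClosed {y : E | ENNReal.ofReal ε ≤ edist y c} :=
    isClosed_le continuous_const (continuous_id.edist continuous_const)
  have h0 : (Measure.dirac ()).map (fun _ : Unit => c)
      {y : E | ENNReal.ofReal ε ≤ edist y c} = 0 := by
    rw [Measure.map_dirac' measurable_const, Measure.dirac_apply' _ hF.measurableSet,
      Set.indicator_of_notMem]
    simpa using hε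
  have h1 := ProbabilityMeasure.tendsto_measure_of_null_frontier_of_tendsto' h.tendsto
    (E := {y : E | ENNReal.ofReal ε ≤ edist y c}) (measure_mono_null hF.frontier_subset h0)
  change Tendsto (fun N => (P N).map (Y N) _) _ (𝓝 ((Measure.dirac ()).map (fun _ : Unit => c) _))
    at h1
  rw [h0] at h1
  refine AsympNull.of_le h1 (Eventually.of_forall fun N => ?_)
  rw [Measure.map_apply_of_aemeasurable (h.forall_aemeasurable N) hF.measurableSet]
  exact measure_mono fun ω hω => show ENNReal.ofReal ε ≤ _ from le_of_lt hω

end Constant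

/-- Uniform closeness implies closeness in the Skorokhod space, by the trivial time change. -/
theorem SkorokhodSpace.edist_le {T : ℝ≥0} {E : Type*} [PseudoEMetricSpace E]
    {x y : SkorokhodSpace T E} {ε : ℝ≥0∞} (h : ∀ t, edist (x.1 t) (y.1 t) ≤ ε) :
    edist x y ≤ ε := by
  refine (iInf_le _ (OrderIso.refl _)).trans (max_le ?_ (iSup_le h))
  simp

end

/-! ### Convergence of the occupancy process -/

theorem mainTheorem2 {K M : ℕ} (d : ℕ) (hd : 2 ≤ d) (lam xi : ℝ) (hlam : 0 < lam) (hxi : 0 < xi)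
    (u v : Fin M → ℝ) (hu : ∀ m, 0 < u m) (hv : ∀ m, 0 < v m) (hvsum : ∑ m, v m = 1)
    (w : Fin K → ℝ) (hw : ∀ k, 0 < w k) (hwsum : ∑ k, w k = 1)
    (p : Fin K → Fin M → ℝ) (hp : ∀ k, 0 < limDeg v p k)
    (G : ∀ N, CompatSystem K M N) (hprop : HasProportions G xi w v)
    (hcompat : HasCompatMatrix G p) (hsparse : ClusteredProportionallySparse G)
    {Ω : ℕ → Type*} [∀ N, MeasurableSpace (Ω N)] (P : ∀ N, Measure (Ω N))
    [∀ N, IsProbabilityMeasure (P N)] (X : ∀ N, ℝ≥0 → Ω N → Fin N → ℕ)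
    (hX : ∀ N, (G N).IsQueueChain d lam u (P N) (X N))
    (q0 : OccSpace M) (hq0 : q0 ∈ occSet M)
    (hinit : TendstoInDistribution (fun N ω => (G N).occ (X N 0 ω)) atTop
      (fun _ : Unit => q0) P (Measure.dirac ())) :
    ∃ (q : ℝ≥0 → OccSpace M) (hq : Continuous q),
      (∀ t, q t ∈ occSet M) ∧
      IsODESolution d lam xi u v w p q0 (fun t => q t) ∧
      (∀ y, IsODESolution d lam xi u v w p q0 y → y = fun t => (q t : Fin M × ℕ → ℝ)) ∧
      ∀ T : ℝ≥0, 0 < T →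
        TendstoInDistribution
          (fun N ω => (G N).occPath T (fun t => X N t ω) ((hX N).cadlag ω)) atTop
          (fun _ : Unit => SkorokhodSpace.ofContinuous T q hq) P (Measure.dirac ()) := by
  have hd1 : 1 ≤ d := one_le_two.trans hd
  have hu0 : ∀ m, 0 ≤ u m := fun m => (hu m).le
  have h : LimitRegime G xi w v p := ⟨hprop, hcompat, hsparse, hxi, hw, hv, hp⟩
  have hinit' : ∀ κ, 0 < κ → AsympNull P fun N => {ω | κ < ‖(G N).occ (X N 0 ω) - q0‖} := by
    intro κ hκ
    refine (asympNull_of_tendstoInDistribution hinit hκ).mono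
      (Eventually.of_forall fun N ω hω => ?_)
    change ENNReal.ofReal κ < edist _ _
    rw [edist_dist, dist_eq_norm]
    exact (ENNReal.ofReal_lt_ofReal_iff_of_nonneg hκ.le).2 hω
  have hsol := fun (T : ℝ≥0) (η : ℝ) (hη : 0 < η) =>
    asympNull_not_isApproxSol (w := w) (xi := xi) h hd1 hlam.le hu0 hX hq0 hinit' T hη
  obtain ⟨q, hq, hmem, hode, huniq, hclose⟩ := exists_odeSolution (d := d) (lam := lam) (xi := xi)
    (u := u) (w := w) hv h.p_nonneg hp hq0 fun T ε hε => by
      obtain ⟨L, hL⟩ := asympNull_tailSum h hd1 hlam.le hu0 hX hq0 hinit' T hε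
      refine ⟨L, fun η hη => ?_⟩
      -- a path of one of the processes, taken from the event of high probability
      obtain ⟨N, ω, hω⟩ := (hL.union (hsol T η hη)).exists_notMem.exists
      simp only [Set.mem_union, Set.mem_ofPred_eq, not_or, not_lt, not_exists, not_and,
        not_not] at hω
      exact ⟨_, hω.2, hω.1⟩
  refine ⟨q, hq, hmem, hode, huniq, fun T hT => ?_⟩
  refine tendstoInDistribution_of_asympNull (fun N => ?_) fun ε hε => ?_
  · exact measurable_skorokhod_path (fun t => (hX N).measurable t) (hX N).cadlag
      (e := (G N).occ) continuous_of_discreteTopology hT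
  · obtain ⟨L, hL⟩ := asympNull_tailSum h hd1 hlam.le hu0 hX hq0 hinit' T
      (show 0 < ε / 4 by positivity)
    obtain ⟨η, hη, hdist⟩ := hclose T ε hε L
    refine (hL.union (hsol T η hη)).mono (Eventually.of_forall fun N ω hω => ?_)
    by_contra hgood
    simp only [Set.mem_union, Set.mem_ofPred_eq, not_or, not_lt, not_exists, not_and,
      not_not] at hgood
    refine absurd hω (not_lt.2 (SkorokhodSpace.edist_le fun t => ?_))
    change edist ((G N).occ (X N t ω)) (q t) ≤ _
    rw [edist_dist, dist_eq_norm]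
    exact ENNReal.ofReal_le_ofReal
      (hdist (fun t => (G N).occ (X N t ω)) hgood.2 hgood.1 t t.2.2)
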